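/- **Setting.** An *orthogonal polygon* is a nonempty bounded region $P\subset\mathbb R^2$, equal to the closure of its interior, whose boundary consists of finitely many axis-parallel line segments (holes are allowed). An *orthogonal dissection* of $P$ into rectangles $R_1,\dots,R_r$ is a subdivision of $P$ into finitely many orthogonal polygons with disjoint interiors, together with translations of these pieces (no rotations) such that the translated pieces can be grouped into subdivisions of $R_1,\dots,R_r$; rectangles are axis-parallel and nondegenerate. A *rational basis* is a finite family of real numbers that is linearly independent over $\mathbb Q$. An input over an $x$-basis $x_1,\dots,x_m$ and a $y$-basis $y_1,\dots,y_n$ (possibly the same) consists of $V$ vertices, each given by the vectors of rational coefficients of its $x$-coordinate over the $x$-basis and of its $y$-coordinate over the $y$-basis, and of the successor of each vertex along the boundary; the sides from each vertex to its successor are nondegenerate axis-parallel segments that meet only in common endpoints, together form the boundary of $P$, and have the interior of $P$ on their left. Its *size* is $V(m+n)$. The *Dehn matrix* of the input is the rational $n\times m$ matrix $D$ with $$D_{kj}=\sum_{v}\bigl(\eta_k(b)-\eta_k(v)\bigr)\bigl(\xi_j(v')-\xi_j(v)\bigr),$$ where $v$ runs over the vertices, $v'$ is the successor of $v$, $\xi_j$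 and $\eta_k$ are the coefficients of the $x$- and $y$-coordinates, and $b$ is any fixed vertex (the choice does not matter): the sum of the outer products of height and width of the signed rectangles between the horizontal sides and the horizontal line through $b$. *Model of computation.* An algorithm is one fixed finite program, the same for all bases and inputs, working on indices (assignment of constants and copies, incrementing, decrementing, comparison, and indexed access to arrays) and on arrays of rational numbers (constants, copying, $+,-,\times,\div$, comparison). Every elementary operation and every test counts as one step. *Arithmetic over the given bases* provides in addition, at one step each and for numbers given by their rational coefficients, (i) the sign of a rational combination of $x$-basis elements, of $y$-basis elements, or of products $y_kx_j$; (ii) for two numbers $u<v$, both of the same one of these three kinds, some rational number strictly between them (with no assumption on which one is returned). **Theorem.** 1. There are an algorithm that uses only rational arithmetic (with no access to the values of the basis elements) and a polynomial $p$ such that, for all rational bases and every input over them of size $N$ that describes an orthogonal polygon $P$, the algorithm halts after at most $p(N)$ steps and outputs the minimum number of rectangles into which $P$ has an orthogonal dissection. This number equals the rank of the Dehn matrix of the input. 2. There are an algorithm that uses arithmetic over the given bases and a polynomial $p$ such that, for all rational bases and every input over them of size $N$ that describes an orthogonal polygon $P$, the algorithm halts after at most $p(N)$ steps and outputs the minimum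 number $r$ of rectangles into which $P$ has an orthogonal dissection, together with $r$ rectangles into which $P$ has an orthogonal dissection, given by the rational coefficients of their (positive) widths over the $x$-basis and of their (positive) heights over the $y$-basis. -/

import Mathlib

open Filter Topology

noncomputable section

namespace OrthoDissection

/-! ### Orthogonal polygons and orthogonal dissections -/

/-- The plane. Only its topology and its real vector space structure are used. -/
abbrev Plane : Type := ℝ × ℝ

/-- An orthogonal polygon: a (nonempty) bounded region of the plane, identified with the closure of
its interior, whose boundary consists of finitely many axis-parallel line segments.
Holes are allowed, and connectedness is not required. -/
def IsOrthogonalPolygon (P : Set Plane) : Prop :=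
  P.Nonempty ∧ Bornology.IsBounded P ∧ closure (interior P) = P ∧
    ∃ S : Set (Plane × Plane), S.Finite ∧
      (∀ s ∈ S, s.1.1 = s.2.1 ∨ s.1.2 = s.2.2) ∧
      frontier P = ⋃ s ∈ S, segment ℝ s.1 s.2

/-- The sets `A i` subdivide `P`: their union is `P` and their interiors are pairwise disjoint. -/
def Subdivides {ι : Type} (A : ι → Set Plane) (P : Set Plane) : Prop :=
  (⋃ i, A i) = P ∧ ∀ i j, i ≠ j → Disjoint (interior (A i)) (interior (A j))

/-- `P` has an orthogonal dissection into the family of regions `R j`: `P` can be cut along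
axis-parallel segments into finitely many pieces `A i`, which after translation by `t i`
(no rotation) are reassembled, the pieces with `c i = j` forming `R j`. -/
def DissectsInto (P : Set Plane) {r : ℕ} (R : Fin r → Set Plane) : Prop :=
  ∃ (N : ℕ) (A : Fin N → Set Plane) (t : Fin N → Plane) (c : Fin N → Fin r),
    (∀ i, IsOrthogonalPolygon (A i)) ∧
    Subdivides A P ∧
    ∀ j, Subdivides (fun i : {i : Fin N // c i = j} => (fun p : Plane => p + t i) '' A i) (R j)

/-- The axis-parallel rectangle of width `w` and height `h` (up to translation). -/
def rectangle (w h : ℝ) : Set Plane := Set.Icc (0, 0) (w, h)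

/-- `P` has an orthogonal dissection into `r` (nondegenerate, axis-parallel) rectangles. -/
def DissectsIntoRectangles (P : Set Plane) (r : ℕ) : Prop :=
  ∃ w h : Fin r → ℝ, (∀ j, 0 < w j ∧ 0 < h j) ∧ DissectsInto P fun j => rectangle (w j) (h j)

/-! ### Polygons with coordinates over rational bases -/

/-- The number represented by the coefficient vector `a` over the basis `b`. -/
def comb {ι : Type} [Fintype ι] (b : ι → ℝ) (a : ι → ℚ) : ℝ := ∑ i, (a i : ℝ) * b i

/-- The description of a polygon over an `x`-basis with `m` and a `y`-basis with `n` elements: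
the vectors of rational coefficients of its vertices, and for each vertex the next vertex along the
(oriented) boundary; the cycles of `next` are the boundary components. -/
structure PolygonInput (m n : ℕ) where
  /-- the number of vertices -/
  V : ℕ
  /-- coefficients of the `x`-coordinates -/
  xc : Fin V → Fin m → ℚ
  /-- coefficients of the `y`-coordinates -/
  yc : Fin V → Fin n → ℚ
  /-- the next vertex along the boundary -/
  next : Equiv.Perm (Fin V)

namespace PolygonInput

variable {m n : ℕ}

/-- The size of an input: the number of its rational coefficients. -/
def size (I : PolygonInput m n) : ℕ := I.V * (m + n)

/-- The vertex `v` as a point of the plane. -/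
def pt (I : PolygonInput m n) (xb : Fin m → ℝ) (yb : Fin n → ℝ) (v : Fin I.V) : Plane :=
  (comb xb (I.xc v), comb yb (I.yc v))

/-- The side from `v` to the next vertex. -/
def side (I : PolygonInput m n) (xb : Fin m → ℝ) (yb : Fin n → ℝ) (v : Fin I.V) : Set Plane :=
  segment ℝ (I.pt xb yb v) (I.pt xb yb (I.next v))

/-- The direction of the side from `v` to the next vertex, rotated by a right angle to the left. -/
def leftNormal (I : PolygonInput m n) (xb : Fin m → ℝ) (yb : Fin n → ℝ) (v : Fin I.V) : Plane :=
  ((I.pt xb yb v).2 - (I.pt xb yb (I.next v)).2, (I.pt xb yb (I.next v)).1 - (I.pt xb yb v).1)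

/-- The input describes the orthogonal polygon `P`: its sides are nondegenerate axis-parallel
segments which form the boundary of `P`, meet only in common endpoints (so there are no crossings or
overlaps), and have the interior of `P` on their left. -/
structure Describes (I : PolygonInput m n) (xb : Fin m → ℝ) (yb : Fin n → ℝ) (P : Set Plane) :
    Prop where
  polygon : IsOrthogonalPolygon P
  nondegenerate : ∀ v, I.pt xb yb v ≠ I.pt xb yb (I.next v)
  axisParallel : ∀ v, (I.pt xb yb v).1 = (I.pt xb yb (I.next v)).1 ∨
    (I.pt xb yb v).2 = (I.pt xb yb (I.next v)).2
  boundary : frontier P = ⋃ v, I.side xb yb v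
  noCrossing : ∀ v w, v ≠ w → I.side xb yb v ∩ I.side xb yb w ⊆
    {I.pt xb yb v, I.pt xb yb (I.next v)} ∩ {I.pt xb yb w, I.pt xb yb (I.next w)}
  interiorLeft : ∀ v, ∀ q ∈ openSegment ℝ (I.pt xb yb v) (I.pt xb yb (I.next v)),
    ∀ᶠ ε in 𝓝[>] (0 : ℝ), q + ε • I.leftNormal xb yb v ∈ interior P ∧
      q - ε • I.leftNormal xb yb v ∉ P

/-- The Dehn matrix, with rows indexed by the `y`-basis and columns by the `x`-basis: the sum of
the outer products (height times width) of the signed rectangles between the sides of the polygon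
and the horizontal base line through the vertex `b`. A side directed to the right has the polygon
above it and so counts negatively. (Vertical sides have width zero and contribute nothing.) -/
def dehnMatrix (I : PolygonInput m n) (b : Fin I.V) : Matrix (Fin n) (Fin m) ℚ :=
  fun k j => ∑ v, (I.yc b k - I.yc v k) * (I.xc (I.next v) j - I.xc v j)

end PolygonInput

/-! ### Programs with a step count

Programs of a fixed finite length, working on registers and arrays of indices (natural numbers, for
loops and addressing only) and on two-dimensional arrays of rational numbers. -/

/-- A memory state. -/
structure State where
  /-- index registers -/
  reg : ℕ → ℕ
  /-- arrays of indices -/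
  tab : ℕ → ℕ → ℕ
  /-- two-dimensional arrays of rational numbers -/
  mat : ℕ → ℕ → ℕ → ℚ

/-- A rational memory cell, the entry of the array `arr` whose row and column are the contents of
the index registers `row` and `col`. -/
structure Cell where
  arr : ℕ
  row : ℕ
  col : ℕ

/-- The four operations of rational arithmetic. -/
inductive ArithOp where
  | add | sub | mul | div

/-- The value of an arithmetic operation (division by zero returns zero). -/
def ArithOp.eval : ArithOp → ℚ → ℚ → ℚ
  | add, a, b => a + b
  | sub, a, b => a - b
  | mul, a, b => a * b
  | div, a, b => a / b

namespace State

/-- Read a rational cell. -/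
def get (s : State) (c : Cell) : ℚ := s.mat c.arr (s.reg c.row) (s.reg c.col)

/-- Write a rational cell. -/
def put (s : State) (c : Cell) (q : ℚ) : State :=
  { s with mat := fun a i j =>
      if a = c.arr ∧ i = s.reg c.row ∧ j = s.reg c.col then q else s.mat a i j }

/-- Write an index register. -/
def setReg (s : State) (d k : ℕ) : State :=
  { s with reg := fun i => if i = d then k else s.reg i }

/-- Write an entry of an array of indices. -/
def setTab (s : State) (a i k : ℕ) : State :=
  { s with tab := fun b j => if b = a ∧ j = i then k else s.tab b j }

end State

/-- Programs over rational arithmetic, with additional primitive operations named by `Q`. -/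
inductive Program (Q : Type) where
  /-- do nothing -/
  | skip
  /-- index register `d` becomes the literal `k` -/
  | setReg (d k : ℕ)
  /-- index register `d` becomes a copy of register `i` -/
  | copyReg (d i : ℕ)
  /-- increment index register `d` -/
  | inc (d : ℕ)
  /-- decrement index register `d` (truncated at zero) -/
  | dec (d : ℕ)
  /-- index register `d` becomes the entry of the index array `a` at the content of register `i` -/
  | load (d a i : ℕ)
  /-- the entry of the index array `a` at the content of `i` becomes the content of `d` -/
  | store (a i d : ℕ)
  /-- the cell `c` becomes the rational literal `q` -/
  | const (c : Cell) (q : ℚ)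
  /-- the cell `c` becomes a copy of the cell `c₁` -/
  | move (c c₁ : Cell)
  /-- the cell `c` becomes the result of an arithmetic operation on two cells -/
  | arith (o : ArithOp) (c c₁ c₂ : Cell)
  /-- an additional primitive operation -/
  | prim (q : Q)
  /-- sequential composition -/
  | seq (p₁ p₂ : Program Q)
  /-- if register `i` is less than register `j` then `p₁` else `p₂` -/
  | ifReg (i j : ℕ) (p₁ p₂ : Program Q)
  /-- if cell `c₁` is less than cell `c₂` then `p₁` else `p₂` -/
  | ifRat (c₁ c₂ : Cell) (p₁ p₂ : Program Q)
  /-- while register `i` is less than register `j` do `p` -/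
  | loop (i j : ℕ) (p : Program Q)

/-- `Exec f p s t s'`: started in `s`, the program `p` halts after `t` steps in `s'`, where the
additional primitive operation `q` acts by `f q`. Every elementary operation and every test, on
indices as on rational numbers, counts as one step. -/
inductive Exec {Q : Type} (f : Q → State → State) : Program Q → State → ℕ → State → Prop where
  | skip (s : State) : Exec f .skip s 1 s
  | setReg (s : State) (d k : ℕ) : Exec f (.setReg d k) s 1 (s.setReg d k)
  | copyReg (s : State) (d i : ℕ) : Exec f (.copyReg d i) s 1 (s.setReg d (s.reg i))
  | inc (s : State) (d : ℕ) : Exec f (.inc d) s 1 (s.setReg d (s.reg d + 1))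
  | dec (s : State) (d : ℕ) : Exec f (.dec d) s 1 (s.setReg d (s.reg d - 1))
  | load (s : State) (d a i : ℕ) : Exec f (.load d a i) s 1 (s.setReg d (s.tab a (s.reg i)))
  | store (s : State) (a i d : ℕ) : Exec f (.store a i d) s 1 (s.setTab a (s.reg i) (s.reg d))
  | const (s : State) (c : Cell) (q : ℚ) : Exec f (.const c q) s 1 (s.put c q)
  | move (s : State) (c c₁ : Cell) : Exec f (.move c c₁) s 1 (s.put c (s.get c₁))
  | arith (s : State) (o : ArithOp) (c c₁ c₂ : Cell) :
      Exec f (.arith o c c₁ c₂) s 1 (s.put c (o.eval (s.get c₁) (s.get c₂)))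
  | prim (s : State) (q : Q) : Exec f (.prim q) s 1 (f q s)
  | seq {p₁ p₂ : Program Q} {s s₁ s₂ : State} {t₁ t₂ : ℕ} :
      Exec f p₁ s t₁ s₁ → Exec f p₂ s₁ t₂ s₂ → Exec f (.seq p₁ p₂) s (t₁ + t₂) s₂
  | ifReg_true {i j : ℕ} {p₁ p₂ : Program Q} {s s' : State} {t : ℕ} :
      s.reg i < s.reg j → Exec f p₁ s t s' → Exec f (.ifReg i j p₁ p₂) s (t + 1) s'
  | ifReg_false {i j : ℕ} {p₁ p₂ : Program Q} {s s' : State} {t : ℕ} :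
      ¬ s.reg i < s.reg j → Exec f p₂ s t s' → Exec f (.ifReg i j p₁ p₂) s (t + 1) s'
  | ifRat_true {c₁ c₂ : Cell} {p₁ p₂ : Program Q} {s s' : State} {t : ℕ} :
      s.get c₁ < s.get c₂ → Exec f p₁ s t s' → Exec f (.ifRat c₁ c₂ p₁ p₂) s (t + 1) s'
  | ifRat_false {c₁ c₂ : Cell} {p₁ p₂ : Program Q} {s s' : State} {t : ℕ} :
      ¬ s.get c₁ < s.get c₂ → Exec f p₂ s t s' → Exec f (.ifRat c₁ c₂ p₁ p₂) s (t + 1) s'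
  | loop_stop {i j : ℕ} {p : Program Q} {s : State} :
      ¬ s.reg i < s.reg j → Exec f (.loop i j p) s 1 s
  | loop_step {i j : ℕ} {p : Program Q} {s s₁ s₂ : State} {t₁ t₂ : ℕ} :
      s.reg i < s.reg j → Exec f p s t₁ s₁ → Exec f (.loop i j p) s₁ t₂ s₂ →
      Exec f (.loop i j p) s (t₁ + t₂ + 1) s₂

/-- Programs using only rational arithmetic: there are no further primitive operations, and the
basis elements are not accessible. -/
abbrev RationalProgram : Type := Program Empty

/-- Execution of a program that uses only rational arithmetic. -/
def RationalExec (p : RationalProgram) (s : State) (t : ℕ) (s' : State) : Prop :=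
  Exec (fun q : Empty => q.elim) p s t s'

/-- The additional primitive operations of arithmetic over the bases. Combinations of `x`-basis or
of `y`-basis elements are given by a row of a rational array (its number and the index register that
holds the row), combinations of products of a `y`-basis and an `x`-basis element by a whole rational
array (its number). The result is written to the cell `c`. -/
inductive BasisOp where
  /-- the sign of a combination of `x`-basis elements -/
  | signX (c : Cell) (a i : ℕ)
  /-- the sign of a combination of `y`-basis elements -/
  | signY (c : Cell) (a i : ℕ)
  /-- the sign of a combination of products of basis elements -/
  | signXY (c : Cell) (a : ℕ)
  /-- a rational number between two combinations of `x`-basis elements -/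
  | betweenX (c : Cell) (a i a' i' : ℕ)
  /-- a rational number between two combinations of `y`-basis elements -/
  | betweenY (c : Cell) (a i a' i' : ℕ)
  /-- a rational number between two combinations of products of basis elements -/
  | betweenXY (c : Cell) (a a' : ℕ)

/-- The products of a `y`-basis element and an `x`-basis element. -/
def prodBasis {m n : ℕ} (xb : Fin m → ℝ) (yb : Fin n → ℝ) : Fin n × Fin m → ℝ :=
  fun i => yb i.1 * xb i.2

/-- `f` finds, given the coefficients of two numbers `x < y` over `b`, a rational number strictly
between `x` and `y`. -/
def FindsBetween {ι : Type} [Fintype ι] (b : ι → ℝ) (f : (ι → ℚ) → (ι → ℚ) → ℚ) : Prop :=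
  ∀ u v, comb b u < comb b v → comb b u < (f u v : ℝ) ∧ (f u v : ℝ) < comb b v

/-- A choice of the rational numbers returned by the operations that find a rational number between
two combinations of basis elements. -/
structure Between {m n : ℕ} (xb : Fin m → ℝ) (yb : Fin n → ℝ) where
  onX : (Fin m → ℚ) → (Fin m → ℚ) → ℚ
  onY : (Fin n → ℚ) → (Fin n → ℚ) → ℚ
  onXY : (Fin n × Fin m → ℚ) → (Fin n × Fin m → ℚ) → ℚ
  onX_spec : FindsBetween xb onX
  onY_spec : FindsBetween yb onY
  onXY_spec : FindsBetween (prodBasis xb yb) onXY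

/-- The first `k` entries of row `i` of the rational array `a`. -/
def State.row (s : State) (k a i : ℕ) : Fin k → ℚ := fun j => s.mat a i j

/-- The upper left `n × m` block of the rational array `a`. -/
def State.block (s : State) (n m a : ℕ) : Fin n × Fin m → ℚ := fun ij => s.mat a ij.1 ij.2

/-- The sign of a real number, as one of the rational numbers `-1`, `0`, `1`. -/
def ratSign (x : ℝ) : ℚ := if x < 0 then -1 else if x = 0 then 0 else 1

/-- The action of the additional primitive operations. -/
def BasisOp.act {m n : ℕ} (xb : Fin m → ℝ) (yb : Fin n → ℝ) (B : Between xb yb) :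
    BasisOp → State → State
  | .signX c a i, s => s.put c (ratSign (comb xb (s.row m a (s.reg i))))
  | .signY c a i, s => s.put c (ratSign (comb yb (s.row n a (s.reg i))))
  | .signXY c a, s => s.put c (ratSign (comb (prodBasis xb yb) (s.block n m a)))
  | .betweenX c a i a' i', s => s.put c (B.onX (s.row m a (s.reg i)) (s.row m a' (s.reg i')))
  | .betweenY c a i a' i', s => s.put c (B.onY (s.row n a (s.reg i)) (s.row n a' (s.reg i')))
  | .betweenXY c a a', s => s.put c (B.onXY (s.block n m a) (s.block n m a'))

/-- Programs using rational arithmetic and the primitive operations over the bases. -/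
abbrev BasisProgram : Type := Program BasisOp

/-- Execution of a program with arithmetic over the bases `xb` and `yb`. -/
def BasisExec {m n : ℕ} (xb : Fin m → ℝ) (yb : Fin n → ℝ) (B : Between xb yb)
    (p : BasisProgram) (s : State) (t : ℕ) (s' : State) : Prop :=
  Exec (BasisOp.act xb yb B) p s t s'

/-- The initial memory state for an input: registers 0, 1, 2 hold the sizes of the bases and the
number of vertices, index array 0 the successors of the vertices, and the rational arrays 0 and 1
the coefficients of the `x`- and of the `y`-coordinates, one row for each vertex. All other memory
is zero. -/
def PolygonInput.encode {m n : ℕ} (I : PolygonInput m n) : State where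
  reg := fun i => if i = 0 then m else if i = 1 then n else if i = 2 then I.V else 0
  tab := fun a v => if h : a = 0 ∧ v < I.V then (I.next ⟨v, h.2⟩ : ℕ) else 0
  mat := fun a v j =>
    if h : a = 0 ∧ v < I.V ∧ j < m then I.xc ⟨v, h.2.1⟩ ⟨j, h.2.2⟩
    else if h : a = 1 ∧ v < I.V ∧ j < n then I.yc ⟨v, h.2.1⟩ ⟨j, h.2.2⟩
    else 0

/-- The number returned by a halted program. -/
def State.outNumber (s : State) : ℕ := s.reg 0

/-- The width of the `i`-th rectangle returned by a halted program, given by its coefficients over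
the `x`-basis in row `i` of the rational array 0. -/
def State.outWidth (s : State) {m : ℕ} (xb : Fin m → ℝ) (i : ℕ) : ℝ := comb xb (s.row m 0 i)

/-- The height of the `i`-th rectangle returned by a halted program, given by its coefficients over
the `y`-basis in row `i` of the rational array 1. -/
def State.outHeight (s : State) {n : ℕ} (yb : Fin n → ℝ) (i : ℕ) : ℝ := comb yb (s.row n 1 i)

end OrthoDissection

end

noncomputable section

namespace OrthoDissection

open Set

/-! ### Boxes -/

/-! Let `f` and `g` be `ℚ`-linear maps from `ℝ` to `ℚ`. Giving a box of width `w` and height `h` the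
value `f w * g h` defines a valuation that is additive under subdivision and invariant under
translation, hence under orthogonal dissection. It is realised as a linear functional `val f g` on
functions on the plane, applied to `chi A`, the indicator of the points whose upper right quadrant
germ lies in `A`. This convention makes closed boxes half-open, so shared boundaries do no harm.
Counting signed sides below a point (`Describes.chi_eq_winding`) turns the valuation of a polygon
into a sum over its sides, which is the bilinear form of the Dehn matrix `D`
(`Describes.val_chi_eq_dehnMatrix`).

Lower bound (`Describes.rank_dehnMatrix_le`): if `P` dissects into `r` rectangles, functionals dual
to the bases write `D` as a product with inner dimension `r`.

These valuations are the only obstruction (`Tiled.dissectsInto`). Finitely many positive lengths are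
natural combinations of positive, rationally independent ones (`exists_positive_basis`), so `P` and
the target rectangles can be cut into boxes from one finite list of sizes. Dual functionals count
the boxes of each size, the counts agree, and equal boxes are matched by translations.

Upper bound: elimination writes `D` as a sum of `rank D` products of a column `g t` and a row `w t`.
By independence of the bases their real values are nonzero, and signs can be moved so that all `w t`
have positive values. The values of the `g t` may still be negative, but the sum of the products of
values is the area of `P`, hence positive (`Describes.area_pos`). Replacing the columns by `∑ q i •
g i + a • g t`, where the rational `q i` approximate the values of the `w i` and `a` is small,
brings every column value close to the area; the rows can be changed accordingly and stay positive
(`positive_factorization`).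

All of this is rational arithmetic apart from signs and intermediate rationals, and uses only
counting loops. Such `Code` has an explicit state function `run` and a polynomial cost
(`Code.exists_exec`), so correctness is proved for `run` by loop invariants. -/

/-- The closed box with lower left corner `p` and size `s`. -/
def box (p s : Plane) : Set Plane := Icc p (p + s)

lemma box_eq_prod (p s : Plane) :
    box p s = Icc p.1 (p.1 + s.1) ×ˢ Icc p.2 (p.2 + s.2) := by
  rw [box, Icc_prod_eq]; rfl

lemma interior_box (p s : Plane) :
    interior (box p s) = Ioo p.1 (p.1 + s.1) ×ˢ Ioo p.2 (p.2 + s.2) := by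
  rw [box_eq_prod, interior_prod_eq, interior_Icc, interior_Icc]

lemma closure_interior_box (p s : Plane) (h : 0 < s.1 ∧ 0 < s.2) :
    closure (interior (box p s)) = box p s := by
  rw [interior_box, closure_prod_eq, closure_Ioo (by linarith), closure_Ioo (by linarith),
    box_eq_prod]

lemma rectangle_eq_box (w h : ℝ) : rectangle w h = box 0 (w, h) := by
  simp [rectangle, box, Prod.zero_eq_mk]

lemma image_add_box (p s t : Plane) : (fun q : Plane => q + t) '' box p s = box (p + t) s := by
  rw [box, box, image_add_const_Icc, add_right_comm]

/-- The segments bounding a box. -/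
def boxSides (p s : Plane) : Set (Plane × Plane) :=
  {((p.1, p.2), (p.1, p.2 + s.2)), ((p.1 + s.1, p.2), (p.1 + s.1, p.2 + s.2)),
   ((p.1, p.2), (p.1 + s.1, p.2)), ((p.1, p.2 + s.2), (p.1 + s.1, p.2 + s.2))}

lemma segment_vertical (a : ℝ) {c d : ℝ} (h : c ≤ d) :
    segment ℝ ((a, c) : Plane) (a, d) = {a} ×ˢ Icc c d := by
  rw [← Prod.image_mk_segment_right, segment_eq_Icc h, singleton_prod]

lemma segment_horizontal (c : ℝ) {a b : ℝ} (h : a ≤ b) :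
    segment ℝ ((a, c) : Plane) (b, c) = Icc a b ×ˢ {c} := by
  rw [← Prod.image_mk_segment_left, segment_eq_Icc h, prod_singleton]

lemma frontier_box (p s : Plane) (h : 0 < s.1 ∧ 0 < s.2) :
    frontier (box p s) = ⋃ e ∈ boxSides p s, segment ℝ e.1 e.2 := by
  have h1 : p.1 ≤ p.1 + s.1 := by linarith
  have h2 : p.2 ≤ p.2 + s.2 := by linarith
  simp only [boxSides, biUnion_insert, biUnion_singleton]
  rw [segment_vertical _ h2, segment_vertical _ h2, segment_horizontal _ h1,
    segment_horizontal _ h1, box_eq_prod, frontier_prod_eq, closure_Icc, closure_Icc,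
    frontier_Icc h1, frontier_Icc h2]
  ext q
  simp only [mem_union, mem_prod, mem_insert_iff, mem_singleton_iff]
  tauto

lemma isOrthogonalPolygon_box (p s : Plane) (h : 0 < s.1 ∧ 0 < s.2) :
    IsOrthogonalPolygon (box p s) := by
  refine ⟨⟨p, le_refl _, ?_⟩, Metric.isBounded_Icc _ _, closure_interior_box p s h,
    boxSides p s, by simp [boxSides], ?_, frontier_box p s h⟩
  · constructor <;> simp <;> linarith [h.1, h.2]
  · rintro e (rfl | rfl | rfl | rfl) <;> simp

/-! ### Subdivisions -/

lemma Subdivides.sigma {ι : Type} {κ : ι → Type} {A : ι → Set Plane} {P : Set Plane}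
    {B : ∀ i, κ i → Set Plane} (h : Subdivides A P) (hB : ∀ i, Subdivides (B i) (A i)) :
    Subdivides (fun x : Σ i, κ i => B x.1 x.2) P := by
  constructor
  · rw [← h.1, iUnion_sigma]
    exact iUnion_congr fun i => (hB i).1
  · rintro ⟨i, k⟩ ⟨j, l⟩ hne
    by_cases hij : i = j
    · subst hij
      exact (hB i).2 k l (by rintro rfl; exact hne rfl)
    · refine (h.2 i j hij).mono (interior_mono ?_) (interior_mono ?_)
      · rw [← (hB i).1]; exact subset_iUnion (B i) k
      · rw [← (hB j).1]; exact subset_iUnion (B j) l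

lemma Subdivides.reindex {ι κ : Type} {A : ι → Set Plane} {P : Set Plane}
    (h : Subdivides A P) (e : κ ≃ ι) : Subdivides (fun k => A (e k)) P :=
  ⟨by rw [← h.1]; exact e.surjective.iUnion_comp A,
    fun i j hij => h.2 _ _ (e.injective.ne hij)⟩

lemma Subdivides.image {ι : Type} {A : ι → Set Plane} {P : Set Plane}
    (h : Subdivides A P) (e : Plane ≃ₜ Plane) : Subdivides (fun i => e '' A i) (e '' P) := by
  constructor
  · rw [← h.1, image_iUnion]
  · intro i j hij
    rw [← e.image_interior, ← e.image_interior, disjoint_image_iff e.injective]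
    exact h.2 i j hij

/-- `A` is subdivided into boxes of sizes `s i`. -/
def TiledBy (A : Set Plane) {ι : Type} (s : ι → Plane) : Prop :=
  ∃ p : ι → Plane, Subdivides (fun i => box (p i) (s i)) A

/-- `A` is subdivided into finitely many nondegenerate boxes. -/
def Tiled (A : Set Plane) : Prop :=
  ∃ (ι : Type) (_ : Finite ι) (s : ι → Plane), (∀ i, 0 < (s i).1 ∧ 0 < (s i).2) ∧ TiledBy A s

lemma TiledBy.translate {A : Set Plane} {ι : Type} {s : ι → Plane} (h : TiledBy A s) (t : Plane) :
    TiledBy ((fun q : Plane => q + t) '' A) s := by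
  obtain ⟨p, hp⟩ := h
  refine ⟨fun i => p i + t, ?_⟩
  simp only [← image_add_box]
  exact hp.image (Homeomorph.addRight t)

lemma Tiled.translate {A : Set Plane} (h : Tiled A) (t : Plane) :
    Tiled ((fun q : Plane => q + t) '' A) := by
  obtain ⟨ι, hι, s, hs, h⟩ := h
  exact ⟨ι, hι, s, hs, h.translate t⟩

/-! ### Grids -/

/-- The pairs of consecutive elements of a finite set of reals. -/
def consecutive (X : Finset ℝ) : Set (ℝ × ℝ) :=
  {c | c.1 ∈ X ∧ c.2 ∈ X ∧ c.1 < c.2 ∧ ∀ x ∈ X, ¬ (c.1 < x ∧ x < c.2)}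

lemma finite_consecutive (X : Finset ℝ) : (consecutive X).Finite :=
  (X.finite_toSet.prod X.finite_toSet).subset fun _ h => ⟨h.1, h.2.1⟩

lemma exists_consecutive {X : Finset ℝ} {a b x : ℝ} (ha : a ∈ X) (hb : b ∈ X) (hx : x ∉ X)
    (hax : a ≤ x) (hxb : x ≤ b) : ∃ c ∈ consecutive X, c.1 < x ∧ x < c.2 := by
  have h1 : (X.filter (· < x)).Nonempty :=
    ⟨a, Finset.mem_filter.2 ⟨ha, lt_of_le_of_ne hax (by rintro rfl; exact hx ha)⟩⟩
  have h2 : (X.filter (x < ·)).Nonempty :=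
    ⟨b, Finset.mem_filter.2 ⟨hb, lt_of_le_of_ne hxb (by rintro rfl; exact hx hb)⟩⟩
  have m1 := Finset.mem_filter.1 ((X.filter (· < x)).max'_mem h1)
  have m2 := Finset.mem_filter.1 ((X.filter (x < ·)).min'_mem h2)
  refine ⟨((X.filter (· < x)).max' h1, (X.filter (x < ·)).min' h2),
    ⟨m1.1, m2.1, m1.2.trans m2.2, ?_⟩, m1.2, m2.2⟩
  rintro z hz ⟨hz1, hz2⟩
  rcases lt_trichotomy z x with h | rfl | h
  · exact absurd (Finset.le_max' _ z (Finset.mem_filter.2 ⟨hz, h⟩)) (not_le.2 hz1)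
  · exact hx hz
  · exact absurd (Finset.min'_le _ z (Finset.mem_filter.2 ⟨hz, h⟩)) (not_le.2 hz2)

lemma consecutive_disjoint {X : Finset ℝ} {c d : ℝ × ℝ} (hc : c ∈ consecutive X)
    (hd : d ∈ consecutive X) (hne : c ≠ d) : Disjoint (Ioo c.1 c.2) (Ioo d.1 d.2) := by
  rw [Set.disjoint_left]
  rintro x ⟨h1, h2⟩ ⟨h3, h4⟩
  apply hne
  have e1 : c.1 = d.1 := by
    rcases lt_trichotomy c.1 d.1 with h | h | h
    · exact absurd ⟨h, h3.trans h2⟩ (hc.2.2.2 _ hd.1)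
    · exact h
    · exact absurd ⟨h, h1.trans h4⟩ (hd.2.2.2 _ hc.1)
  have e2 : c.2 = d.2 := by
    rcases lt_trichotomy c.2 d.2 with h | h | h
    · exact absurd ⟨h3.trans h2, h⟩ (hd.2.2.2 _ hc.2.1)
    · exact h
    · exact absurd ⟨h1.trans h4, h⟩ (hc.2.2.2 _ hd.2.1)
  exact Prod.ext e1 e2

/-- The union of finitely many vertical and horizontal lines. -/
def gridLines (X Y : Finset ℝ) : Set Plane := {p | p.1 ∈ X ∨ p.2 ∈ Y}

lemma dense_compl_gridLines (X Y : Finset ℝ) : Dense (gridLines X Y)ᶜ := by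
  have h : (gridLines X Y)ᶜ = ((X : Set ℝ)ᶜ ×ˢ (Y : Set ℝ)ᶜ) := by
    ext p; simp [gridLines]
  rw [h]
  exact (X.countable_toSet.dense_compl ℝ).prod (Y.countable_toSet.dense_compl ℝ)

/-- A connected set that misses the frontier of `A` lies in the interior of `A` or outside `A`. -/
lemma subset_interior_or_compl {U A : Set Plane} (hU : IsPreconnected U)
    (h : Disjoint U (frontier A)) : U ⊆ interior A ∨ U ⊆ Aᶜ := by
  have hcov : U ⊆ interior A ∪ (closure A)ᶜ := by
    intro p hp
    by_contra hn
    simp only [mem_union, mem_compl_iff, not_or, not_not] at hn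
    exact Set.disjoint_left.1 h hp ⟨hn.2, hn.1⟩
  rcases hU.subset_or_subset isOpen_interior isClosed_closure.isOpen_compl
    (Set.disjoint_left.2 fun p hp hq => hq (subset_closure (interior_subset hp))) hcov with h | h
  · exact Or.inl h
  · exact Or.inr (h.trans (compl_subset_compl.2 subset_closure))

lemma isPreconnected_Ioo_prod (a b c d : ℝ) : IsPreconnected (Ioo a b ×ˢ Ioo c d) :=
  isPreconnected_Ioo.prod isPreconnected_Ioo

/-- Each boundary segment lies on the vertical or the horizontal line through its first endpoint. -/
lemma IsOrthogonalPolygon.exists_gridLines {P : Set Plane} (h : IsOrthogonalPolygon P) :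
    ∃ X Y : Finset ℝ, frontier P ⊆ gridLines X Y := by
  obtain ⟨-, -, -, S, hS, hax, hfr⟩ := h
  refine ⟨hS.toFinset.image fun e => e.1.1, hS.toFinset.image fun e => e.1.2, ?_⟩
  rw [hfr]
  refine iUnion₂_subset fun e he p hp => ?_
  obtain ⟨s, t, hs, ht, hst, rfl⟩ := hp
  rcases hax e he with h | h
  · left
    refine Finset.mem_image.2 ⟨e, hS.mem_toFinset.2 he, ?_⟩
    simp [← h, ← add_mul, hst]
  · right
    refine Finset.mem_image.2 ⟨e, hS.mem_toFinset.2 he, ?_⟩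
    simp [← h, ← add_mul, hst]

/-- The open cells of a grid containing the boundary are connected and miss the frontier, so each
lies inside or outside `P`. The closures of the inside cells are the tiles. -/
lemma IsOrthogonalPolygon.tiled {P : Set Plane} (h : IsOrthogonalPolygon P) : Tiled P := by
  obtain ⟨X₀, Y₀, hXY⟩ := h.exists_gridLines
  obtain ⟨hne, hbd, hcl, -⟩ := h
  obtain ⟨M, hM⟩ := hbd.subset_closedBall 0
  have hMb : ∀ p ∈ P, (-M ≤ p.1 ∧ p.1 ≤ M) ∧ (-M ≤ p.2 ∧ p.2 ≤ M) := by
    intro p hp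
    have := hM hp
    rw [mem_closedBall_zero_iff, Prod.norm_def, max_le_iff, Real.norm_eq_abs,
      Real.norm_eq_abs, abs_le, abs_le] at this
    exact this
  -- The lines at `±M` ensure that each point of `P` off the grid lies between two consecutive lines
  -- in both directions.
  set X : Finset ℝ := insert (-M) (insert M X₀) with hX
  set Y : Finset ℝ := insert (-M) (insert M Y₀) with hY
  have hfr : frontier P ⊆ gridLines X Y := by
    intro p hp
    rcases hXY hp with h | h
    · left; simp [hX, h]
    · right; simp [hY, h]
  have hclosed : IsClosed P := hcl ▸ isClosed_closure
  let T : Set ((ℝ × ℝ) × (ℝ × ℝ)) :=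
    {c | c.1 ∈ consecutive X ∧ c.2 ∈ consecutive Y ∧ Ioo c.1.1 c.1.2 ×ˢ Ioo c.2.1 c.2.2 ⊆ P}
  have hT : T.Finite := ((finite_consecutive X).prod (finite_consecutive Y)).subset
    fun c hc => ⟨hc.1, hc.2.1⟩
  have hbox : ∀ c : (ℝ × ℝ) × (ℝ × ℝ),
      box (c.1.1, c.2.1) (c.1.2 - c.1.1, c.2.2 - c.2.1) = Icc c.1.1 c.1.2 ×ˢ Icc c.2.1 c.2.2 := by
    intro c; rw [box_eq_prod]; simp
  refine ⟨T, hT.to_subtype, fun c => (c.1.1.2 - c.1.1.1, c.1.2.2 - c.1.2.1),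
    fun c => ⟨sub_pos.2 c.2.1.2.2.1, sub_pos.2 c.2.2.1.2.2.1⟩,
    fun c => (c.1.1.1, c.1.2.1), ?_, ?_⟩
  · simp only [hbox]
    have := hT.to_subtype
    apply Subset.antisymm
    · refine iUnion_subset fun c => ?_
      have := closure_minimal c.2.2.2 hclosed
      rwa [closure_prod_eq, closure_Ioo c.2.1.2.2.1.ne, closure_Ioo c.2.2.1.2.2.1.ne] at this
    · have hcu : IsClosed (⋃ c : T, Icc c.1.1.1 c.1.1.2 ×ˢ Icc c.1.2.1 c.1.2.2) :=
        isClosed_iUnion_of_finite fun c => isClosed_Icc.prod isClosed_Icc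
      have key : interior P ∩ (gridLines X Y)ᶜ ⊆
          ⋃ c : T, Icc c.1.1.1 c.1.1.2 ×ˢ Icc c.1.2.1 c.1.2.2 := by
        rintro p ⟨hp, hpl⟩
        have hpl' : p.1 ∉ X ∧ p.2 ∉ Y := by
          simpa [gridLines, not_or] using hpl
        obtain ⟨b1, b2⟩ := hMb p (interior_subset hp)
        obtain ⟨c, hc, hc1, hc2⟩ := exists_consecutive (X := X) (a := -M) (b := M)
          (by simp [hX]) (by simp [hX]) hpl'.1 b1.1 b1.2
        obtain ⟨d, hd, hd1, hd2⟩ := exists_consecutive (X := Y) (a := -M) (b := M)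
          (by simp [hY]) (by simp [hY]) hpl'.2 b2.1 b2.2
        have hsub : Ioo c.1 c.2 ×ˢ Ioo d.1 d.2 ⊆ P := by
          rcases subset_interior_or_compl (A := P) (isPreconnected_Ioo_prod c.1 c.2 d.1 d.2)
            (Set.disjoint_left.2 fun q hq hqf => by
              rcases hfr hqf with h | h
              · exact hc.2.2.2 _ h hq.1
              · exact hd.2.2.2 _ h hq.2) with h | h
          · exact h.trans interior_subset
          · exact absurd (interior_subset hp) (h ⟨⟨hc1, hc2⟩, ⟨hd1, hd2⟩⟩)
        exact mem_iUnion.2 ⟨⟨(c, d), hc, hd, hsub⟩, ⟨hc1.le, hc2.le⟩, ⟨hd1.le, hd2.le⟩⟩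
      -- Points on grid lines are recovered by density: the finite union of closed tiles is closed,
      -- and `P` is the closure of its interior.
      calc P = closure (interior P) := hcl.symm
        _ ⊆ closure (closure (interior P ∩ (gridLines X Y)ᶜ)) :=
            closure_mono ((dense_compl_gridLines X Y).open_subset_closure_inter isOpen_interior)
        _ ⊆ _ := by rw [closure_closure]; exact closure_minimal key hcu
  · intro c d hcd
    simp only [hbox, interior_prod_eq, interior_Icc]
    by_cases h1 : c.1.1 = d.1.1
    · have h2 : c.1.2 ≠ d.1.2 := fun h2 => hcd (Subtype.ext (Prod.ext h1 h2))
      exact disjoint_prod.2 (Or.inr (consecutive_disjoint c.2.2.1 d.2.2.1 h2))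
    · exact disjoint_prod.2 (Or.inl (consecutive_disjoint c.2.1 d.2.1 h1))

/-! ### Germs in the upper right quadrant -/

/-- The open square of side `ε` with lower left corner `p`. -/
def quad (p : Plane) (ε : ℝ) : Set Plane := Ioo p.1 (p.1 + ε) ×ˢ Ioo p.2 (p.2 + ε)

lemma quad_mono (p : Plane) {ε δ : ℝ} (h : ε ≤ δ) : quad p ε ⊆ quad p δ :=
  prod_mono (Ioo_subset_Ioo_right (by linarith)) (Ioo_subset_Ioo_right (by linarith))

lemma quad_nonempty (p : Plane) {ε : ℝ} (h : 0 < ε) : (quad p ε).Nonempty :=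
  ⟨(p.1 + ε / 2, p.2 + ε / 2), ⟨by simp [h], by simp [h]⟩, ⟨by simp [h], by simp [h]⟩⟩

lemma isOpen_quad (p : Plane) (ε : ℝ) : IsOpen (quad p ε) := isOpen_Ioo.prod isOpen_Ioo

/-- Near `p`, the open upper right quadrant at `p` is contained in `A`. -/
def Germ (A : Set Plane) (p : Plane) : Prop := ∃ ε > 0, quad p ε ⊆ A

/-- At each point, the germ of the upper right quadrant lies in `A` or in its complement. -/
def Decided (A : Set Plane) : Prop := ∀ p, Germ A p ∨ Germ Aᶜ p

lemma Germ.mono {A B : Set Plane} {p : Plane} (h : A ⊆ B) (hA : Germ A p) : Germ B p := by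
  obtain ⟨ε, h0, hε⟩ := hA
  exact ⟨ε, h0, hε.trans h⟩

lemma Germ.inter {A B : Set Plane} {p : Plane} (hA : Germ A p) (hB : Germ B p) :
    Germ (A ∩ B) p := by
  obtain ⟨ε, h0, hε⟩ := hA
  obtain ⟨δ, k0, hδ⟩ := hB
  exact ⟨min ε δ, lt_min h0 k0, subset_inter ((quad_mono p (min_le_left _ _)).trans hε)
    ((quad_mono p (min_le_right _ _)).trans hδ)⟩

lemma not_germ_empty (p : Plane) : ¬ Germ ∅ p := by
  rintro ⟨ε, h0, hε⟩
  exact (quad_nonempty p h0).not_subset_empty hε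

lemma Germ.not_compl {A : Set Plane} {p : Plane} (hA : Germ A p) : ¬ Germ Aᶜ p := by
  intro h
  have := hA.inter h
  rw [inter_compl_self] at this
  exact not_germ_empty p this

lemma Germ.interior {A : Set Plane} {p : Plane} (hA : Germ A p) : Germ (interior A) p := by
  obtain ⟨ε, h0, hε⟩ := hA
  exact ⟨ε, h0, interior_maximal hε (isOpen_quad p ε)⟩

lemma Germ.iInter {ι : Type} [Finite ι] {A : ι → Set Plane} {p : Plane}
    (h : ∀ i, Germ (A i) p) : Germ (⋂ i, A i) p := by
  choose ε h0 hε using h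
  obtain ⟨δ, hδ0, hδ⟩ : ∃ δ > 0, ∀ i, δ ≤ ε i := by
    rcases isEmpty_or_nonempty ι with hι | hι
    · exact ⟨1, one_pos, fun i => isEmptyElim i⟩
    · obtain ⟨i, hi⟩ := Finite.exists_min ε
      exact ⟨ε i, h0 i, hi⟩
  exact ⟨δ, hδ0, subset_iInter fun i => (quad_mono p (hδ i)).trans (hε i)⟩

lemma Decided.iUnion {ι : Type} [Finite ι] {A : ι → Set Plane} (h : ∀ i, Decided (A i)) :
    Decided (⋃ i, A i) := by
  intro p
  by_cases hp : ∃ i, Germ (A i) p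
  · obtain ⟨i, hi⟩ := hp
    exact Or.inl (hi.mono (subset_iUnion A i))
  · push Not at hp
    right
    rw [compl_iUnion]
    exact Germ.iInter fun i => (h i p).resolve_left (hp i)

/-- In each coordinate, a short interval to the right of `x` lies in `[a, b]` if `a ≤ x < b` and
misses it otherwise. Germs thus see the half-open box, and every point is decided. -/
lemma germ_box_iff {c s p : Plane} :
    (Germ (box c s) p ↔ (c.1 ≤ p.1 ∧ p.1 < c.1 + s.1) ∧ c.2 ≤ p.2 ∧ p.2 < c.2 + s.2) ∧
      (Germ (box c s) p ∨ Germ (box c s)ᶜ p) := by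
  have half : ∀ (x a b : ℝ), (∃ ε > 0, Ioo x (x + ε) ⊆ Icc a b) ∧ (a ≤ x ∧ x < b) ∨
      (∃ ε > 0, Ioo x (x + ε) ⊆ (Icc a b)ᶜ) ∧ ¬ (a ≤ x ∧ x < b) := by
    intro x a b
    by_cases ha : a ≤ x
    · by_cases hb : x < b
      · refine Or.inl ⟨⟨b - x, by linarith, fun y hy => ⟨by linarith [hy.1], by linarith [hy.2]⟩⟩,
          ha, hb⟩
      · refine Or.inr ⟨⟨1, one_pos, fun y hy hy' => ?_⟩, fun h => hb h.2⟩
        exact hb (hy.1.trans_le hy'.2)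
    · refine Or.inr ⟨⟨a - x, by linarith, fun y hy hy' => ?_⟩, fun h => ha h.1⟩
      linarith [hy.2, hy'.1]
  have key : (Germ (box c s) p ∧ (c.1 ≤ p.1 ∧ p.1 < c.1 + s.1) ∧ c.2 ≤ p.2 ∧ p.2 < c.2 + s.2) ∨
      (Germ (box c s)ᶜ p ∧
        ¬ ((c.1 ≤ p.1 ∧ p.1 < c.1 + s.1) ∧ c.2 ≤ p.2 ∧ p.2 < c.2 + s.2)) := by
    rw [box_eq_prod]
    rcases half p.1 c.1 (c.1 + s.1) with ⟨⟨ε, h0, hε⟩, h⟩ | ⟨⟨ε, h0, hε⟩, h⟩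
    · rcases half p.2 c.2 (c.2 + s.2) with ⟨⟨δ, k0, hδ⟩, k⟩ | ⟨⟨δ, k0, hδ⟩, k⟩
      · refine Or.inl ⟨⟨min ε δ, lt_min h0 k0, prod_mono ?_ ?_⟩, h, k⟩
        · exact (Ioo_subset_Ioo_right (by gcongr; exact min_le_left _ _)).trans hε
        · exact (Ioo_subset_Ioo_right (by gcongr; exact min_le_right _ _)).trans hδ
      · exact Or.inr ⟨⟨δ, k0, fun q hq hq' => hδ hq.2 hq'.2⟩, fun h => k h.2⟩
    · exact Or.inr ⟨⟨ε, h0, fun q hq hq' => hε hq.1 hq'.1⟩, fun k => h k.1⟩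
  rcases key with ⟨h, k⟩ | ⟨h, k⟩
  · exact ⟨iff_of_true h k, Or.inl h⟩
  · exact ⟨iff_of_false (fun h' => h'.not_compl h) k, Or.inr h⟩

lemma decided_box (c s : Plane) : Decided (box c s) := fun _ => germ_box_iff.2

lemma Tiled.decided {A : Set Plane} (h : Tiled A) : Decided A := by
  obtain ⟨ι, hι, s, -, p, hp, -⟩ := h
  rw [← hp]
  exact Decided.iUnion fun i => decided_box _ _

open Classical in
/-- The indicator function of the germs of `A`. -/
def chi (A : Set Plane) (p : Plane) : ℚ := if Germ A p then 1 else 0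

/-- A germ cannot lie in two pieces, because their interiors are disjoint. If it lies in none, it
lies in each of the finitely many complements, since the pieces are decided, and hence in the
complement of `P`. -/
lemma chi_subdivides {ι : Type} [Fintype ι] {A : ι → Set Plane} {P : Set Plane}
    (hA : ∀ i, Decided (A i)) (h : Subdivides A P) : chi P = ∑ i, chi (A i) := by
  classical
  ext p
  rw [Finset.sum_apply]
  by_cases hp : ∃ i, Germ (A i) p
  · obtain ⟨i, hi⟩ := hp
    rw [Finset.sum_eq_single i, chi, chi, if_pos hi, if_pos (hi.mono (h.1 ▸ subset_iUnion A i))]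
    · intro j _ hj
      rw [chi, if_neg]
      intro hj'
      have := hi.interior.inter hj'.interior
      rw [(h.2 i j hj.symm).inter_eq] at this
      exact not_germ_empty p this
    · exact fun h => absurd (Finset.mem_univ i) h
  · push Not at hp
    rw [Finset.sum_eq_zero fun i _ => by rw [chi, if_neg (hp i)], chi, if_neg]
    have : Germ (⋂ i, (A i)ᶜ) p := Germ.iInter fun i => (hA i p).resolve_left (hp i)
    rw [← compl_iUnion, h.1] at this
    exact fun h' => h'.not_compl this

/-! ### Additive valuations -/

/-- The indicator function of `[a, ∞)`. -/
def ray (a x : ℝ) : ℚ := if a ≤ x then 1 else 0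

/-- At the smallest endpoint `a` that occurs, every ray except `ray a` vanishes, so the coefficient
of `ray a` is zero; induct. -/
lemma linearIndependent_ray : LinearIndependent ℚ ray := by
  rw [linearIndependent_iff']
  intro s
  induction s using Finset.induction_on_min with
  | empty => simp
  | insert a s ha ih =>
    intro g hg i hi
    have has : a ∉ s := fun h => lt_irrefl _ (ha a h)
    have h0 : g a = 0 := by
      have := congrFun hg a
      rw [Finset.sum_insert has, Pi.add_apply, Finset.sum_apply,
        Finset.sum_eq_zero fun x hx => by simp [ray, not_le.2 (ha x hx)]] at this
      simpa [ray] using this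
    rcases Finset.mem_insert.1 hi with rfl | hi
    · exact h0
    · rw [Finset.sum_insert has, h0, zero_smul, zero_add] at hg
      exact ih g hg i hi

lemma LinearIndependent.exists_linearMap {ι V : Type} [AddCommGroup V] [Module ℚ V] {v : ι → V}
    (hv : LinearIndependent ℚ v) (f : ι → ℚ) : ∃ φ : V →ₗ[ℚ] ℚ, ∀ i, φ (v i) = f i := by
  obtain ⟨φ, hφ⟩ := LinearMap.exists_extend ((Module.Basis.span hv).constr ℚ f)
  refine ⟨φ, fun i => ?_⟩
  have h1 := (Module.Basis.span hv).constr_basis ℚ f i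
  have h2 := LinearMap.congr_fun hφ (Module.Basis.span hv i)
  rw [h1] at h2
  rw [← h2, LinearMap.comp_apply, Submodule.subtype_apply, Module.Basis.span_apply]

/-- A linear extension of the valuation of step functions defined by `f`. -/
def stepVal (f : ℝ →ₗ[ℚ] ℚ) : (ℝ → ℚ) →ₗ[ℚ] ℚ :=
  -- With this sign the indicator `ray a - ray b` of `[a, b)` gets the value `f b - f a`. Values
  -- outside the span of the rays are arbitrary and play no role.
  (LinearIndependent.exists_linearMap linearIndependent_ray fun a => -f a).choose

lemma stepVal_ray (f : ℝ →ₗ[ℚ] ℚ) (a : ℝ) : stepVal f (ray a) = -f a :=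
  (LinearIndependent.exists_linearMap linearIndependent_ray fun a => -f a).choose_spec a

/-- A linear extension of the valuation of plane step functions defined by `f` and `g`. -/
def val (f g : ℝ →ₗ[ℚ] ℚ) : (Plane → ℚ) →ₗ[ℚ] ℚ where
  toFun F := stepVal f fun x => stepVal g fun y => F (x, y)
  map_add' F G := by
    rw [← map_add]; congr 1; ext x; rw [Pi.add_apply, ← map_add]; rfl
  map_smul' c F := by
    rw [RingHom.id_apply, ← map_smul]; congr 1; ext x; rw [Pi.smul_apply, ← map_smul]; rfl

lemma val_mul (f g : ℝ →ₗ[ℚ] ℚ) (u v : ℝ → ℚ) :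
    val f g (fun p => u p.1 * v p.2) = stepVal f u * stepVal g v := by
  have h : ∀ x, (stepVal g fun y => u x * v y) = stepVal g v * u x := by
    intro x
    rw [mul_comm, ← smul_eq_mul, ← map_smul]; rfl
  change (stepVal f fun x => stepVal g fun y => u x * v y) = _
  simp only [h]
  rw [mul_comm (stepVal f u), ← smul_eq_mul (stepVal g v) (stepVal f u), ← map_smul]; rfl

lemma val_box (f g : ℝ →ₗ[ℚ] ℚ) (c s : Plane) (h : 0 < s.1 ∧ 0 < s.2) :
    val f g (chi (box c s)) = f s.1 * g s.2 := by
  have hchi : chi (box c s) = fun p => (ray c.1 - ray (c.1 + s.1)) p.1 *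
      (ray c.2 - ray (c.2 + s.2)) p.2 := by
    ext p
    have half : ∀ a w x : ℝ, 0 < w → (ray a - ray (a + w)) x =
        if a ≤ x ∧ x < a + w then 1 else 0 := by
      intro a w x hw
      simp only [Pi.sub_apply, ray]
      by_cases h1 : a ≤ x <;> by_cases h2 : x < a + w <;> by_cases h3 : a + w ≤ x <;>
        simp [h1, h2, h3] <;> linarith
    rw [half _ _ _ h.1, half _ _ _ h.2, chi]
    simp only [germ_box_iff.1]
    split_ifs <;> simp <;> tauto
  rw [hchi, val_mul, map_sub, map_sub, stepVal_ray, stepVal_ray, stepVal_ray, stepVal_ray, map_add,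
    map_add]
  ring

lemma TiledBy.val_chi {A : Set Plane} {ι : Type} [Fintype ι] {s : ι → Plane} (h : TiledBy A s)
    (hs : ∀ i, 0 < (s i).1 ∧ 0 < (s i).2) (f g : ℝ →ₗ[ℚ] ℚ) :
    val f g (chi A) = ∑ i, f (s i).1 * g (s i).2 := by
  obtain ⟨p, hp⟩ := h
  rw [chi_subdivides (fun i => decided_box _ _) hp, map_sum]
  exact Finset.sum_congr rfl fun i _ => val_box f g _ _ (hs i)

/-- The value is a sum over the sizes of the tiles, and translation moves the tiles without changing
their sizes. -/
lemma Tiled.val_translate {A : Set Plane} (h : Tiled A) (t : Plane) (f g : ℝ →ₗ[ℚ] ℚ) :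
    val f g (chi ((fun q : Plane => q + t) '' A)) = val f g (chi A) := by
  obtain ⟨ι, hι, s, hs, h⟩ := h
  have := Fintype.ofFinite ι
  rw [h.val_chi hs, (h.translate t).val_chi hs]

/-- The valuations are invariant under orthogonal dissection into rectangles. -/
lemma DissectsInto.val_chi {P : Set Plane} {r : ℕ} {w h : Fin r → ℝ}
    (hwh : ∀ j, 0 < w j ∧ 0 < h j) (hP : DissectsInto P fun j => rectangle (w j) (h j))
    (f g : ℝ →ₗ[ℚ] ℚ) : val f g (chi P) = ∑ j, f (w j) * g (h j) := by
  classical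
  obtain ⟨N, A, t, c, hA, hsub, hR⟩ := hP
  rw [chi_subdivides (fun i => (hA i).tiled.decided) hsub, map_sum]
  calc ∑ i, val f g (chi (A i))
      = ∑ i, val f g (chi ((fun p : Plane => p + t i) '' A i)) :=
        Finset.sum_congr rfl fun i _ => ((hA i).tiled.val_translate _ f g).symm
    _ = ∑ j, ∑ i : {i // c i = j}, val f g (chi ((fun p : Plane => p + t i) '' A i)) :=
        (Fintype.sum_fiberwise c _).symm
    _ = _ := Finset.sum_congr rfl fun j _ => by
        rw [← val_box f g 0 (w j, h j) (hwh j), ← rectangle_eq_box, ← map_sum,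
          chi_subdivides (fun i : {i // c i = j} => ((hA i).tiled.translate _).decided) (hR j)]

/-! ### The boundary formula for the valuations -/

lemma exists_gap (X : Finset ℝ) (x : ℝ) : ∃ ε > 0, ∀ a ∈ X, |a - x| < ε → a = x := by
  have h : ((X.erase x : Finset ℝ) : Set ℝ)ᶜ ∈ 𝓝 x :=
    (X.erase x).finite_toSet.isClosed.isOpen_compl.mem_nhds (by simp)
  obtain ⟨ε, h0, hε⟩ := Metric.mem_nhds_iff.1 h
  refine ⟨ε, h0, fun a ha hax => ?_⟩
  by_contra hne
  exact hε (Metric.mem_ball.2 (by rwa [Real.dist_eq])) (by simp [ha, hne])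

/-- A connected set that misses the frontier lies on one side of it, so a single test point `q`
decides the germ. -/
lemma germ_iff_mem {U P : Set Plane} {p q : Plane} (hU : IsPreconnected U)
    (hd : Disjoint U (frontier P)) (hq : q ∈ U) (hg : Germ U p) : Germ P p ↔ q ∈ P := by
  rcases subset_interior_or_compl hU hd with h | h
  · exact iff_of_true (hg.mono (h.trans interior_subset)) (interior_subset (h hq))
  · exact iff_of_false (fun h' => h'.not_compl (hg.mono h)) (h hq)

lemma chi_congr {A B : Set Plane} {p q : Plane} (h : Germ A p ↔ Germ B q) :
    chi A p = chi B q := by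
  classical
  rw [chi, chi]
  exact if_congr h rfl rfl

lemma germ_Ioo_prod {a b c d : ℝ} {p : Plane} (h1 : a ≤ p.1) (h2 : p.1 < b) (h3 : c ≤ p.2)
    (h4 : p.2 < d) : Germ (Ioo a b ×ˢ Ioo c d) p := by
  refine ⟨min (b - p.1) (d - p.2), lt_min (by linarith) (by linarith),
    prod_mono (Ioo_subset_Ioo h1 ?_) (Ioo_subset_Ioo h3 ?_)⟩
  · linarith [min_le_left (b - p.1) (d - p.2)]
  · linarith [min_le_right (b - p.1) (d - p.2)]

lemma ray_sub_ray_ne_zero {a b x : ℝ} (h : ray a x - ray b x ≠ 0) :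
    (a ≤ x ∧ x < b) ∨ (b ≤ x ∧ x < a) := by
  by_contra hn
  apply h
  by_cases h1 : a ≤ x <;> by_cases h2 : b ≤ x <;> simp [ray, h1, h2] <;>
    simp only [not_or, not_and, not_lt] at hn
  · exact h2 (hn.1 h1)
  · exact h1 (hn.2 h2)

namespace PolygonInput

variable {m n : ℕ} {I : PolygonInput m n} {xb : Fin m → ℝ} {yb : Fin n → ℝ} {P : Set Plane}

lemma side_horizontal {v : Fin I.V} (h : (I.pt xb yb v).2 = (I.pt xb yb (I.next v)).2) :
    I.side xb yb v =
      uIcc (I.pt xb yb v).1 (I.pt xb yb (I.next v)).1 ×ˢ {(I.pt xb yb v).2} := by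
  rw [side, ← segment_eq_uIcc, prod_singleton, Prod.image_mk_segment_left]
  congr 1
  exact Prod.ext rfl h.symm

lemma side_vertical {v : Fin I.V} (h : (I.pt xb yb v).1 = (I.pt xb yb (I.next v)).1) :
    I.side xb yb v =
      {(I.pt xb yb v).1} ×ˢ uIcc (I.pt xb yb v).2 (I.pt xb yb (I.next v)).2 := by
  rw [side, ← segment_eq_uIcc, singleton_prod, Prod.image_mk_segment_right]
  congr 1
  exact Prod.ext h.symm rfl

/-- The side at `v` passes above or below `x` and points just to the right of `x`. -/
def Covers (I : PolygonInput m n) (xb : Fin m → ℝ) (yb : Fin n → ℝ) (x : ℝ) (v : Fin I.V) : Prop :=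
  ((I.pt xb yb v).1 ≤ x ∧ x < (I.pt xb yb (I.next v)).1) ∨
    ((I.pt xb yb (I.next v)).1 ≤ x ∧ x < (I.pt xb yb v).1)

lemma Describes.horizontal_of_covers (hI : I.Describes xb yb P) {x : ℝ} {v : Fin I.V}
    (h : I.Covers xb yb x v) : (I.pt xb yb v).2 = (I.pt xb yb (I.next v)).2 := by
  refine (hI.axisParallel v).resolve_left fun h' => ?_
  rcases h with h | h <;> linarith

/-- Two sides at one height that both pass `x` overlap just to the right of `x`. A point `z` of the
overlap, beyond `x` and before both right ends, is not an endpoint of the first side, which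
`noCrossing` excludes. -/
lemma Describes.eq_of_covers (hI : I.Describes xb yb P) {x : ℝ} {v w : Fin I.V}
    (hv : I.Covers xb yb x v) (hw : I.Covers xb yb x w)
    (h : (I.pt xb yb v).2 = (I.pt xb yb w).2) : v = w := by
  by_contra hne
  have hv2 := hI.horizontal_of_covers hv
  have hw2 := hI.horizontal_of_covers hw
  obtain ⟨z, hz, hz1, hz2⟩ : ∃ z, x < z ∧
      z < max (I.pt xb yb v).1 (I.pt xb yb (I.next v)).1 ∧
      z < max (I.pt xb yb w).1 (I.pt xb yb (I.next w)).1 := by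
    have h1 : x < max (I.pt xb yb v).1 (I.pt xb yb (I.next v)).1 :=
      lt_max_iff.2 (hv.elim (fun h => Or.inr h.2) fun h => Or.inl h.2)
    have h2 : x < max (I.pt xb yb w).1 (I.pt xb yb (I.next w)).1 :=
      lt_max_iff.2 (hw.elim (fun h => Or.inr h.2) fun h => Or.inl h.2)
    obtain ⟨z, hz, hz'⟩ := exists_between (lt_min h1 h2)
    exact ⟨z, hz, lt_min_iff.1 hz'⟩
  have hzv : z ∈ uIcc (I.pt xb yb v).1 (I.pt xb yb (I.next v)).1 := by
    rw [uIcc, mem_Icc]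
    exact ⟨(inf_le_iff.2 (hv.elim (fun h => Or.inl (by linarith)) fun h => Or.inr (by linarith))),
      hz1.le⟩
  have hzw : z ∈ uIcc (I.pt xb yb w).1 (I.pt xb yb (I.next w)).1 := by
    rw [uIcc, mem_Icc]
    exact ⟨(inf_le_iff.2 (hw.elim (fun h => Or.inl (by linarith)) fun h => Or.inr (by linarith))),
      hz2.le⟩
  have := (hI.noCrossing v w hne
    (show (z, (I.pt xb yb v).2) ∈ I.side xb yb v ∩ I.side xb yb w from ⟨?_, ?_⟩)).1
  · rw [mem_insert_iff, mem_singleton_iff] at this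
    rcases this with e | e <;> have e := congrArg Prod.fst e <;> simp only at e <;>
      rcases hv with hv | hv
    · linarith
    · rw [max_eq_left (by linarith)] at hz1; linarith
    · rw [max_eq_right (by linarith)] at hz1; linarith
    · linarith
  · rw [side_horizontal hv2]; exact ⟨hzv, rfl⟩
  · rw [side_horizontal hw2]; exact ⟨hzw, h⟩

/-- The signed number of sides below the germ of a point. -/
def winding (I : PolygonInput m n) (xb : Fin m → ℝ) (yb : Fin n → ℝ) (p : Plane) : ℚ :=
  ∑ v, (ray (I.pt xb yb v).1 - ray (I.pt xb yb (I.next v)).1) p.1 * ray (I.pt xb yb v).2 p.2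

/-- Moving up a vertical line, both functions can jump only at the height of a side that covers `x`.
At most one side at height `y₀` does so, and since the interior is on its left, both jumps are `+1`
for a side directed to the right and `-1` for one directed to the left. -/
lemma Describes.eventually_chi_sub_winding (hI : I.Describes xb yb P) (x y₀ : ℝ) :
    ∀ᶠ y in 𝓝 y₀, chi P (x, y) - I.winding xb yb (x, y)
      = chi P (x, y₀) - I.winding xb yb (x, y₀) := by
  obtain ⟨δ, hδ0, hδ⟩ := exists_gap (Finset.univ.image fun v => (I.pt xb yb v).1) x
  obtain ⟨ε, hε0, hε⟩ := exists_gap (Finset.univ.image fun v => (I.pt xb yb v).2) y₀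
  have hX : ∀ v, (I.pt xb yb v).1 < x + δ → (I.pt xb yb v).1 ≤ x := by
    intro v hv
    by_contra hn
    rw [not_le] at hn
    exact hn.ne' (hδ _ (Finset.mem_image_of_mem _ (Finset.mem_univ v))
      (abs_lt.2 ⟨by linarith, by linarith⟩))
  have hY : ∀ v, y₀ - ε < (I.pt xb yb v).2 → (I.pt xb yb v).2 < y₀ + ε →
      (I.pt xb yb v).2 = y₀ := fun v h1 h2 =>
    hε _ (Finset.mem_image_of_mem _ (Finset.mem_univ v)) (abs_lt.2 ⟨by linarith, by linarith⟩)
  -- By the choice of `δ` no vertical side meets the strip to the right of `x`, and by the choice of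
  -- `ε` horizontal sides meet it only at height `y₀`.
  have hfr : ∀ p ∈ frontier P, p.1 ∈ Ioo x (x + δ) → p.2 ∈ Ioo (y₀ - ε) (y₀ + ε) →
      p.2 = y₀ ∧ ∃ v, (I.pt xb yb v).2 = y₀ ∧ I.Covers xb yb x v := by
    intro p hp h1 h2
    rw [hI.boundary] at hp
    obtain ⟨v, hv⟩ := mem_iUnion.1 hp
    rcases hI.axisParallel v with h | h
    · rw [side_vertical h] at hv
      have e : p.1 = (I.pt xb yb v).1 := hv.1
      have := hX v (e ▸ h1.2)
      linarith [h1.1]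
    · rw [side_horizontal h] at hv
      have e : p.2 = (I.pt xb yb v).2 := hv.2
      have hy := hY v (e ▸ h2.1) (e ▸ h2.2)
      refine ⟨e.trans hy, v, hy, ?_⟩
      rcases mem_uIcc.1 hv.1 with ⟨k1, k2⟩ | ⟨k1, k2⟩
      · exact Or.inl ⟨hX v (by linarith [h1.2]), by linarith [h1.1]⟩
      · exact Or.inr ⟨hX _ (by linarith [h1.2]), by linarith [h1.1]⟩
  -- Rays contain their left endpoint, so the value at `y₀` already counts the sides at that height
  -- and persists just above it; only the values below can differ.
  have hup : ∀ y, y₀ ≤ y → y < y₀ + ε → I.winding xb yb (x, y) = I.winding xb yb (x, y₀) := by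
    intro y h1 h2
    refine Finset.sum_congr rfl fun v _ => ?_
    congr 1
    simp only [ray]
    refine if_congr ⟨fun h => ?_, fun h => h.trans h1⟩ rfl rfl
    by_cases h3 : y₀ - ε < (I.pt xb yb v).2
    · exact (hY v h3 (h.trans_lt h2)).le
    · linarith
  have hdown : ∀ y, y₀ - ε < y → y < y₀ → I.winding xb yb (x, y₀) - I.winding xb yb (x, y) =
      ∑ v, (ray (I.pt xb yb v).1 - ray (I.pt xb yb (I.next v)).1) x *
        if (I.pt xb yb v).2 = y₀ then 1 else 0 := by
    intro y h1 h2
    rw [winding, winding, ← Finset.sum_sub_distrib]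
    refine Finset.sum_congr rfl fun v _ => ?_
    rw [← mul_sub]
    congr 1
    simp only [ray]
    by_cases h3 : (I.pt xb yb v).2 = y₀
    · simp [h3, h2]
    · rw [if_neg h3, sub_eq_zero]
      refine if_congr ⟨fun h => ?_, fun h => h.trans h2.le⟩ rfl rfl
      by_contra h4
      exact h3 (hY v (by linarith) (by linarith))
  have hnb : ∀ᶠ y in 𝓝 y₀, y ∈ Ioo (y₀ - ε) (y₀ + ε) :=
    Ioo_mem_nhds (by linarith) (by linarith)
  by_cases hcov : ∃ v, (I.pt xb yb v).2 = y₀ ∧ I.Covers xb yb x v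
  · obtain ⟨v, hv, hvc⟩ := hcov
    have hsum : (∑ w, (ray (I.pt xb yb w).1 - ray (I.pt xb yb (I.next w)).1) x *
        if (I.pt xb yb w).2 = y₀ then 1 else 0) =
        (ray (I.pt xb yb v).1 - ray (I.pt xb yb (I.next v)).1) x := by
      rw [Finset.sum_eq_single v]
      · simp [hv]
      · intro w _ hw
        by_contra hne
        rw [mul_ite, mul_one, mul_zero, ite_eq_right_iff, Classical.not_imp] at hne
        exact hw (hI.eq_of_covers (ray_sub_ray_ne_zero hne.2) hvc (hne.1.trans hv.symm))
      · exact fun h => absurd (Finset.mem_univ v) h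
    have hh := hI.horizontal_of_covers hvc
    set L := (I.pt xb yb (I.next v)).1 - (I.pt xb yb v).1 with hL
    have hL0 : L ≠ 0 := by rcases hvc with h | h <;> [exact ne_of_gt (by linarith); exact ne_of_lt (by linarith)]
    have hnorm : I.leftNormal xb yb v = (0, L) := by
      rw [leftNormal, hh, sub_self]
    obtain ⟨q, hqx, hqy, hqs⟩ : ∃ q : Plane, q.1 ∈ Ioo x (x + δ) ∧ q.2 = y₀ ∧
        q ∈ openSegment ℝ (I.pt xb yb v) (I.pt xb yb (I.next v)) := by
      have hseg : ∀ z ∈ openSegment ℝ (I.pt xb yb v).1 (I.pt xb yb (I.next v)).1,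
          ((z, y₀) : Plane) ∈ openSegment ℝ (I.pt xb yb v) (I.pt xb yb (I.next v)) := by
        rintro z ⟨a, b, ha, hb, hab, rfl⟩
        refine ⟨a, b, ha, hb, hab, Prod.ext rfl ?_⟩
        simp only [Prod.snd_add, Prod.smul_snd, ← hh, hv, smul_eq_mul, ← add_mul, hab, one_mul]
      rcases hvc with ⟨h1, h2⟩ | ⟨h1, h2⟩
      · obtain ⟨z, hz1, hz2⟩ := exists_between (lt_min h2 (lt_add_of_pos_right x hδ0))
        refine ⟨(z, y₀), ⟨hz1, (lt_min_iff.1 hz2).2⟩, rfl, hseg z ?_⟩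
        rw [openSegment_eq_Ioo (h1.trans_lt h2)]
        exact ⟨h1.trans_lt hz1, (lt_min_iff.1 hz2).1⟩
      · obtain ⟨z, hz1, hz2⟩ := exists_between (lt_min h2 (lt_add_of_pos_right x hδ0))
        refine ⟨(z, y₀), ⟨hz1, (lt_min_iff.1 hz2).2⟩, rfl, hseg z ?_⟩
        rw [openSegment_symm, openSegment_eq_Ioo (h1.trans_lt h2)]
        exact ⟨h1.trans_lt hz1, (lt_min_iff.1 hz2).1⟩
    -- Test points on both sides of the covering side; `τ * |L| < ε` keeps them in the strip. The
    -- sign of `L` tells which one is above, and `interiorLeft` which one is in `P`.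
    obtain ⟨τ, ⟨hτi, hτo⟩, hτ⟩ := ((hI.interiorLeft v q hqs).and
      (Ioo_mem_nhdsGT (show (0 : ℝ) < ε / |L| by positivity))).exists
    have hτ0 : 0 < τ := hτ.1
    have hτL : |τ * L| < ε := by
      rw [abs_mul, abs_of_pos hτ0]
      exact (lt_div_iff₀ (abs_pos.2 hL0)).1 hτ.2
    rw [abs_lt] at hτL
    have e1 : q + τ • I.leftNormal xb yb v = (q.1, y₀ + τ * L) := by
      rw [hnorm]; ext <;> simp [hqy]
    have e2 : q - τ • I.leftNormal xb yb v = (q.1, y₀ - τ * L) := by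
      rw [hnorm]; ext <;> simp [hqy]
    rw [e1] at hτi
    rw [e2] at hτo
    have hτi := interior_subset hτi
    have gup : ∀ y z, y₀ ≤ y → y < y₀ + ε → y₀ < z → z < y₀ + ε →
        (Germ P (x, y) ↔ (q.1, z) ∈ P) := by
      intro y z h1 h2 h3 h4
      refine germ_iff_mem (isPreconnected_Ioo_prod x (x + δ) y₀ (y₀ + ε)) ?_ ⟨hqx, h3, h4⟩
        (germ_Ioo_prod le_rfl (lt_add_of_pos_right x hδ0) h1 h2)
      exact Set.disjoint_left.2 fun p hp hpf =>
        hp.2.1.ne' (hfr p hpf hp.1 ⟨by linarith [hp.2.1], hp.2.2⟩).1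
    have gdown : ∀ y z, y₀ - ε < y → y < y₀ → y₀ - ε < z → z < y₀ →
        (Germ P (x, y) ↔ (q.1, z) ∈ P) := by
      intro y z h1 h2 h3 h4
      refine germ_iff_mem (isPreconnected_Ioo_prod x (x + δ) (y₀ - ε) y₀) ?_ ⟨hqx, h3, h4⟩
        (germ_Ioo_prod le_rfl (lt_add_of_pos_right x hδ0) h1.le h2)
      exact Set.disjoint_left.2 fun p hp hpf =>
        hp.2.2.ne (hfr p hpf hp.1 ⟨hp.2.1, by linarith [hp.2.2]⟩).1
    filter_upwards [hnb] with y hy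
    rcases le_or_gt y₀ y with h | h
    · rw [hup y h hy.2]
      congr 1
      have hz : y₀ < y₀ + ε / 2 := by linarith
      exact chi_congr ((gup y _ h hy.2 hz (by linarith)).trans
        (gup y₀ _ le_rfl (by linarith) hz (by linarith)).symm)
    · have hd := hdown y hy.1 h
      rw [hsum] at hd
      have hc : chi P (x, y₀) - chi P (x, y) =
          (ray (I.pt xb yb v).1 - ray (I.pt xb yb (I.next v)).1) x := by
        rw [chi, chi, Pi.sub_apply, ray, ray]
        rcases hvc with ⟨k1, k2⟩ | ⟨k1, k2⟩
        · have hL1 : 0 < L := by linarith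
          have hτL1 : 0 < τ * L := mul_pos hτ0 hL1
          rw [if_pos ((gup y₀ _ le_rfl (by linarith) (by linarith) (by linarith)).2 hτi),
            if_neg (fun h' => hτo ((gdown y _ hy.1 h (by linarith) (by linarith)).1 h')),
            if_pos k1, if_neg (not_le.2 k2)]
        · have hL1 : L < 0 := by linarith
          have hτL1 : τ * L < 0 := mul_neg_of_pos_of_neg hτ0 hL1
          rw [if_pos ((gdown y _ hy.1 h (by linarith) (by linarith)).2 hτi),
            if_neg (fun h' => hτo ((gup y₀ _ le_rfl (by linarith) (by linarith)
              (by linarith)).1 h')), if_neg (not_le.2 k2), if_pos k1]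
      linarith
  · have hsum : (∑ w, (ray (I.pt xb yb w).1 - ray (I.pt xb yb (I.next w)).1) x *
        if (I.pt xb yb w).2 = y₀ then (1 : ℚ) else 0) = 0 := by
      refine Finset.sum_eq_zero fun w _ => ?_
      by_contra hne
      rw [mul_ite, mul_one, mul_zero, ite_eq_right_iff, Classical.not_imp] at hne
      exact hcov ⟨w, hne.1, ray_sub_ray_ne_zero hne.2⟩
    have g : ∀ y, y₀ - ε < y → y < y₀ + ε → (Germ P (x, y) ↔ (x + δ / 2, y₀) ∈ P) := by
      intro y h1 h2
      refine germ_iff_mem (isPreconnected_Ioo_prod x (x + δ) (y₀ - ε) (y₀ + ε)) ?_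
        ⟨⟨by simp [hδ0], by simp [hδ0]⟩, by simp [hε0], by simp [hε0]⟩
        (germ_Ioo_prod le_rfl (lt_add_of_pos_right x hδ0) h1.le h2)
      exact Set.disjoint_left.2 fun p hp hpf => hcov (hfr p hpf hp.1 hp.2).2
    filter_upwards [hnb] with y hy
    have hc : chi P (x, y) = chi P (x, y₀) :=
      chi_congr ((g y hy.1 hy.2).trans (g y₀ (by linarith) (by linarith)).symm)
    rw [hc]
    congr 1
    rcases le_or_gt y₀ y with h | h
    · exact hup y h hy.2
    · have hd := hdown y hy.1 h
      rw [hsum] at hd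
      linarith

/-- The difference is locally constant on each vertical line, hence constant, and it vanishes far
below the polygon. -/
lemma Describes.chi_eq_winding (hI : I.Describes xb yb P) : chi P = I.winding xb yb := by
  ext ⟨x, y⟩
  rw [← sub_eq_zero]
  have hlc : IsLocallyConstant fun y => chi P (x, y) - I.winding xb yb (x, y) :=
    (IsLocallyConstant.iff_eventually_eq _).2 fun y₀ => hI.eventually_chi_sub_winding x y₀
  obtain ⟨M, hM⟩ := hI.polygon.2.1.subset_closedBall 0
  obtain ⟨z, hz⟩ := (Finset.univ.image fun v => (I.pt xb yb v).2).bddBelow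
  -- Below all vertices, with room for a unit square at height `z'` that is still below `P`.
  set z' := min z (-M) - 2 with hz'
  have h1 := min_le_left z (-M)
  have h2 := min_le_right z (-M)
  rw [hlc.apply_eq_of_isPreconnected isPreconnected_univ (mem_univ y) (mem_univ z'), sub_eq_zero]
  rw [chi, if_neg, winding, Finset.sum_eq_zero]
  · intro v _
    have := hz (Finset.mem_coe.2 (Finset.mem_image_of_mem (fun v => (I.pt xb yb v).2)
      (Finset.mem_univ v)))
    rw [ray, if_neg (by simp only at this ⊢; linarith), mul_zero]
  · intro h
    obtain ⟨δ, hδ0, hδ⟩ := h.inter (germ_Ioo_prod (p := (x, z')) (a := x) (b := x + 1) (c := z')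
      (d := z' + 1) le_rfl (by simp) le_rfl (by simp))
    obtain ⟨p, hp⟩ := quad_nonempty (x, z') hδ0
    obtain ⟨hp1, hp2⟩ := hδ hp
    have h3 := mem_closedBall_zero_iff.1 (hM hp1)
    have h4 := (abs_le.1 ((Real.norm_eq_abs _).symm.le.trans ((norm_snd_le p).trans h3))).1
    linarith [hp2.2.2]

/-- The boundary formula for the valuation of a polygon. -/
lemma Describes.val_chi (hI : I.Describes xb yb P) (f g : ℝ →ₗ[ℚ] ℚ) :
    val f g (chi P) = -∑ v, g (I.pt xb yb v).2 *
      (f (I.pt xb yb (I.next v)).1 - f (I.pt xb yb v).1) := by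
  have h : chi P = ∑ v, fun p : Plane => (ray (I.pt xb yb v).1 - ray (I.pt xb yb (I.next v)).1) p.1
      * ray (I.pt xb yb v).2 p.2 := by
    rw [hI.chi_eq_winding]; ext p; rw [winding, Finset.sum_apply]
  rw [h, map_sum, ← Finset.sum_neg_distrib]
  refine Finset.sum_congr rfl fun v _ => ?_
  rw [val_mul, map_sub, stepVal_ray, stepVal_ray, stepVal_ray]
  ring

end PolygonInput

/-! ### The Dehn matrix as a bilinear form, and the lower bound -/

lemma map_comb {ι : Type} [Fintype ι] (f : ℝ →ₗ[ℚ] ℚ) (b : ι → ℝ) (a : ι → ℚ) :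
    f (comb b a) = ∑ i, a i * f (b i) := by
  simp only [comb, map_sum, ← Rat.smul_def, map_smul, smul_eq_mul]

namespace PolygonInput

variable {m n : ℕ} {I : PolygonInput m n} {xb : Fin m → ℝ} {yb : Fin n → ℝ} {P : Set Plane}

/-- The base vertex drops out because `next` is a permutation, so the horizontal displacements sum
to zero. -/
lemma dehnMatrix_eq (b : Fin I.V) (k : Fin n) (j : Fin m) :
    I.dehnMatrix b k j = -∑ v, I.yc v k * (I.xc (I.next v) j - I.xc v j) := by
  have h : ∑ v, (I.xc (I.next v) j - I.xc v j) = 0 := by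
    rw [Finset.sum_sub_distrib, Equiv.sum_comp I.next fun v => I.xc v j, sub_self]
  simp only [dehnMatrix, sub_mul]
  rw [Finset.sum_sub_distrib, ← Finset.mul_sum, h]
  ring

lemma Describes.val_chi_eq_dehnMatrix (hI : I.Describes xb yb P) (b : Fin I.V)
    (f g : ℝ →ₗ[ℚ] ℚ) :
    val f g (chi P) = ∑ k, ∑ j, I.dehnMatrix b k j * (g (yb k) * f (xb j)) := by
  rw [hI.val_chi]
  simp only [dehnMatrix_eq, pt, map_comb, ← Finset.sum_sub_distrib, ← sub_mul, neg_mul,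
    Finset.sum_neg_distrib, Finset.sum_mul, Finset.mul_sum]
  congr 1
  rw [Finset.sum_comm]
  refine (Finset.sum_congr rfl fun j _ => Finset.sum_comm).trans ?_
  rw [Finset.sum_comm]
  refine Finset.sum_congr rfl fun k _ => Finset.sum_congr rfl fun j _ =>
    Finset.sum_congr rfl fun v _ => ?_
  ring

/-- The rank of the Dehn matrix bounds the number of rectangles from below. -/
lemma Describes.rank_dehnMatrix_le (hI : I.Describes xb yb P) (hx : LinearIndependent ℚ xb)
    (hy : LinearIndependent ℚ yb) (b : Fin I.V) {r : ℕ} (h : DissectsIntoRectangles P r) :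
    (I.dehnMatrix b).rank ≤ r := by
  classical
  obtain ⟨w, h, hwh, hP⟩ := h
  -- Coordinate functionals of the two bases, extended to all of `ℝ`: the sides of the rectangles
  -- need not lie in the spans of the bases.
  choose ξ hξ using fun j : Fin m => LinearIndependent.exists_linearMap hx (Pi.single j 1)
  choose η hη using fun k : Fin n => LinearIndependent.exists_linearMap hy (Pi.single k 1)
  have hD : I.dehnMatrix b = (Matrix.of fun k i => η k (h i) : Matrix (Fin n) (Fin r) ℚ) *
      Matrix.of fun i j => ξ j (w i) := by
    ext k j
    have h1 := hI.val_chi_eq_dehnMatrix b (ξ j) (η k)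
    rw [hP.val_chi hwh] at h1
    simp only [hξ, hη, Pi.single_apply] at h1
    simp only [mul_ite, mul_one, mul_zero, Finset.sum_ite_eq', Finset.mem_univ, if_true] at h1
    rw [Matrix.mul_apply, ← h1]
    exact Finset.sum_congr rfl fun i _ => mul_comm _ _
  rw [hD]
  exact (Matrix.rank_mul_le_left _ _).trans (Matrix.rank_le_width _)

end PolygonInput

/-! ### Cutting boxes -/

lemma swap_image_box (p s : Plane) :
    Homeomorph.prodComm ℝ ℝ '' box p s = box p.swap s.swap := by
  rw [box_eq_prod, box_eq_prod]
  exact image_swap_prod _ _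

lemma TiledBy.swap_image {A : Set Plane} {ι : Type} {s : ι → Plane} (h : TiledBy A s) :
    TiledBy (Homeomorph.prodComm ℝ ℝ '' A) (fun i => (s i).swap) := by
  obtain ⟨p, hp⟩ := h
  refine ⟨fun i => (p i).swap, ?_⟩
  simp only [← swap_image_box]
  exact Subdivides.image hp (Homeomorph.prodComm ℝ ℝ)

lemma TiledBy.reindex {A : Set Plane} {ι κ : Type} {s : ι → Plane} (h : TiledBy A s)
    (e : κ ≃ ι) : TiledBy A fun k => s (e k) := by
  obtain ⟨p, hp⟩ := h
  exact ⟨fun k => p (e k), hp.reindex e⟩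

lemma Subdivides.tiledBy {A : Set Plane} {ι : Type} {κ : ι → Type} {B : ι → Set Plane}
    (h : Subdivides B A) {s : ∀ i, κ i → Plane} (hs : ∀ i, TiledBy (B i) (s i)) :
    TiledBy A fun x : Σ i, κ i => s x.1 x.2 := by
  choose p hp using hs
  exact ⟨fun x => p x.1 x.2, h.sigma hp⟩

/-- Induction on the index type splits off one box at the left. The index type must be nonempty: an
empty sum would give a box of width zero, which need not be an empty union. -/
lemma box_tiledBy_width (ι : Type) [Fintype ι] : ∀ (l : ι → ℝ) (p : Plane) (h : ℝ), Nonempty ι →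
    (∀ i, 0 < l i) → TiledBy (box p (∑ i, l i, h)) fun i => (l i, h) := by
  refine Fintype.induction_empty_option (P := fun ι _ => ∀ (l : ι → ℝ) (p : Plane) (h : ℝ),
    Nonempty ι → (∀ i, 0 < l i) → TiledBy (box p (∑ i, l i, h)) fun i => (l i, h)) ?_ ?_ ?_ ι
  · intro α β _ e ih l p h hne hl
    let _ := Fintype.ofEquiv β e.symm
    have := (ih (fun a => l (e a)) p h (e.nonempty_congr.2 hne) fun a => hl _).reindex e.symm
    rw [Equiv.sum_comp e l] at this
    simpa using this
  · exact fun _ _ _ h => isEmptyElim h.some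
  · intro α _ ih l p h _ hl
    rw [Fintype.sum_option]
    rcases isEmpty_or_nonempty α with hα | hα
    · refine ⟨fun _ => p, ?_, fun i j hij => ?_⟩
      · rw [iUnion_option]; simp
      · rcases i with _ | i
        · rcases j with _ | j
          · exact absurd rfl hij
          · exact isEmptyElim j
        · exact isEmptyElim i
    · obtain ⟨q, hq1, hq2⟩ := ih (fun a => l (some a)) (p + (l none, 0)) h hα fun a => hl _
      have h0 := hl none
      have h1 : 0 < ∑ a, l (some a) := Finset.sum_pos (fun a _ => hl _) Finset.univ_nonempty
      refine ⟨fun o => o.elim p q, ?_, ?_⟩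
      · rw [iUnion_option]
        simp only [Option.elim_none, Option.elim_some]
        rw [hq1, box_eq_prod, box_eq_prod, box_eq_prod]
        simp only [Prod.fst_add, Prod.snd_add, add_zero]
        rw [← union_prod, Icc_union_Icc_eq_Icc (by linarith) (by linarith), add_assoc]
      · have hd : ∀ a, Disjoint (interior (box p (l none, h)))
            (interior (box (q a) (l (some a), h))) := by
          intro a
          refine Disjoint.mono_right (interior_mono (hq1 ▸ subset_iUnion (fun a => box (q a)
            (l (some a), h)) a)) ?_
          rw [interior_box, interior_box]
          refine disjoint_prod.2 (Or.inl (Set.disjoint_left.2 fun x hx hx' => ?_))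
          have h3 : p.1 + l none < x := hx'.1
          exact absurd hx.2 (not_lt.2 h3.le)
        intro i j hij
        rcases i with _ | i <;> rcases j with _ | j
        · exact absurd rfl hij
        · exact hd j
        · exact (hd i).symm
        · exact hq2 i j fun h => hij (congrArg some h)

lemma box_tiledBy_height {ι : Type} [Fintype ι] [Nonempty ι] (l : ι → ℝ) (p : Plane) (w : ℝ)
    (hl : ∀ i, 0 < l i) : TiledBy (box p (w, ∑ i, l i)) fun i => (w, l i) := by
  have := (box_tiledBy_width ι l p.swap w inferInstance hl).swap_image
  rwa [swap_image_box] at this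

lemma box_tiledBy_prod {ι κ : Type} [Fintype ι] [Nonempty ι] [Fintype κ] [Nonempty κ]
    (l : ι → ℝ) (h : κ → ℝ) (p : Plane) (hl : ∀ i, 0 < l i) (hh : ∀ k, 0 < h k) :
    TiledBy (box p (∑ i, l i, ∑ k, h k)) fun x : ι × κ => (l x.1, h x.2) := by
  obtain ⟨q, hq⟩ := box_tiledBy_width ι l p (∑ k, h k) inferInstance hl
  exact (hq.tiledBy fun i => box_tiledBy_height h (q i) (l i) hh).reindex
    (Equiv.sigmaEquivProd ι κ).symm

/-- The number `x` is a combination of the numbers `c k` with natural coefficients. -/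
def NatComb {p : ℕ} (c : Fin p → ℝ) (x : ℝ) : Prop := ∃ a : Fin p → ℕ, x = ∑ k, a k * c k

/-- `A` is subdivided into finitely many boxes with widths among the `c k` and heights among the
`e l`. -/
def GridTiled {p q : ℕ} (c : Fin p → ℝ) (e : Fin q → ℝ) (A : Set Plane) : Prop :=
  ∃ (T : Type) (_ : Fintype T) (τ : T → Fin p × Fin q), TiledBy A fun t => (c (τ t).1, e (τ t).2)

/-- Repeats each `c k` as often as its coefficient says; positivity of `x` rules out the empty sum.
-/
lemma NatComb.exists_sum {p : ℕ} {c : Fin p → ℝ} {x : ℝ} (h : NatComb c x) (hx : 0 < x) :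
    ∃ (T : Type) (_ : Fintype T) (_ : Nonempty T) (τ : T → Fin p), x = ∑ t, c (τ t) := by
  obtain ⟨a, rfl⟩ := h
  have e : ∑ k, a k * c k = ∑ t : Σ k, Fin (a k), c t.1 := by
    rw [Fintype.sum_sigma]; simp
  refine ⟨Σ k, Fin (a k), inferInstance, ?_, Sigma.fst, e⟩
  by_contra hn
  rw [not_nonempty_iff] at hn
  rw [e] at hx
  simp at hx

lemma GridTiled.of_subdivides {p q : ℕ} {c : Fin p → ℝ} {e : Fin q → ℝ} {A : Set Plane} {ι : Type}
    [Fintype ι] {B : ι → Set Plane} (h : Subdivides B A) (hB : ∀ i, GridTiled c e (B i)) :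
    GridTiled c e A := by
  choose T hT τ hτ using hB
  exact ⟨Σ i, T i, inferInstance, fun x => τ x.1 x.2, h.tiledBy hτ⟩

lemma gridTiled_box {p q : ℕ} {c : Fin p → ℝ} {e : Fin q → ℝ} (hc : ∀ k, 0 < c k)
    (he : ∀ k, 0 < e k) (z s : Plane) (h : 0 < s.1 ∧ 0 < s.2) (h1 : NatComb c s.1)
    (h2 : NatComb e s.2) : GridTiled c e (box z s) := by
  obtain ⟨T, _, _, τ, hτ⟩ := h1.exists_sum h.1
  obtain ⟨U, _, _, υ, hυ⟩ := h2.exists_sum h.2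
  have := box_tiledBy_prod (fun t => c (τ t)) (fun u => e (υ u)) z (fun _ => hc _) fun _ => he _
  rw [← hτ, ← hυ] at this
  exact ⟨T × U, inferInstance, fun x => (τ x.1, υ x.2), this⟩

/-! ### Positive bases -/

/-- Call the quotient `σ`. The hypotheses give `0 < σ < 1`. If `q i ≤ 0`, the difference is at least
`x i`; otherwise it exceeds `x i - q i`. Geometrically, divided by `s`, these numbers are the
coordinates of `x` in the narrow cone spanned by the vectors `q + s e_i`, with `e_i` the unit
vectors. They serve both for positive bases and for positive factorizations. -/
lemma cone_pos {ι : Type} [Fintype ι] {x q : ι → ℝ} {s : ℝ} (hx : ∀ i, 0 < x i)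
    (hq : ∀ i, q i < x i) (hs : ∑ i, (x i - q i) < s) (i : ι) :
    0 < x i - (∑ j, x j) / (s + ∑ j, q j) * q i := by
  rw [Finset.sum_sub_distrib] at hs
  have h1 : 0 < ∑ j, x j := Finset.sum_pos (fun j _ => hx j) ⟨i, Finset.mem_univ i⟩
  have h2 : 0 < s + ∑ j, q j := by linarith
  have h3 : (∑ j, x j) / (s + ∑ j, q j) < 1 := by rw [div_lt_one h2]; linarith
  have h4 : 0 < (∑ j, x j) / (s + ∑ j, q j) := div_pos h1 h2
  rcases le_or_gt (q i) 0 with h | h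
  · nlinarith [hx i]
  · nlinarith [hq i]

lemma exists_common_denominator (s : Finset ℚ) :
    ∃ N : ℕ, 0 < N ∧ ∀ q ∈ s, 0 < q → ∃ a : ℕ, q * N = a := by
  refine ⟨∏ q ∈ s, q.den, Finset.prod_pos fun q _ => q.den_pos, fun q hq h0 => ?_⟩
  obtain ⟨d, hd⟩ := Finset.dvd_prod_of_mem Rat.den hq
  refine ⟨q.num.toNat * d, ?_⟩
  rw [hd, Nat.cast_mul, ← mul_assoc, Rat.mul_den_eq_num, Nat.cast_mul]
  congr 1
  have := Int.toNat_of_nonneg (Rat.num_nonneg.2 h0.le)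
  exact_mod_cast this.symm

/-- Finitely many positive reals are natural combinations of finitely many positive reals that are
linearly independent over the rationals. -/
lemma exists_positive_basis (W : Finset ℝ) (hW : ∀ w ∈ W, 0 < w) :
    ∃ (p : ℕ) (c : Fin p → ℝ), LinearIndependent ℚ c ∧ (∀ k, 0 < c k) ∧
      ∀ w ∈ W, NatComb c w := by
  classical
  obtain ⟨b, hbW, hspan, hb⟩ := exists_linearIndependent ℚ (W : Set ℝ)
  have hbf : Finite b := (W.finite_toSet.subset hbW).to_subtype
  have := Fintype.ofFinite b
  set p := Fintype.card b
  let ε : Fin p ≃ b := (Fintype.equivFin b).symm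
  set x : Fin p → ℝ := fun i => (ε i : ℝ) with hx
  have hxi : LinearIndependent ℚ x := hb.comp ε ε.injective
  have hx0 : ∀ i, 0 < x i := fun i => hW _ (hbW (ε i).2)
  have hrange : Set.range x = b := by
    rw [hx, ← Function.comp_def, ε.surjective.range_comp, Subtype.range_coe]
  have hα : ∀ w : ℝ, ∃ α : Fin p → ℚ, w ∈ W → ∑ i, (α i : ℝ) * x i = w := by
    intro w
    by_cases hw : w ∈ W
    · have : w ∈ Submodule.span ℚ (Set.range x) := by
        rw [hrange, hspan]; exact Submodule.subset_span hw
      obtain ⟨α, h⟩ := (Submodule.mem_span_range_iff_exists_fun ℚ).1 this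
      exact ⟨α, fun _ => by simpa only [Rat.smul_def] using h⟩
    · exact ⟨0, fun h => absurd h hw⟩
  choose α hα using hα
  -- The coefficient `β w k` below differs from `w` by at most `2 * s * ∑ |α w i|`: once for
  -- replacing `x` by `q`, once for the term `s * α w k`. The summand `1` keeps the divisor
  -- positive.
  obtain ⟨δ, hδ, hδ0⟩ : ∃ δ, (∀ w ∈ W, δ * (2 * ∑ i, |(α w i : ℝ)| + 1) < w) ∧ (0 : ℝ) < δ := by
    have h : ∀ w ∈ W, ∀ᶠ δ in 𝓝[>] (0 : ℝ), δ * (2 * ∑ i, |(α w i : ℝ)| + 1) < w := by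
      intro w hw
      have h0 : 0 < 2 * ∑ i, |(α w i : ℝ)| + 1 := by positivity
      filter_upwards [Ioo_mem_nhdsGT (div_pos (hW w hw) h0)] with δ hδ
      exact (lt_div_iff₀ h0).1 hδ.2
    exact (((eventually_all_finset W).2 h).and self_mem_nhdsWithin).exists
  obtain ⟨s, hs0, hsδ⟩ := exists_rat_btwn hδ0
  have hs0' : (0 : ℚ) < s := by exact_mod_cast hs0
  -- Dividing by `p + 1` keeps the sum of the `p` errors strictly below `s`, as `cone_pos` requires,
  -- also for `p = 0`.
  have hq : ∀ i, ∃ q : ℚ, x i - s / (p + 1) < q ∧ q < x i := fun i =>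
    exists_rat_btwn (sub_lt_self _ (by positivity))
  choose q hq1 hq2 using hq
  have hsp : (s : ℝ) / (p + 1) ≤ s := div_le_self hs0.le (by linarith [p.cast_nonneg (α := ℝ)])
  have hsum : ∑ i, (x i - q i) < s := by
    calc ∑ i, (x i - q i) ≤ ∑ i : Fin p, (s : ℝ) / (p + 1) :=
          Finset.sum_le_sum fun i _ => by linarith [hq1 i]
      _ = s * (p / (p + 1)) := by simp; ring
      _ < s * 1 := mul_lt_mul_of_pos_left ((div_lt_one (by positivity)).2 (by linarith)) hs0
      _ = s := mul_one _
  -- The coordinates `c` solve `x i = σ * q i + s * c i` with `σ = ∑ c k`. Hence `x` is a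
  -- combination of the `c k` with the rational coefficients `q i + s δ_ki`, with `δ_ki` the
  -- Kronecker delta.
  set σ := (∑ j, x j) / (s + ∑ j, (q j : ℝ)) with hσ
  set c : Fin p → ℝ := fun i => (x i - σ * q i) / s with hc
  have hc0 : ∀ i, 0 < c i := fun i => div_pos (cone_pos hx0 hq2 hsum i) hs0
  have hcsum : ∀ _ : Fin p, ∑ i, c i = σ := by
    intro i
    rw [Finset.sum_sub_distrib] at hsum
    have h1 : 0 < ∑ j, x j := Finset.sum_pos (fun j _ => hx0 j) ⟨i, Finset.mem_univ i⟩
    have h2 : 0 < s + ∑ j, (q j : ℝ) := by linarith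
    rw [← Finset.sum_div, Finset.sum_sub_distrib, ← Finset.mul_sum, div_eq_iff hs0.ne', hσ]
    field_simp
    ring
  have hxc : ∀ i, x i = ∑ k, c k * (q i + if k = i then (s : ℝ) else 0) := by
    intro i
    simp only [mul_add, Finset.sum_add_distrib, ← Finset.sum_mul, hcsum i]
    simp [hc, hs0.ne']
  set β : ℝ → Fin p → ℚ := fun w k => ∑ i, α w i * q i + s * α w k with hβ
  have hβc : ∀ w ∈ W, w = ∑ k, (β w k : ℝ) * c k := by
    intro w hw
    conv_lhs => rw [← hα w hw]
    simp only [hxc _, Finset.mul_sum]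
    rw [Finset.sum_comm]
    refine Finset.sum_congr rfl fun k _ => ?_
    simp only [hβ, mul_add, Finset.sum_add_distrib]
    push_cast
    simp [add_mul, Finset.sum_mul]
    congr 1
    · exact Finset.sum_congr rfl fun i _ => by ring
    · ring
  have hβ0 : ∀ w ∈ W, ∀ k, 0 < β w k := by
    intro w hw k
    have h1 : w - ∑ i, (α w i : ℝ) * q i ≤ s * ∑ i, |(α w i : ℝ)| := by
      rw [show w - ∑ i, (α w i : ℝ) * q i = ∑ i, (α w i : ℝ) * x i - ∑ i, (α w i : ℝ) * q i by
        rw [hα w hw], ← Finset.sum_sub_distrib, Finset.mul_sum]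
      refine Finset.sum_le_sum fun i _ => ?_
      have := hq1 i
      have h3 : 0 < x i - q i := sub_pos.2 (hq2 i)
      rw [← mul_sub, mul_comm (s : ℝ)]
      exact mul_le_mul (le_abs_self _) (by linarith) h3.le (abs_nonneg _)
    have h2 : |(α w k : ℝ)| ≤ ∑ i, |(α w i : ℝ)| :=
      Finset.single_le_sum (fun i _ => abs_nonneg (α w i : ℝ)) (Finset.mem_univ k)
    have h3 := hδ w hw
    have h4 : (0 : ℝ) < β w k := by
      simp only [hβ]
      push_cast
      nlinarith [neg_abs_le (α w k : ℝ), abs_nonneg (α w k : ℝ)]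
    exact_mod_cast h4
  -- The `p` numbers `c k` span all `p` independent numbers `x i`.
  have hci : LinearIndependent ℚ c := by
    rw [linearIndependent_iff_card_le_finrank_span, ← finrank_span_eq_card hxi]
    have : FiniteDimensional ℚ (Submodule.span ℚ (Set.range c)) :=
      FiniteDimensional.span_of_finite ℚ (Set.finite_range c)
    refine Submodule.finrank_mono (Submodule.span_le.2 ?_)
    rintro _ ⟨i, rfl⟩
    rw [hxc i]
    refine Submodule.sum_mem _ fun k _ => ?_
    have h1 : c k * (q i + if k = i then (s : ℝ) else 0) =
        (q i + if k = i then s else 0 : ℚ) • c k := by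
      rw [Rat.smul_def, mul_comm]; split_ifs <;> push_cast <;> rfl
    rw [h1]
    exact Submodule.smul_mem _ _ (Submodule.subset_span ⟨k, rfl⟩)
  -- Dividing `c` by a common denominator turns the positive rational coefficients into natural
  -- numbers.
  obtain ⟨N, hN0, hN⟩ := exists_common_denominator
    ((W ×ˢ (Finset.univ : Finset (Fin p))).image fun z => β z.1 z.2)
  have hN0' : (N : ℚ)⁻¹ ≠ 0 := by positivity
  refine ⟨p, fun k => (N : ℚ)⁻¹ • c k, hci.units_smul fun _ => Units.mk0 _ hN0', fun k => ?_,
    fun w hw => ?_⟩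
  · have := hc0 k
    simp only [Rat.smul_def]
    push_cast
    positivity
  · choose a ha using fun k => hN (β w k) (Finset.mem_image.2
      ⟨(w, k), Finset.mem_product.2 ⟨hw, Finset.mem_univ k⟩, rfl⟩) (hβ0 w hw k)
    refine ⟨a, ?_⟩
    conv_lhs => rw [hβc w hw]
    refine Finset.sum_congr rfl fun k _ => ?_
    have h1 : (β w k : ℝ) * N = a k := by exact_mod_cast ha k
    have h2 : (N : ℝ) ≠ 0 := by positivity
    simp only [← h1, Rat.smul_def]
    push_cast
    field_simp

/-! ### Dissection of polygons with equal valuations -/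

lemma exists_equiv_of_card_fiber {T U C : Type} [Fintype T] [Fintype U] [DecidableEq C]
    (τ : T → C) (υ : U → C)
    (h : ∀ x, Fintype.card {t // τ t = x} = Fintype.card {u // υ u = x}) :
    ∃ σ : T ≃ U, ∀ t, υ (σ t) = τ t := by
  let e : ∀ x, {t // τ t = x} ≃ {u // υ u = x} := fun x => Fintype.equivOfCardEq (h x)
  exact ⟨(Equiv.sigmaFiberEquiv τ).symm.trans
    ((Equiv.sigmaCongrRight e).trans (Equiv.sigmaFiberEquiv υ)), fun t => (e (τ t) ⟨t, rfl⟩).2⟩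

/-- Dual functionals make each summand the indicator of the box type `x`, so this valuation counts
the boxes of that type. -/
lemma card_fiber_eq_val {p q : ℕ} {c : Fin p → ℝ} {e : Fin q → ℝ} {f g : ℝ →ₗ[ℚ] ℚ} {x : Fin p × Fin q}
    (hf : ∀ k, f (c k) = if k = x.1 then 1 else 0) (hg : ∀ k, g (e k) = if k = x.2 then 1 else 0)
    {T : Type} [Fintype T] (τ : T → Fin p × Fin q) :
    ∑ t, f (c (τ t).1) * g (e (τ t).2) = Fintype.card {t // τ t = x} := by
  rw [Fintype.card_subtype, Finset.card_filter, Nat.cast_sum]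
  refine Finset.sum_congr rfl fun t _ => ?_
  rw [hf, hg]
  by_cases h1 : (τ t).1 = x.1 <;> by_cases h2 : (τ t).2 = x.2 <;> simp [h1, h2, Prod.ext_iff]

/-- A tiled set has an orthogonal dissection into rectangles with the same valuations. -/
theorem Tiled.dissectsInto {P : Set Plane} (hP : Tiled P) {r : ℕ} {w h : Fin r → ℝ}
    (hwh : ∀ j, 0 < w j ∧ 0 < h j)
    (hval : ∀ f g : ℝ →ₗ[ℚ] ℚ, val f g (chi P) = ∑ j, f (w j) * g (h j)) :
    DissectsInto P fun j => rectangle (w j) (h j) := by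
  classical
  obtain ⟨ι, hι, s, hs, z, hz⟩ := hP
  have := Fintype.ofFinite ι
  -- One basis for the widths of the tiles of `P` and of the target rectangles together, so that
  -- both are cut into boxes of the same types; likewise for heights.
  obtain ⟨p, c, hc, hc0, hcW⟩ := exists_positive_basis
    (Finset.univ.image (fun i => (s i).1) ∪ Finset.univ.image w) (by
      intro x hx
      simp only [Finset.mem_union, Finset.mem_image, Finset.mem_univ, true_and] at hx
      rcases hx with ⟨i, rfl⟩ | ⟨j, rfl⟩
      exacts [(hs i).1, (hwh j).1])
  obtain ⟨q, e, he, he0, heW⟩ := exists_positive_basis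
    (Finset.univ.image (fun i => (s i).2) ∪ Finset.univ.image h) (by
      intro x hx
      simp only [Finset.mem_union, Finset.mem_image, Finset.mem_univ, true_and] at hx
      rcases hx with ⟨i, rfl⟩ | ⟨j, rfl⟩
      exacts [(hs i).2, (hwh j).2])
  obtain ⟨T, _, τ, hT⟩ : GridTiled c e P := GridTiled.of_subdivides hz fun i =>
    gridTiled_box hc0 he0 _ _ (hs i) (hcW _ (by simp)) (heW _ (by simp))
  have hR : ∀ j, GridTiled c e (rectangle (w j) (h j)) := fun j => by
    rw [rectangle_eq_box]
    exact gridTiled_box hc0 he0 _ _ (hwh j) (hcW _ (by simp)) (heW _ (by simp))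
  choose U hU υ hυ using hR
  -- Equal valuations mean equally many boxes of each type on both sides, hence a bijection
  -- preserving types.
  obtain ⟨σ, hσ⟩ := exists_equiv_of_card_fiber τ (fun u : Σ j, U j => υ u.1 u.2) (by
    intro x
    obtain ⟨f, hf⟩ := LinearIndependent.exists_linearMap hc fun k => if k = x.1 then 1 else 0
    obtain ⟨g, hg⟩ := LinearIndependent.exists_linearMap he fun k => if k = x.2 then 1 else 0
    have h1 := hT.val_chi (fun t => ⟨hc0 _, he0 _⟩) f g
    rw [hval f g] at h1
    have h2 : ∀ j, f (w j) * g (h j) = ∑ u, f (c (υ j u).1) * g (e (υ j u).2) := fun j => by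
      rw [← (hυ j).val_chi (fun t => ⟨hc0 _, he0 _⟩) f g, rectangle_eq_box,
        val_box f g 0 (w j, h j) (hwh j)]
    simp only [h2] at h1
    rw [card_fiber_eq_val hf hg τ, ← Fintype.sum_sigma' fun j u => f (c (υ j u).1) * g (e (υ j u).2),
      card_fiber_eq_val hf hg fun u : Σ j, U j => υ u.1 u.2] at h1
    exact_mod_cast h1.symm)
  obtain ⟨y, hy⟩ := hT
  choose y' hy' using hυ
  let ε : Fin (Fintype.card T) ≃ T := (Fintype.equivFin T).symm
  refine ⟨Fintype.card T, fun i => box (y (ε i)) (c (τ (ε i)).1, e (τ (ε i)).2),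
    fun i => y' (σ (ε i)).1 (σ (ε i)).2 - y (ε i), fun i => (σ (ε i)).1,
    fun i => isOrthogonalPolygon_box _ _ ⟨hc0 _, he0 _⟩, hy.reindex ε, fun j => ?_⟩
  have h3 := (hy' j).reindex (((ε.trans σ).subtypeEquiv fun _ => Iff.rfl).trans
    (Equiv.sigmaSubtype j))
  refine (congrArg (fun B => Subdivides B _) (funext fun i => ?_)).mpr h3
  rw [image_add_box, add_sub_cancel, ← hσ]
  obtain ⟨i, rfl⟩ := i
  rfl

end OrthoDissection

end

noncomputable section

namespace OrthoDissection

/-! ### Rank factorization -/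

/-- The two matrices differ by a matrix of rank at most one, which bounds the drop. The drop does
occur: the new column space lies in the old one and vanishes in coordinate `k`, whereas column `j`
of `D` does not. -/
lemma rank_eq_rank_pivot_add_one {m n : ℕ} (D : Matrix (Fin n) (Fin m) ℚ) {k : Fin n} {j : Fin m}
    (h : D k j ≠ 0) :
    D.rank = (Matrix.of fun i l => D i l - D i j * (D k l / D k j)).rank + 1 := by
  set D' : Matrix (Fin n) (Fin m) ℚ := Matrix.of fun i l => D i l - D i j * (D k l / D k j)
    with hD'
  apply le_antisymm
  · have e : D = D' + Matrix.vecMulVec (fun i => D i j) (fun l => D k l / D k j) := by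
      ext i l; simp [hD', Matrix.vecMulVec_apply]
    conv_lhs => rw [e]
    refine le_trans ?_ (Nat.add_le_add_left
      (Matrix.rank_vecMulVec_le (fun i => D i j) fun l => D k l / D k j) _)
    rw [Matrix.rank, Matrix.mulVecLin_add]
    exact (Submodule.finrank_mono (LinearMap.range_add_le _ _)).trans
      (Submodule.finrank_add_le_finrank_add_finrank _ _)
  · have e : ∀ v, D'.mulVec v =
        D.mulVec (v - (∑ l, D k l / D k j * v l) • Pi.single j 1) := by
      intro v
      rw [Matrix.mulVec_sub, Matrix.mulVec_smul, Matrix.mulVec_single_one]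
      ext i
      simp only [hD', Matrix.mulVec, dotProduct, Matrix.of_apply, Pi.sub_apply, Pi.smul_apply,
        Matrix.col_apply, smul_eq_mul, sub_mul, Finset.sum_sub_distrib, Finset.sum_mul]
      congr 1
      exact Finset.sum_congr rfl fun l _ => by ring
    refine Nat.succ_le_of_lt (Submodule.finrank_lt_finrank_of_lt (lt_of_le_of_ne ?_ ?_))
    · rintro _ ⟨v, rfl⟩
      exact ⟨_, (e v).symm⟩
    · intro hne
      have hm : D.mulVec (Pi.single j 1) ∈ LinearMap.range D'.mulVecLin := by
        rw [hne]; exact ⟨_, rfl⟩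
      obtain ⟨v, hv⟩ := hm
      have hv := congrFun hv k
      rw [Matrix.mulVecLin_apply, Matrix.mulVec_single_one, Matrix.col_apply] at hv
      apply h
      rw [← hv]
      simp only [hD', Matrix.mulVec, dotProduct, Matrix.of_apply]
      exact Finset.sum_eq_zero fun l _ => by rw [mul_div_cancel₀ _ h]; ring

/-- The upper left block of a two-dimensional array. -/
def toMatrix (n m : ℕ) (D : ℕ → ℕ → ℚ) : Matrix (Fin n) (Fin m) ℚ := Matrix.of fun i l => D i l

/-- The state of an elimination of `D₀`: `r` products of the columns `G t` and the rows `W t` have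
been subtracted, and `D` remains. -/
structure Eliminated (n m : ℕ) (D₀ D G W : ℕ → ℕ → ℚ) (r : ℕ) : Prop where
  sum : ∀ i < n, ∀ l < m, D₀ i l = D i l + ∑ t ∈ Finset.range r, G t i * W t l
  rank : (toMatrix n m D₀).rank = r + (toMatrix n m D).rank
  ne_col : ∀ t < r, ∃ i < n, G t i ≠ 0
  ne_row : ∀ t < r, ∃ l < m, W t l ≠ 0

namespace Eliminated

variable {n m : ℕ} {D₀ D D' G G' W W' : ℕ → ℕ → ℚ} {r : ℕ}

lemma init (D G W : ℕ → ℕ → ℚ) : Eliminated n m D D G W 0 :=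
  ⟨by simp, by simp, by simp, by simp⟩

/-- The new column contains the pivot `D k j` and the new row has entry `1` at `j`, so both are
nonzero. The arrays are constrained only on the indices that matter. -/
lemma pivot (h : Eliminated n m D₀ D G W r) {k j : ℕ} (hk : k < n) (hj : j < m)
    (hkj : D k j ≠ 0) (hG : ∀ t < r, ∀ i < n, G' t i = G t i) (hGr : ∀ i < n, G' r i = D i j)
    (hW : ∀ t < r, ∀ l < m, W' t l = W t l) (hWr : ∀ l < m, W' r l = D k l / D k j)
    (hD : ∀ i < n, ∀ l < m, D' i l = D i l - D i j * (D k l / D k j)) :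
    Eliminated n m D₀ D' G' W' (r + 1) := by
  refine ⟨fun i hi l hl => ?_, ?_, fun t ht => ?_, fun t ht => ?_⟩
  · rw [Finset.sum_range_succ, h.sum i hi l hl, hD i hi l hl, hGr i hi, hWr l hl]
    have e : ∑ t ∈ Finset.range r, G' t i * W' t l = ∑ t ∈ Finset.range r, G t i * W t l :=
      Finset.sum_congr rfl fun t ht => by
        rw [hG t (Finset.mem_range.1 ht) i hi, hW t (Finset.mem_range.1 ht) l hl]
    rw [e]
    ring
  · have e : toMatrix n m D' = Matrix.of fun i l => toMatrix n m D i l -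
        toMatrix n m D i ⟨j, hj⟩ *
          (toMatrix n m D ⟨k, hk⟩ l / toMatrix n m D ⟨k, hk⟩ ⟨j, hj⟩) := by
      ext i l; exact hD i i.2 l l.2
    rw [h.rank, rank_eq_rank_pivot_add_one (toMatrix n m D) (k := ⟨k, hk⟩) (j := ⟨j, hj⟩) hkj, e]
    ring
  · rcases Nat.lt_succ_iff_lt_or_eq.1 ht with h' | rfl
    · obtain ⟨i, hi, hne⟩ := h.ne_col t h'
      exact ⟨i, hi, by rwa [hG t h' i hi]⟩
    · exact ⟨k, hk, by rwa [hGr k hk]⟩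
  · rcases Nat.lt_succ_iff_lt_or_eq.1 ht with h' | rfl
    · obtain ⟨l, hl, hne⟩ := h.ne_row t h'
      exact ⟨l, hl, by rwa [hW t h' l hl]⟩
    · exact ⟨j, hj, by rw [hWr j hj, div_self hkj]; exact one_ne_zero⟩

lemma rank_eq (h : Eliminated n m D₀ D G W r) (hD : ∀ i < n, ∀ l < m, D i l = 0) :
    (toMatrix n m D₀).rank = r := by
  have : toMatrix n m D = 0 := by ext i l; exact hD i i.2 l l.2
  rw [h.rank, this, Matrix.rank_zero, add_zero]

end Eliminated

/-! ### Combinations of basis elements -/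

section comb

variable {ι κ : Type} [Fintype ι] [Fintype κ]

lemma comb_add (b : ι → ℝ) (a a' : ι → ℚ) : comb b (a + a') = comb b a + comb b a' := by
  simp [comb, add_mul, Finset.sum_add_distrib]

lemma comb_smul (b : ι → ℝ) (c : ℚ) (a : ι → ℚ) : comb b (c • a) = c * comb b a := by
  simp [comb, Finset.mul_sum, mul_assoc]

lemma comb_sum (b : ι → ℝ) (a : κ → ι → ℚ) : comb b (∑ t, a t) = ∑ t, comb b (a t) := by
  simp only [comb, Finset.sum_apply, Rat.cast_sum, Finset.sum_mul]
  exact Finset.sum_comm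

lemma comb_eq_zero_iff {b : ι → ℝ} (hb : LinearIndependent ℚ b) (a : ι → ℚ) :
    comb b a = 0 ↔ a = 0 := by
  refine ⟨fun h => ?_, fun h => by simp [h, comb]⟩
  ext i
  exact Fintype.linearIndependent_iff.1 hb a (by simpa only [Rat.smul_def, comb] using h) i

lemma comb_prodBasis {m n : ℕ} (xb : Fin m → ℝ) (yb : Fin n → ℝ) {κ : Type} [Fintype κ]
    (g : κ → Fin n → ℚ) (w : κ → Fin m → ℚ) :
    comb (prodBasis xb yb) (fun kl => ∑ t, g t kl.1 * w t kl.2) =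
      ∑ t, comb yb (g t) * comb xb (w t) := by
  simp only [comb, prodBasis, Finset.sum_mul_sum, Rat.cast_sum]
  simp only [Finset.sum_mul]
  rw [Finset.sum_comm]
  refine Finset.sum_congr rfl fun t _ => ?_
  rw [Fintype.sum_prod_type]
  refine Finset.sum_congr rfl fun l _ => Finset.sum_congr rfl fun k _ => ?_
  push_cast
  ring

end comb

/-- Two sums of products of reals agree if they agree as tensors over the rationals. -/
lemma sum_mul_eq_zero_of_linearMap {ι : Type} [Fintype ι] (u v : ι → ℝ)
    (h : ∀ f g : ℝ →ₗ[ℚ] ℚ, ∑ i, f (u i) * g (v i) = 0) : ∑ i, u i * v i = 0 := by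
  classical
  -- Functionals `f` separate the points of `ℝ`, so the hypothesis holds before `f` is applied.
  have h1 : ∀ g : ℝ →ₗ[ℚ] ℚ, ∑ i, g (v i) • u i = 0 := by
    intro g
    rw [← Module.forall_dual_apply_eq_zero_iff ℚ]
    intro f
    rw [map_sum, ← h f g]
    exact Finset.sum_congr rfl fun i _ => by rw [map_smul, smul_eq_mul, mul_comm]
  -- Expanding the `v i` in a Hamel basis; finitely many basis elements `S` suffice, and each
  -- contributes a sum that vanishes by `h1`.
  let b := Module.Basis.ofVectorSpace ℚ ℝ
  let S := Finset.univ.biUnion fun i => (b.repr (v i)).support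
  have h2 : ∀ i, v i = ∑ β ∈ S, b.coord β (v i) • b β := by
    intro i
    conv_lhs => rw [← b.linearCombination_repr (v i), Finsupp.linearCombination_apply,
      Finsupp.sum_of_support_subset _ (Finset.subset_biUnion_of_mem
        (fun i => (b.repr (v i)).support) (Finset.mem_univ i)) _ (by simp)]
    rfl
  calc ∑ i, u i * v i = ∑ i, ∑ β ∈ S, (b.coord β (v i) • u i) * b β := by
        refine Finset.sum_congr rfl fun i _ => ?_
        conv_lhs => rw [h2 i, Finset.mul_sum]
        exact Finset.sum_congr rfl fun β _ => by
          rw [mul_smul_comm, smul_mul_assoc]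
    _ = ∑ β ∈ S, (∑ i, b.coord β (v i) • u i) * b β := by
        rw [Finset.sum_comm]
        exact Finset.sum_congr rfl fun β _ => (Finset.sum_mul _ _ _).symm
    _ = 0 := Finset.sum_eq_zero fun β _ => by rw [h1, zero_mul]

/-! ### The area, and dissections from positive factorizations -/

namespace PolygonInput

variable {m n : ℕ} {I : PolygonInput m n} {xb : Fin m → ℝ} {yb : Fin n → ℝ} {P : Set Plane}

/-- The area of the polygon is positive. -/
lemma Describes.area_pos (hI : I.Describes xb yb P) (b : Fin I.V) :
    0 < comb (prodBasis xb yb) fun kl => I.dehnMatrix b kl.1 kl.2 := by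
  obtain ⟨ι, hι, s, hs, ht⟩ := hI.polygon.tiled
  have := Fintype.ofFinite ι
  have hne : Nonempty ι := by
    obtain ⟨p, hp⟩ := ht
    by_contra hn
    rw [not_nonempty_iff] at hn
    have h1 := hp.1
    rw [Set.iUnion_of_empty] at h1
    exact hI.polygon.1.ne_empty h1.symm
  -- The area is not one of the valuations, whose functionals are rational-valued. It is obtained
  -- from the tensor difference between a tiling and the Dehn matrix, which all of them annihilate.
  have key := sum_mul_eq_zero_of_linearMap (ι := ι ⊕ (Fin n × Fin m))
    (Sum.elim (fun i => (s i).1) fun kl => -((I.dehnMatrix b kl.1 kl.2) • xb kl.2))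
    (Sum.elim (fun i => (s i).2) fun kl => yb kl.1) (by
      intro f g
      have h1 := hI.val_chi_eq_dehnMatrix b f g
      rw [ht.val_chi hs] at h1
      rw [Fintype.sum_sum_type]
      simp only [Sum.elim_inl, Sum.elim_inr, map_neg, map_smul, Fintype.sum_prod_type, neg_mul,
        Finset.sum_neg_distrib, smul_eq_mul]
      rw [h1, add_neg_eq_zero]
      exact Finset.sum_congr rfl fun k _ => Finset.sum_congr rfl fun l _ => by ring)
  rw [Fintype.sum_sum_type] at key
  simp only [Sum.elim_inl, Sum.elim_inr, neg_mul, Finset.sum_neg_distrib] at key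
  have h2 : comb (prodBasis xb yb) (fun kl => I.dehnMatrix b kl.1 kl.2) =
      ∑ i, (s i).1 * (s i).2 := by
    rw [eq_comm, ← sub_eq_zero, sub_eq_add_neg, ← key]
    congr 2
    exact Finset.sum_congr rfl fun kl _ => by rw [Rat.smul_def, prodBasis]; ring
  rw [h2]
  exact Finset.sum_pos (fun i _ => mul_pos (hs i).1 (hs i).2) Finset.univ_nonempty

/-- A factorization of the Dehn matrix into positive rows and columns gives a dissection. -/
lemma Describes.dissectsInto (hI : I.Describes xb yb P) (b : Fin I.V) {r : ℕ}
    {w : Fin r → Fin m → ℚ} {h : Fin r → Fin n → ℚ}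
    (hD : ∀ k l, I.dehnMatrix b k l = ∑ t, h t k * w t l)
    (hpos : ∀ t, 0 < comb xb (w t) ∧ 0 < comb yb (h t)) :
    DissectsInto P fun t => rectangle (comb xb (w t)) (comb yb (h t)) := by
  refine hI.polygon.tiled.dissectsInto hpos fun f g => ?_
  rw [hI.val_chi_eq_dehnMatrix b]
  simp only [hD, map_comb, Finset.sum_mul_sum]
  simp only [Finset.sum_mul]
  rw [Finset.sum_congr rfl fun l _ => Finset.sum_comm, Finset.sum_comm]
  refine Finset.sum_congr rfl fun t _ => ?_
  rw [Finset.sum_comm]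
  exact Finset.sum_congr rfl fun l _ => Finset.sum_congr rfl fun k _ => by ring

end PolygonInput

/-! ### Positive factorization -/

/-- From a factorization into columns `g t` and rows `w t`, one with positive values. -/
lemma positive_factorization {m n r : ℕ} {xb : Fin m → ℝ} {yb : Fin n → ℝ}
    {g : Fin r → Fin n → ℚ} {w : Fin r → Fin m → ℚ} {a b : ℚ} {l : ℚ} {u ω q : Fin r → ℚ}
    (hw : ∀ t, 0 < comb xb (w t)) (hu : ∀ t, |comb yb (g t)| < u t)
    (hω : ∀ t, comb xb (w t) < ω t) (hl : 0 < l)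
    (hlA : (l : ℝ) < ∑ t, comb yb (g t) * comb xb (w t))
    (ha : a = l / (2 * ∑ t, u t)) (hb : b = a / ∑ t, ω t)
    (hq : ∀ t, (1 - b) * comb xb (w t) < q t ∧ q t < comb xb (w t)) :
    (∀ t, 0 < comb yb (∑ i, q i • g i + a • g t)) ∧
    (∀ t, 0 < comb xb ((1 / a) • (w t - (q t / (a + ∑ i, q i)) • ∑ i, w i))) ∧
    ∀ k j, ∑ t, (∑ i, q i • g i + a • g t) k *
      ((1 / a) • (w t - (q t / (a + ∑ i, q i)) • ∑ i, w i)) j = ∑ t, g t k * w t j := by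
  have hlA0 : (0 : ℝ) < ∑ t, comb yb (g t) * comb xb (w t) := lt_trans (by exact_mod_cast hl) hlA
  have hne : (Finset.univ : Finset (Fin r)).Nonempty := by
    by_contra hn
    rw [Finset.not_nonempty_iff_eq_empty] at hn
    rw [hn, Finset.sum_empty] at hlA0
    exact lt_irrefl _ hlA0
  have hω0 : ∀ t, 0 < ω t := fun t => by exact_mod_cast (hw t).trans (hω t)
  have hu0 : ∀ t, 0 < u t := fun t => by exact_mod_cast (abs_nonneg _).trans_lt (hu t)
  set U := ∑ t, u t with hU
  set Ω := ∑ t, ω t with hΩ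
  have hU0 : 0 < U := Finset.sum_pos (fun t _ => hu0 t) hne
  have hΩ0 : 0 < Ω := Finset.sum_pos (fun t _ => hω0 t) hne
  have ha0 : 0 < a := by rw [ha]; positivity
  have hb0 : 0 < b := by rw [hb]; positivity
  have ha0' : (0 : ℝ) < a := by exact_mod_cast ha0
  have hb0' : (0 : ℝ) < b := by exact_mod_cast hb0
  -- The error budget: `a * U` is half the lower bound `l` of the area. One half pays for the terms
  -- `a • g t`, the other for replacing values by the approximations `q`.
  have haU : (a : ℝ) * U = l / 2 := by
    have : a * U = l / 2 := by rw [ha]; field_simp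
    exact_mod_cast this
  have hbΩ : (b : ℝ) * Ω = a := by
    have : b * Ω = a := by rw [hb]; field_simp
    exact_mod_cast this
  -- Each approximation error is below `b * ω t`, and `b` is chosen so that these bounds sum to `a`.
  have hd : ∑ t, (comb xb (w t) - q t) < a := by
    calc ∑ t, (comb xb (w t) - q t) < ∑ t, (b : ℝ) * ω t := by
          refine Finset.sum_lt_sum_of_nonempty hne fun t _ => ?_
          have := mul_lt_mul_of_pos_left (hω t) hb0'
          linarith [(hq t).1]
      _ = a := by rw [← Finset.mul_sum, ← hbΩ, hΩ]; push_cast; rfl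
  have hS : 0 < a + ∑ i, q i := by
    have h1 : 0 < ∑ t, comb xb (w t) := Finset.sum_pos (fun t _ => hw t) hne
    rw [Finset.sum_sub_distrib] at hd
    have : (0 : ℝ) < a + ∑ i, (q i : ℝ) := by linarith
    exact_mod_cast this
  refine ⟨fun t => ?_, fun t => ?_, fun k j => ?_⟩
  · rw [comb_add, comb_sum, comb_smul]
    simp only [comb_smul]
    have h1 : |comb yb (g t)| ≤ U := by
      refine (hu t).le.trans ?_
      exact_mod_cast Finset.single_le_sum (fun i _ => (hu0 i).le) (Finset.mem_univ t)
    -- The value of `∑ q i • g i` misses the area by less than `U * a = l / 2`.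
    have h2 : ∑ i, comb yb (g i) * (comb xb (w i) - q i) ≤ U * ∑ i, (comb xb (w i) - q i) := by
      rw [Finset.mul_sum]
      refine Finset.sum_le_sum fun i _ => mul_le_mul_of_nonneg_right ?_ (sub_nonneg.2 (hq i).2.le)
      refine (le_abs_self _).trans ((hu i).le.trans ?_)
      exact_mod_cast Finset.single_le_sum (fun i _ => (hu0 i).le) (Finset.mem_univ i)
    have h3 : (U : ℝ) * ∑ i, (comb xb (w i) - q i) < l / 2 := by
      rw [← haU, mul_comm (a : ℝ)]
      exact mul_lt_mul_of_pos_left hd (by exact_mod_cast hU0)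
    have h4 : -(l / 2 : ℝ) ≤ a * comb yb (g t) := by
      rw [← haU, ← mul_neg]
      exact mul_le_mul_of_nonneg_left (by linarith [neg_abs_le (comb yb (g t))]) ha0'.le
    have h5 : ∑ i, (q i : ℝ) * comb yb (g i) = ∑ i, comb yb (g i) * comb xb (w i) -
        ∑ i, comb yb (g i) * (comb xb (w i) - q i) := by
      rw [← Finset.sum_sub_distrib]
      exact Finset.sum_congr rfl fun i _ => by ring
    rw [h5]
    linarith
  · have h1 := cone_pos hw (fun t => (hq t).2) hd t
    have h2 : comb xb ((1 / a) • (w t - (q t / (a + ∑ i, q i)) • ∑ i, w i)) =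
        (1 / a) * (comb xb (w t) - (∑ i, comb xb (w i)) / (a + ∑ i, (q i : ℝ)) * q t) := by
      rw [comb_smul, sub_eq_add_neg, ← neg_smul, comb_add, comb_smul, comb_sum]
      push_cast
      ring
    rw [h2]
    positivity
  -- Let `w'` denote the new rows and `S` their sum. Then `w t = q t • S + a • w' t`, so collecting
  -- the coefficient of `w' t` in the sum of the products of `g t` and `w t` gives the new columns.
  · have h1 : ∀ t, (∑ i, q i • g i + a • g t) k *
        ((1 / a) • (w t - (q t / (a + ∑ i, q i)) • ∑ i, w i)) j =
        (1 / a) * (∑ i, q i * g i k) * w t j + g t k * w t j -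
        (1 / a) * (∑ i, q i * g i k) * (∑ i, w i j) / (a + ∑ i, q i) * q t -
        (∑ i, w i j) / (a + ∑ i, q i) * (q t * g t k) := by
      intro t
      simp only [Pi.add_apply, Pi.smul_apply, Pi.sub_apply, Finset.sum_apply, smul_eq_mul]
      field_simp
      ring
    simp only [h1, Finset.sum_sub_distrib, Finset.sum_add_distrib, ← Finset.mul_sum]
    field_simp
    ring

/-! ### Structured programs -/

/-- Programs whose loops count an index register up to the content of another register. -/
inductive Code (Q : Type) where
  | skip
  | inc (d : ℕ)
  | load (d a i : ℕ)
  | const (c : Cell) (q : ℚ)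
  | arith (o : ArithOp) (c c₁ c₂ : Cell)
  | prim (q : Q)
  | seq (p₁ p₂ : Code Q)
  | ifRat (c₁ c₂ : Cell) (p₁ p₂ : Code Q)
  | loop (i n : ℕ) (p : Code Q)

namespace Code

infixr:60 " ;; " => Code.seq

variable {Q : Type}

/-- The program given by structured code. -/
def compile : Code Q → Program Q
  | skip => .skip
  | inc d => .inc d
  | load d a i => .load d a i
  | const c q => .const c q
  | arith o c c₁ c₂ => .arith o c c₁ c₂
  | prim q => .prim q
  | seq p₁ p₂ => .seq p₁.compile p₂.compile
  | ifRat c₁ c₂ p₁ p₂ => .ifRat c₁ c₂ p₁.compile p₂.compile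
  | loop i n p => .seq (.setReg i 0) (.loop i n (.seq p.compile (.inc i)))

/-- The state transformation computed by structured code. -/
def run (f : Q → State → State) : Code Q → State → State
  | skip, s => s
  | inc d, s => s.setReg d (s.reg d + 1)
  | load d a i, s => s.setReg d (s.tab a (s.reg i))
  | const c q, s => s.put c q
  | arith o c c₁ c₂, s => s.put c (o.eval (s.get c₁) (s.get c₂))
  | prim q, s => f q s
  | seq p₁ p₂, s => p₂.run f (p₁.run f s)
  | ifRat c₁ c₂ p₁ p₂, s => if s.get c₁ < s.get c₂ then p₁.run f s else p₂.run f s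
  | loop i n p, s => (fun s => (p.run f s).setReg i ((p.run f s).reg i + 1))^[s.reg n] (s.setReg i 0)

/-- Whether structured code may write the index register `r`. -/
def writesReg (r : ℕ) : Code Q → Bool
  | inc d => d == r
  | load d _ _ => d == r
  | seq p₁ p₂ => p₁.writesReg r || p₂.writesReg r
  | ifRat _ _ p₁ p₂ => p₁.writesReg r || p₂.writesReg r
  | loop i _ p => i == r || p.writesReg r
  | _ => false

/-- Whether structured code may write the rational array `a`, if the primitive operation `q` writes
the array `tgt q`. -/
def writesMat (tgt : Q → ℕ) (a : ℕ) : Code Q → Bool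
  | const c _ => c.arr == a
  | arith _ c _ _ => c.arr == a
  | prim q => tgt q == a
  | seq p₁ p₂ => p₁.writesMat tgt a || p₂.writesMat tgt a
  | ifRat _ _ p₁ p₂ => p₁.writesMat tgt a || p₂.writesMat tgt a
  | loop _ _ p => p.writesMat tgt a
  | _ => false

/-- All loops run up to registers below `b`, which are not written, and do not write their
counters. -/
def WellFormed (b : ℕ) : Code Q → Bool
  | inc d => decide (b ≤ d)
  | load d _ _ => decide (b ≤ d)
  | seq p₁ p₂ => p₁.WellFormed b && p₂.WellFormed b
  | ifRat _ _ p₁ p₂ => p₁.WellFormed b && p₂.WellFormed b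
  | loop i n p => decide (b ≤ i) && decide (n < b) && !p.writesReg i && p.WellFormed b
  | _ => true

open Polynomial in
/-- A bound for the number of steps in terms of a bound for the numbers of loop passes. -/
def cost : Code Q → ℕ[X]
  | seq p₁ p₂ => p₁.cost + p₂.cost
  | ifRat _ _ p₁ p₂ => p₁.cost + p₂.cost + 1
  -- Each pass adds a test and an increment to the body; the final `2` pays for resetting the
  -- counter and for the last, failing test.
  | loop _ _ p => X * (p.cost + 2) + 2
  | _ => 1

/-- The parts of the state that are not written by the code `p` agree. -/
structure Frame (tgt : Q → ℕ) (p : Code Q) (s s' : State) : Prop where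
  reg : ∀ r, p.writesReg r = false → s'.reg r = s.reg r
  mat : ∀ a, p.writesMat tgt a = false → s'.mat a = s.mat a
  tab : s'.tab = s.tab

/-- The primitive operation `q` writes only the array `tgt q`. -/
def Targets (f : Q → State → State) (tgt : Q → ℕ) : Prop :=
  ∀ q s, (f q s).reg = s.reg ∧ (f q s).tab = s.tab ∧ ∀ a, tgt q ≠ a → (f q s).mat a = s.mat a

lemma put_mat_of_ne (s : State) (c : Cell) (q : ℚ) {a : ℕ} (h : c.arr ≠ a) :
    (s.put c q).mat a = s.mat a := by
  ext i j
  exact if_neg fun h' => h h'.1.symm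

variable {f : Q → State → State} {tgt : Q → ℕ}

lemma Frame.refl (p : Code Q) (s : State) : Frame tgt p s s :=
  ⟨fun _ _ => rfl, fun _ _ => rfl, rfl⟩

lemma Frame.trans {p : Code Q} {s s' s'' : State} (h : Frame tgt p s s') (h' : Frame tgt p s' s'') :
    Frame tgt p s s'' :=
  ⟨fun r hr => (h'.reg r hr).trans (h.reg r hr), fun a ha => (h'.mat a ha).trans (h.mat a ha),
    h'.tab.trans h.tab⟩

lemma Frame.mono {p q : Code Q} {s s' : State} (h : Frame tgt p s s')
    (hr : ∀ r, q.writesReg r = false → p.writesReg r = false)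
    (ha : ∀ a, q.writesMat tgt a = false → p.writesMat tgt a = false) : Frame tgt q s s' :=
  ⟨fun r h' => h.reg r (hr r h'), fun a h' => h.mat a (ha a h'), h.tab⟩

lemma Frame.setReg {p : Code Q} {s s' : State} (h : Frame tgt p s s') (i n k : ℕ) :
    Frame tgt (loop i n p) s (s'.setReg i k) := by
  refine ⟨fun r hr => ?_, fun a ha => h.mat a ha, h.tab⟩
  simp only [writesReg, Bool.or_eq_false_iff, beq_eq_false_iff_ne, ne_eq] at hr
  rw [State.setReg]
  simp only
  rw [if_neg (Ne.symm hr.1), h.reg r hr.2]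

/-- Reduces "this is unchanged" to a syntactic check on the code, which for concrete programs,
registers and arrays evaluates by `rfl`. -/
lemma frame (hf : Targets f tgt) (p : Code Q) : ∀ s, Frame tgt p s (p.run f s) := by
  induction p with
  | skip => exact fun s => Frame.refl _ s
  | inc d =>
    refine fun s => ⟨fun r hr => ?_, fun a _ => rfl, rfl⟩
    simp only [writesReg, beq_eq_false_iff_ne] at hr
    exact if_neg hr.symm
  | load d a i =>
    refine fun s => ⟨fun r hr => ?_, fun a _ => rfl, rfl⟩
    simp only [writesReg, beq_eq_false_iff_ne] at hr
    exact if_neg hr.symm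
  | const c q =>
    exact fun s => ⟨fun r _ => rfl, fun a ha => put_mat_of_ne s c q (by
      simpa only [writesMat, beq_eq_false_iff_ne] using ha), rfl⟩
  | arith o c c₁ c₂ =>
    exact fun s => ⟨fun r _ => rfl, fun a ha => put_mat_of_ne s c _ (by
      simpa only [writesMat, beq_eq_false_iff_ne] using ha), rfl⟩
  | prim q =>
    exact fun s => ⟨fun r _ => congrFun (hf q s).1 r, fun a ha => (hf q s).2.2 a (by
      simpa only [writesMat, beq_eq_false_iff_ne] using ha), (hf q s).2.1⟩
  | seq p₁ p₂ h₁ h₂ =>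
    intro s
    refine ((h₁ s).mono ?_ ?_).trans ((h₂ (p₁.run f s)).mono ?_ ?_) <;>
    · intro r hr
      simp only [writesReg, writesMat, Bool.or_eq_false_iff] at hr
      first | exact hr.1 | exact hr.2
  | ifRat c₁ c₂ p₁ p₂ h₁ h₂ =>
    intro s
    rw [run]
    split_ifs
    · refine (h₁ s).mono ?_ ?_ <;>
      · intro r hr
        simp only [writesReg, writesMat, Bool.or_eq_false_iff] at hr
        exact hr.1
    · refine (h₂ s).mono ?_ ?_ <;>
      · intro r hr
        simp only [writesReg, writesMat, Bool.or_eq_false_iff] at hr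
        exact hr.2
  | loop i n p h =>
    intro s
    rw [run]
    have key : ∀ k s', Frame tgt (loop i n p) s' ((fun s => (p.run f s).setReg i
        ((p.run f s).reg i + 1))^[k] s') := by
      intro k
      induction k with
      | zero => exact fun s' => Frame.refl _ s'
      | succ k ih =>
        intro s'
        rw [Function.iterate_succ_apply]
        exact ((h s').setReg i n _).trans (ih _)
    exact ((Frame.refl p s).setReg i n 0).trans (key _ _)

/-- Invariants of loops. -/
lemma run_loop (hf : Targets f tgt) {i n : ℕ} {p : Code Q} (hi : p.writesReg i = false) {s : State}
    (Inv : ℕ → State → Prop) (h0 : Inv 0 (s.setReg i 0))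
    (hstep : ∀ k < s.reg n, ∀ s', Frame tgt (loop i n p) s s' → s'.reg i = k → Inv k s' →
      Inv (k + 1) ((p.run f s').setReg i (k + 1))) :
    Inv (s.reg n) ((loop i n p).run f s) := by
  have key : ∀ k ≤ s.reg n, ∀ s', s' = (fun s => (p.run f s).setReg i
      ((p.run f s).reg i + 1))^[k] (s.setReg i 0) →
      Frame tgt (loop i n p) s s' ∧ s'.reg i = k ∧ Inv k s' := by
    intro k
    induction k with
    | zero =>
      rintro - s' rfl
      exact ⟨(Frame.refl p s).setReg i n 0, if_pos rfl, h0⟩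
    | succ k ih =>
      rintro hk s' rfl
      obtain ⟨h1, h2, h3⟩ := ih (Nat.le_of_succ_le hk) _ rfl
      rw [Function.iterate_succ_apply']
      set s' := (fun s => (p.run f s).setReg i ((p.run f s).reg i + 1))^[k] (s.setReg i 0)
      have h4 : (p.run f s').reg i = k := ((frame hf p s').reg i hi).trans h2
      simp only [h4]
      exact ⟨h1.trans ((frame hf p s').setReg i n _), if_pos rfl, hstep k hk s' h1 h2 h3⟩
  exact (key _ le_rfl _ rfl).2.2

lemma WellFormed.writesReg_eq_false {b r : ℕ} (hr : r < b) {p : Code Q}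
    (h : p.WellFormed b = true) : p.writesReg r = false := by
  induction p with
  | inc d => simp only [WellFormed, decide_eq_true_eq] at h; simp [writesReg]; omega
  | load d a i => simp only [WellFormed, decide_eq_true_eq] at h; simp [writesReg]; omega
  | seq p₁ p₂ h₁ h₂ =>
    simp only [WellFormed, Bool.and_eq_true] at h
    simp [writesReg, h₁ h.1, h₂ h.2]
  | ifRat c₁ c₂ p₁ p₂ h₁ h₂ =>
    simp only [WellFormed, Bool.and_eq_true] at h
    simp [writesReg, h₁ h.1, h₂ h.2]
  | loop i n p ih =>
    simp only [WellFormed, Bool.and_eq_true, decide_eq_true_eq] at h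
    simp only [writesReg, ih h.2, Bool.or_false, beq_eq_false_iff_ne]
    omega
  | _ => rfl

/-- The compiled program halts in polynomially many steps in the state computed by the code. -/
theorem exists_exec (hf : Targets f tgt) {b M : ℕ} (p : Code Q) (hp : p.WellFormed b = true) :
    ∀ s : State, (∀ r < b, s.reg r ≤ M) →
      ∃ t ≤ p.cost.eval M, Exec f p.compile s t (p.run f s) := by
  induction p with
  | skip => exact fun s _ => ⟨1, by simp [cost], .skip s⟩
  | inc d => exact fun s _ => ⟨1, by simp [cost], .inc s d⟩
  | load d a i => exact fun s _ => ⟨1, by simp [cost], .load s d a i⟩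
  | const c q => exact fun s _ => ⟨1, by simp [cost], .const s c q⟩
  | arith o c c₁ c₂ => exact fun s _ => ⟨1, by simp [cost], .arith s o c c₁ c₂⟩
  | prim q => exact fun s _ => ⟨1, by simp [cost], .prim s q⟩
  | seq p₁ p₂ h₁ h₂ =>
    intro s hs
    simp only [WellFormed, Bool.and_eq_true] at hp
    obtain ⟨t₁, ht₁, e₁⟩ := h₁ hp.1 s hs
    obtain ⟨t₂, ht₂, e₂⟩ := h₂ hp.2 (p₁.run f s) fun r hr => by
      rw [(frame hf p₁ s).reg r (WellFormed.writesReg_eq_false hr hp.1)]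
      exact hs r hr
    refine ⟨t₁ + t₂, ?_, .seq e₁ e₂⟩
    rw [cost, Polynomial.eval_add]
    exact Nat.add_le_add ht₁ ht₂
  | ifRat c₁ c₂ p₁ p₂ h₁ h₂ =>
    intro s hs
    simp only [WellFormed, Bool.and_eq_true] at hp
    rw [cost, Polynomial.eval_add, Polynomial.eval_add, Polynomial.eval_one, run]
    split_ifs with h
    · obtain ⟨t, ht, e⟩ := h₁ hp.1 s hs
      exact ⟨t + 1, by omega, .ifRat_true h e⟩
    · obtain ⟨t, ht, e⟩ := h₂ hp.2 s hs
      exact ⟨t + 1, by omega, .ifRat_false h e⟩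
  | loop i n p ih =>
    intro s hs
    have hp' := hp
    simp only [WellFormed, Bool.and_eq_true, decide_eq_true_eq, Bool.not_eq_true'] at hp
    obtain ⟨⟨⟨hi, hn⟩, hpi⟩, hwf⟩ := hp
    have hpn := WellFormed.writesReg_eq_false hn hwf
    -- Here `k` is the number of remaining passes; it is known in advance because the body changes
    -- neither the counter nor the bound.
    have key : ∀ k s', s'.reg i + k = s'.reg n → (∀ r < b, s'.reg r ≤ M) →
        ∃ t ≤ k * (p.cost.eval M + 2) + 1,
          Exec f (.loop i n (.seq p.compile (.inc i))) s' t
            ((fun s => (p.run f s).setReg i ((p.run f s).reg i + 1))^[k] s') := by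
      intro k
      induction k with
      | zero => exact fun s' h _ => ⟨1, by simp, by constructor; omega⟩
      | succ k ihk =>
        intro s' h hs'
        obtain ⟨t₁, ht₁, e₁⟩ := ih hwf s' hs'
        have hfr := frame hf p s'
        obtain ⟨t₂, ht₂, e₂⟩ := ihk ((p.run f s').setReg i ((p.run f s').reg i + 1))
          (by
            simp only [State.setReg, if_true, if_neg (show n ≠ i by omega)]
            rw [hfr.reg i hpi, hfr.reg n hpn]; omega)
          (fun r hr => by
            simp only [State.setReg, if_neg (show r ≠ i by omega)]
            rw [hfr.reg r (WellFormed.writesReg_eq_false hr hwf)]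
            exact hs' r hr)
        refine ⟨(t₁ + 1) + t₂ + 1, ?_, ?_⟩
        · rw [Nat.succ_mul]; omega
        · rw [Function.iterate_succ_apply]
          exact .loop_step (by omega) (.seq e₁ (.inc _ i)) e₂
    obtain ⟨t, ht, e⟩ := key (s.reg n) (s.setReg i 0)
      (by simp only [State.setReg, if_true, if_neg (show n ≠ i by omega)]; omega)
      (fun r hr => by
        simp only [State.setReg, if_neg (show r ≠ i by omega)]; exact hs r hr)
    refine ⟨1 + t, ?_, .seq (.setReg s i 0) e⟩
    have := Nat.mul_le_mul_right (p.cost.eval M + 2) (hs n hn)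
    simp only [cost, Polynomial.eval_add, Polynomial.eval_mul, Polynomial.eval_X,
      Polynomial.eval_ofNat]
    omega

/-! ### Row operations -/

/-- An arithmetic operation for all values of the counter `i` below register `n`. -/
def rowOp (o : ArithOp) (i n : ℕ) (c c₁ c₂ : Cell) : Code Q := loop i n (arith o c c₁ c₂)

end Code

/-- Fill the first `N` entries of row `ρ` of the array `a`, and set register `i` to `N`. -/
def State.fillRow (s : State) (i N a ρ : ℕ) (v : ℕ → ℚ) : State where
  reg := fun r => if r = i then N else s.reg r
  tab := s.tab
  mat := fun a' i' j => if a' = a ∧ i' = ρ ∧ j < N then v j else s.mat a' i' j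

/-- Read a cell for the value `k` of the counter `i`. -/
def State.getAt (s : State) (i k : ℕ) (c : Cell) : ℚ := (s.setReg i k).get c

namespace Code

variable {Q : Type} {f : Q → State → State} {tgt : Q → ℕ}

/-- A source may be the target cell itself or lie in another array. In either case no pass reads an
entry overwritten by an earlier pass, so all entries can be computed from the initial state. -/
lemma run_rowOp (o : ArithOp) {i n a ρ : ℕ} {c₁ c₂ : Cell} (s : State) (hρ : ρ ≠ i)
    (h1 : c₁.arr ≠ a ∨ c₁ = ⟨a, ρ, i⟩) (h2 : c₂.arr ≠ a ∨ c₂ = ⟨a, ρ, i⟩) :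
    (rowOp o i n ⟨a, ρ, i⟩ c₁ c₂ : Code Q).run f s =
      s.fillRow i (s.reg n) a (s.reg ρ) fun k => o.eval (s.getAt i k c₁) (s.getAt i k c₂) := by
  rw [rowOp, run]
  generalize s.reg n = N
  induction N with
  | zero =>
    simp [State.fillRow, State.setReg]
  | succ N ih =>
    rw [Function.iterate_succ_apply', ih]
    have hget : ∀ c : Cell, c.arr ≠ a ∨ c = ⟨a, ρ, i⟩ →
        (s.fillRow i N a (s.reg ρ) fun k => o.eval (s.getAt i k c₁) (s.getAt i k c₂)).get c =
          s.getAt i N c := by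
      rintro c (h | rfl)
      · simp [State.get, State.getAt, State.setReg, State.fillRow, h]
      · simp [State.get, State.getAt, State.setReg, State.fillRow]
    simp only [run, hget c₁ h1, hget c₂ h2]
    simp only [State.fillRow, State.put, State.setReg, State.mk.injEq, true_and, if_true, if_neg hρ]
    constructor
    · ext r; split_ifs <;> rfl
    · ext a' i' j
      by_cases h : a' = a ∧ i' = s.reg ρ
      · by_cases h3 : j = N
        · simp [h, h3]
        · have : j < N + 1 ↔ j < N := by omega
          simp [h, h3, this]
      · have : ∀ q : Prop, ¬ (a' = a ∧ i' = s.reg ρ ∧ q) := fun q hq => h ⟨hq.1, hq.2.1⟩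
        rw [if_neg (this _), if_neg (this _), if_neg (this _)]

end Code

/-! ### The rank of the Dehn matrix -/

namespace Code

variable {Q : Type} {f : Q → State → State} {tgt : Q → ℕ}

/-- Subtract the contribution of a vertex to one row of the Dehn matrix from the arrays 2 and 3. -/
def dehnRow : Code Q :=
  rowOp .sub 7 0 ⟨15, 9, 7⟩ ⟨0, 5, 7⟩ ⟨0, 4, 7⟩ ;;
    rowOp .mul 7 0 ⟨15, 9, 7⟩ ⟨1, 4, 6⟩ ⟨15, 9, 7⟩ ;;
    rowOp .sub 7 0 ⟨2, 6, 7⟩ ⟨2, 6, 7⟩ ⟨15, 9, 7⟩ ;;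
    -- Elimination destroys array 2; this second copy is kept for the lower bound of the area.
    rowOp .sub 7 0 ⟨3, 6, 7⟩ ⟨3, 6, 7⟩ ⟨15, 9, 7⟩

/-- Subtract the contribution of a vertex to the Dehn matrix from the arrays 2 and 3. -/
def dehnVertex : Code Q := load 5 0 4 ;; loop 6 1 dehnRow

/-- Compute the Dehn matrix in the arrays 2 and 3. -/
def dehnCode : Code Q := loop 4 2 dehnVertex

/-- Subtract a multiple of row `reg 3` of array 5 from row `reg 6` of array 2. -/
def subtractRow : Code Q :=
  rowOp .mul 7 0 ⟨15, 9, 7⟩ ⟨4, 3, 6⟩ ⟨5, 3, 7⟩ ;;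
    rowOp .sub 7 0 ⟨2, 6, 7⟩ ⟨2, 6, 7⟩ ⟨15, 9, 7⟩

/-- Eliminate with the pivot in row `reg 4` and column `reg 5`. -/
def pivotCode : Code Q :=
  -- Adding the cell of array 14, which is never written and holds zero, copies the pivot column.
  rowOp .add 6 1 ⟨4, 3, 6⟩ ⟨2, 6, 5⟩ ⟨14, 9, 9⟩ ;;
    rowOp .div 7 0 ⟨5, 3, 7⟩ ⟨2, 4, 7⟩ ⟨2, 4, 5⟩ ;;
    loop 6 1 subtractRow ;; inc 3

/-- Eliminate with a pivot if it is nonzero. -/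
def eliminateEntry : Code Q :=
  -- Only `<` can be tested, so a nonzero entry is recognised by two comparisons with the zero cell.
  ifRat ⟨2, 4, 5⟩ ⟨14, 9, 9⟩ pivotCode (ifRat ⟨14, 9, 9⟩ ⟨2, 4, 5⟩ pivotCode skip)

/-- Eliminate at each nonzero entry. -/
def eliminateCode : Code Q := loop 4 1 (loop 5 0 eliminateEntry)

/-- Compute the rank of the Dehn matrix in register 3. -/
def rankCode : Code Q := dehnCode ;; eliminateCode

lemma run_dehnRows (hf : Targets f tgt) (s : State) {i j : ℕ} (hi : i < s.reg 1)
    (hj : j < s.reg 0) {a : ℕ} (ha : a = 2 ∨ a = 3) :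
    ((loop 6 1 dehnRow).run f s).mat a i j = s.mat a i j -
      s.mat 1 (s.reg 4) i * (s.mat 0 (s.reg 5) j - s.mat 0 (s.reg 4) j) := by
  have := run_loop (s := s) (i := 6) (n := 1) (p := dehnRow) hf rfl
    -- Row `i` changes only in pass `i`, so the invariant for a fixed entry is a case distinction on
    -- whether that pass is over.
    (fun k s' => s'.mat a i j = s.mat a i j -
      if i < k then s.mat 1 (s.reg 4) i * (s.mat 0 (s.reg 5) j - s.mat 0 (s.reg 4) j) else 0)
    (by simp [State.setReg]) ?_
  · rwa [if_pos hi] at this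
  · intro k hk s' hF h6 ih
    have r0 : s'.reg 0 = s.reg 0 := hF.reg 0 rfl
    have r4 : s'.reg 4 = s.reg 4 := hF.reg 4 rfl
    have r5 : s'.reg 5 = s.reg 5 := hF.reg 5 rfl
    have m0 : s'.mat 0 = s.mat 0 := hF.mat 0 rfl
    have m1 : s'.mat 1 = s.mat 1 := hF.mat 1 rfl
    simp only [dehnRow, run]
    rw [run_rowOp _ _ (by simp) (by simp) (by simp), run_rowOp _ _ (by simp) (by simp) (by simp),
      run_rowOp _ _ (by simp) (by simp) (by simp), run_rowOp _ _ (by simp) (by simp) (by simp)]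
    rcases ha with rfl | rfl <;>
    · simp only [State.fillRow, State.setReg, State.getAt, State.get, ArithOp.eval, r0, r4, r5, m0,
        m1, hj, h6, and_true, if_true, true_and]
      by_cases h : i = k
      · subst h
        simp only [lt_irrefl, if_false, sub_zero] at ih
        simp [ih, hj]
      · have : i ≤ k ↔ i < k := by omega
        simp [h, this, ih]

lemma run_dehnCode (hf : Targets f tgt) (s : State) {i j : ℕ} (hi : i < s.reg 1)
    (hj : j < s.reg 0) {a : ℕ} (ha : a = 2 ∨ a = 3) :
    (dehnCode.run f s).mat a i j = s.mat a i j -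
      ∑ v ∈ Finset.range (s.reg 2), s.mat 1 v i * (s.mat 0 (s.tab 0 v) j - s.mat 0 v j) := by
  refine run_loop (s := s) (i := 4) (n := 2) (p := dehnVertex) hf rfl
    (fun k s' => s'.mat a i j = s.mat a i j -
      ∑ v ∈ Finset.range k, s.mat 1 v i * (s.mat 0 (s.tab 0 v) j - s.mat 0 v j))
    (by simp [State.setReg]) ?_
  intro k hk s' hF h4 ih
  have r0 : s'.reg 0 = s.reg 0 := hF.reg 0 rfl
  have r1 : s'.reg 1 = s.reg 1 := hF.reg 1 rfl
  have m0 : s'.mat 0 = s.mat 0 := hF.mat 0 rfl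
  have m1 : s'.mat 1 = s.mat 1 := hF.mat 1 rfl
  simp only [dehnVertex, run]
  have := run_dehnRows hf (s'.setReg 5 (s'.tab 0 (s'.reg 4))) (i := i) (j := j)
    (by simpa [State.setReg, r1] using hi) (by simpa [State.setReg, r0] using hj) ha
  change (((loop 6 1 dehnRow).run f (s'.setReg 5 (s'.tab 0 (s'.reg 4)))).mat a i j) = _
  rw [this, Finset.sum_range_succ]
  simp only [State.setReg, ih, h4, m0, m1, hF.tab]
  simp only [reduceIte, Nat.reduceEqDiff]
  ring

lemma run_subtractRows (hf : Targets f tgt) (s : State) {i j : ℕ} (hi : i < s.reg 1)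
    (hj : j < s.reg 0) : ((loop 6 1 subtractRow).run f s).mat 2 i j = s.mat 2 i j -
      s.mat 4 (s.reg 3) i * s.mat 5 (s.reg 3) j := by
  have := run_loop (s := s) (i := 6) (n := 1) (p := subtractRow) hf rfl
    (fun k s' => s'.mat 2 i j = s.mat 2 i j -
      if i < k then s.mat 4 (s.reg 3) i * s.mat 5 (s.reg 3) j else 0)
    (by simp [State.setReg]) ?_
  · rwa [if_pos hi] at this
  · intro k hk s' hF h6 ih
    have r0 : s'.reg 0 = s.reg 0 := hF.reg 0 rfl
    have r3 : s'.reg 3 = s.reg 3 := hF.reg 3 rfl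
    have m4 : s'.mat 4 = s.mat 4 := hF.mat 4 rfl
    have m5 : s'.mat 5 = s.mat 5 := hF.mat 5 rfl
    simp only [subtractRow, run]
    rw [run_rowOp _ _ (by simp) (by simp) (by simp), run_rowOp _ _ (by simp) (by simp) (by simp)]
    simp only [State.fillRow, State.setReg, State.getAt, State.get, ArithOp.eval, r0, r3, m4,
      m5, hj, h6, and_true, if_true, true_and]
    by_cases h : i = k
    · subst h
      simp only [lt_irrefl, if_false, sub_zero] at ih
      simp [ih, hj]
    · have : i ≤ k ↔ i < k := by omega
      simp [h, this, ih]

lemma run_pivotCode (hf : Targets f tgt) (s : State) (h14 : s.mat 14 (s.reg 9) (s.reg 9) = 0) :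
    (pivotCode.run f s).reg 3 = s.reg 3 + 1 ∧
    (∀ i j, (pivotCode.run f s).mat 4 i j =
      if i = s.reg 3 ∧ j < s.reg 1 then s.mat 2 j (s.reg 5) else s.mat 4 i j) ∧
    (∀ i j, (pivotCode.run f s).mat 5 i j = if i = s.reg 3 ∧ j < s.reg 0 then
      s.mat 2 (s.reg 4) j / s.mat 2 (s.reg 4) (s.reg 5) else s.mat 5 i j) ∧
    ∀ i < s.reg 1, ∀ j < s.reg 0, (pivotCode.run f s).mat 2 i j =
      s.mat 2 i j - s.mat 2 i (s.reg 5) *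
        (s.mat 2 (s.reg 4) j / s.mat 2 (s.reg 4) (s.reg 5)) := by
  simp only [pivotCode, run]
  rw [run_rowOp _ _ (by simp) (by simp) (by simp), run_rowOp _ _ (by simp) (by simp) (by simp)]
  set s' := State.fillRow (State.fillRow s 6 _ _ _ _) 7 _ _ _ _ with hs'
  have hF := frame hf (loop 6 1 subtractRow) s'
  have r3 := hF.reg 3 rfl
  have m4 := hF.mat 4 rfl
  have m5 := hF.mat 5 rfl
  have r0 : s'.reg 0 = s.reg 0 := by simp [hs', State.fillRow]
  have r1 : s'.reg 1 = s.reg 1 := by simp [hs', State.fillRow]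
  have r3' : s'.reg 3 = s.reg 3 := by simp [hs', State.fillRow]
  have m2 : s'.mat 2 = s.mat 2 := by ext i j; simp [hs', State.fillRow]
  have m4' : ∀ i j, s'.mat 4 i j =
      if i = s.reg 3 ∧ j < s.reg 1 then s.mat 2 j (s.reg 5) else s.mat 4 i j := by
    intro i j
    simp [hs', State.fillRow, State.getAt, State.setReg, State.get, ArithOp.eval, h14]
  have m5' : ∀ i j, s'.mat 5 i j = if i = s.reg 3 ∧ j < s.reg 0 then
      s.mat 2 (s.reg 4) j / s.mat 2 (s.reg 4) (s.reg 5) else s.mat 5 i j := by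
    intro i j
    simp [hs', State.fillRow, State.getAt, State.setReg, State.get, ArithOp.eval]
  refine ⟨?_, fun i j => ?_, fun i j => ?_, fun i hi j hj => ?_⟩
  · change ((loop 6 1 subtractRow).run f s').reg 3 + 1 = _
    rw [r3, r3']
  · change ((loop 6 1 subtractRow).run f s').mat 4 i j = _
    rw [m4, m4']
  · change ((loop 6 1 subtractRow).run f s').mat 5 i j = _
    rw [m5, m5']
  · change ((loop 6 1 subtractRow).run f s').mat 2 i j = _
    rw [run_subtractRows hf s' (by rwa [r1]) (by rwa [r0]), m2, r3', m4', m5',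
      if_pos ⟨rfl, hi⟩, if_pos ⟨rfl, hj⟩]

lemma run_eliminateEntry (s : State) (h14 : s.mat 14 (s.reg 9) (s.reg 9) = 0) :
    eliminateEntry.run f s =
      if s.mat 2 (s.reg 4) (s.reg 5) = 0 then s else pivotCode.run f s := by
  simp only [eliminateEntry, run, State.get, h14]
  split_ifs with h1 h2 h3 h4
  · linarith
  · rfl
  · linarith
  · rfl
  · rfl
  · exact absurd (le_antisymm (not_lt.1 h3) (not_lt.1 h1)) (by assumption)

/-- A pivot in row `k` clears that whole row, and rows above, being zero already, stay zero. One
sweep over the entries therefore ends with the zero matrix, and the number of pivots is the rank. -/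
lemma run_eliminateCode (hf : Targets f tgt) (s : State) (h14 : s.mat 14 (s.reg 9) (s.reg 9) = 0)
    (h3 : s.reg 3 = 0) :
    Eliminated (s.reg 1) (s.reg 0) (s.mat 2) ((eliminateCode.run f s).mat 2)
        ((eliminateCode.run f s).mat 4) ((eliminateCode.run f s).mat 5)
        ((eliminateCode.run f s).reg 3) ∧
      ∀ i < s.reg 1, ∀ j < s.reg 0, (eliminateCode.run f s).mat 2 i j = 0 := by
  refine run_loop (s := s) (i := 4) (n := 1) (p := loop 5 0 eliminateEntry) hf rfl
    (fun k s' => Eliminated (s.reg 1) (s.reg 0) (s.mat 2) (s'.mat 2) (s'.mat 4) (s'.mat 5)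
      (s'.reg 3) ∧ ∀ i < k, ∀ j < s.reg 0, s'.mat 2 i j = 0)
    ⟨by simpa [State.setReg, h3] using Eliminated.init _ _ _, by simp⟩ ?_
  rintro k hk s' hF h4 ⟨ih, ih0⟩
  have r0 : s'.reg 0 = s.reg 0 := hF.reg 0 rfl
  have r1 : s'.reg 1 = s.reg 1 := hF.reg 1 rfl
  have r9 : s'.reg 9 = s.reg 9 := hF.reg 9 rfl
  have m14 : s'.mat 14 = s.mat 14 := hF.mat 14 rfl
  have := run_loop (s := s') (i := 5) (n := 0) (p := eliminateEntry) hf rfl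
    (fun l s'' => Eliminated (s.reg 1) (s.reg 0) (s.mat 2) (s''.mat 2) (s''.mat 4) (s''.mat 5)
      (s''.reg 3) ∧ (∀ i < k, ∀ j < s.reg 0, s''.mat 2 i j = 0) ∧ ∀ j < l, s''.mat 2 k j = 0)
    ⟨by simpa [State.setReg] using ih, by simpa [State.setReg] using ih0, by simp⟩ ?_
  · refine ⟨by simpa [State.setReg] using this.1, fun i hi j hj => ?_⟩
    rcases Nat.lt_succ_iff_lt_or_eq.1 hi with hi | rfl
    · exact this.2.1 i hi j hj
    · exact this.2.2 j (by rwa [r0])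
  · rintro l hl s'' hF' h5 ⟨ih, ih0, ih1⟩
    have q0 : s''.reg 0 = s.reg 0 := (hF'.reg 0 rfl).trans r0
    have q1 : s''.reg 1 = s.reg 1 := (hF'.reg 1 rfl).trans r1
    have q4 : s''.reg 4 = k := (hF'.reg 4 rfl).trans h4
    have q14 : s''.mat 14 (s''.reg 9) (s''.reg 9) = 0 := by
      rw [hF'.mat 14 rfl, hF'.reg 9 rfl, m14, r9, h14]
    rw [r0] at hl
    rw [run_eliminateEntry s'' q14, q4, h5]
    split_ifs with h
    · refine ⟨by simpa [State.setReg] using ih, ih0, fun j hj => ?_⟩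
      rcases Nat.lt_succ_iff_lt_or_eq.1 hj with hj | rfl
      · exact ih1 j hj
      · exact h
    · obtain ⟨p3, p4, p5, p2⟩ := run_pivotCode hf s'' q14
      rw [q4, h5, q0, q1] at *
      refine ⟨?_, fun i hi j hj => ?_, fun j hj => ?_⟩
      · simp only [State.setReg, Nat.reduceEqDiff, reduceIte, p3]
        refine ih.pivot hk hl h (fun t ht i hi => ?_) (fun i hi => ?_) (fun t ht i hi => ?_)
          (fun i hi => ?_) p2
        · rw [p4, if_neg (by omega)]
        · rw [p4, if_pos ⟨rfl, hi⟩]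
        · rw [p5, if_neg (by omega)]
        · rw [p5, if_pos ⟨rfl, hi⟩]
      · change (pivotCode.run f s'').mat 2 i j = 0
        rw [p2 i (hi.trans hk) j hj, ih0 i hi j hj, ih0 i hi l hl]
        ring
      · change (pivotCode.run f s'').mat 2 k j = 0
        rw [p2 k hk j (by omega), mul_div_cancel₀ _ h, sub_self]

/-- The factorization of the Dehn matrix that is computed. -/
lemma run_rankCode (hf : Targets f tgt) {m n : ℕ} (I : PolygonInput m n) (b : Fin I.V) {s : State}
    (hs : s = rankCode.run f I.encode) :
    s.reg 3 = (I.dehnMatrix b).rank ∧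
    (∀ (k : Fin n) (l : Fin m), s.mat 3 k l = I.dehnMatrix b k l) ∧
    (∀ (k : Fin n) (l : Fin m), I.dehnMatrix b k l =
      ∑ t ∈ Finset.range (s.reg 3), s.mat 4 t k * s.mat 5 t l) ∧
    (∀ t < s.reg 3, (s.row n 4 t ≠ 0) ∧ s.row m 5 t ≠ 0) := by
  set s₁ := dehnCode.run f I.encode with hs₁
  have hF := frame hf dehnCode I.encode
  have r0 : s₁.reg 0 = m := hF.reg 0 rfl
  have r1 : s₁.reg 1 = n := hF.reg 1 rfl
  have r3 : s₁.reg 3 = 0 := hF.reg 3 rfl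
  have m14 : s₁.mat 14 (s₁.reg 9) (s₁.reg 9) = 0 := by
    rw [hF.mat 14 rfl]; simp [PolygonInput.encode]
  have hD : ∀ a, a = 2 ∨ a = 3 → ∀ (k : Fin n) (l : Fin m), s₁.mat a k l = I.dehnMatrix b k l := by
    intro a ha k l
    rw [hs₁, run_dehnCode hf I.encode (i := k) (j := l) k.2 l.2 ha,
      PolygonInput.dehnMatrix_eq, Finset.sum_range]
    have h0 : I.encode.mat a k l = 0 := by
      rcases ha with rfl | rfl <;> simp [PolygonInput.encode]
    rw [h0, zero_sub, neg_inj]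
    change ∑ i : Fin I.V, _ = _
    refine Finset.sum_congr rfl fun v _ => ?_
    simp [PolygonInput.encode]
  obtain ⟨hE, hE0⟩ := run_eliminateCode hf s₁ m14 r3
  have hs' : s = eliminateCode.run f s₁ := hs
  rw [← hs', r0, r1] at hE
  rw [← hs', r0, r1] at hE0
  have hM : toMatrix n m (s₁.mat 2) = I.dehnMatrix b := by
    ext k l; exact hD 2 (Or.inl rfl) k l
  refine ⟨?_, fun k l => ?_, fun k l => ?_, fun t ht => ⟨fun h0 => ?_, fun h0 => ?_⟩⟩
  · rw [← hM, hE.rank_eq hE0]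
  · rw [hs', (frame hf eliminateCode s₁).mat 3 rfl, hD 3 (Or.inr rfl)]
  · rw [← hD 2 (Or.inl rfl), hE.sum k k.2 l l.2, hE0 k k.2 l l.2, zero_add]
  · obtain ⟨i, hi, hne⟩ := hE.ne_col t ht
    exact hne (congrFun h0 ⟨i, hi⟩)
  · obtain ⟨i, hi, hne⟩ := hE.ne_row t ht
    exact hne (congrFun h0 ⟨i, hi⟩)

end Code

/-! ### Computing the rectangles -/

lemma ratSign_mul_self {x : ℝ} : ratSign x * x = |x| := by
  rw [ratSign]
  split_ifs with h1 h2
  · rw [abs_of_neg h1]; push_cast; ring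
  · simp [h2]
  · rw [abs_of_nonneg (not_lt.1 h1)]; push_cast; ring

lemma ratSign_sq {x : ℝ} (hx : x ≠ 0) : ratSign x * ratSign x = 1 := by
  rw [ratSign]
  split_ifs <;> norm_num

/-- The array written by a primitive operation. -/
def BasisOp.target : BasisOp → ℕ
  | .signX c _ _ => c.arr
  | .signY c _ _ => c.arr
  | .signXY c _ => c.arr
  | .betweenX c _ _ _ _ => c.arr
  | .betweenY c _ _ _ _ => c.arr
  | .betweenXY c _ _ => c.arr

namespace Code

lemma targets_act {m n : ℕ} (xb : Fin m → ℝ) (yb : Fin n → ℝ) (B : Between xb yb) :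
    Targets (BasisOp.act xb yb B) BasisOp.target := by
  intro q s
  cases q <;> exact ⟨rfl, rfl, fun a ha => put_mat_of_ne _ _ _ ha⟩

/-- Make the value of row `reg 4` of array 5 positive, and add an upper bound of it to a sum. -/
def normalizeX : Code BasisOp :=
  prim (.signX ⟨10, 9, 9⟩ 5 4) ;;
    rowOp .mul 5 0 ⟨5, 4, 5⟩ ⟨10, 9, 9⟩ ⟨5, 4, 5⟩ ;;
    rowOp .mul 6 1 ⟨4, 4, 6⟩ ⟨10, 9, 9⟩ ⟨4, 4, 6⟩ ;;
    -- Twice the row: a rational between a positive value and its double is a rational upper bound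
    -- for the value.
    rowOp .add 5 0 ⟨15, 9, 5⟩ ⟨5, 4, 5⟩ ⟨5, 4, 5⟩ ;;
    prim (.betweenX ⟨18, 9, 4⟩ 5 4 15 9) ;;
    arith .add ⟨12, 9, 9⟩ ⟨12, 9, 9⟩ ⟨18, 9, 4⟩

/-- Add an upper bound of the absolute value of row `reg 4` of array 4 to a sum. -/
def boundY : Code BasisOp :=
  prim (.signY ⟨10, 9, 9⟩ 4 4) ;;
    rowOp .mul 6 1 ⟨16, 9, 6⟩ ⟨10, 9, 9⟩ ⟨4, 4, 6⟩ ;;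
    rowOp .add 6 1 ⟨17, 9, 6⟩ ⟨16, 9, 6⟩ ⟨16, 9, 6⟩ ;;
    prim (.betweenY ⟨19, 9, 4⟩ 16 9 17 9) ;;
    arith .add ⟨13, 9, 9⟩ ⟨13, 9, 9⟩ ⟨19, 9, 4⟩

/-- Normalize all rows. -/
def normalizeCode : Code BasisOp := loop 4 3 (normalizeX ;; boundY)

/-- Compute the tolerances from the upper bounds and a lower bound of the area. -/
def toleranceCode : Code BasisOp :=
  -- Array 21 is zero and array 3 holds the Dehn matrix, so this is a positive rational `l` below
  -- the area.
  prim (.betweenXY ⟨20, 9, 9⟩ 21 3) ;;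
    -- The cells of arrays 22, 23 and 25 become `a = l / (2 * ∑ u t)`, `b = a / ∑ ω t` and `1 - b`
    -- of `positive_factorization`.
    arith .add ⟨13, 9, 9⟩ ⟨13, 9, 9⟩ ⟨13, 9, 9⟩ ;;
    arith .div ⟨22, 9, 9⟩ ⟨20, 9, 9⟩ ⟨13, 9, 9⟩ ;;
    arith .div ⟨23, 9, 9⟩ ⟨22, 9, 9⟩ ⟨12, 9, 9⟩ ;;
    const ⟨24, 9, 9⟩ 1 ;;
    arith .sub ⟨25, 9, 9⟩ ⟨24, 9, 9⟩ ⟨23, 9, 9⟩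

/-- Approximate the value of row `reg 4` of array 5 from below and accumulate sums. -/
def approximateRow : Code BasisOp :=
  -- The row scaled by `1 - b`; a rational between its value and that of the row itself is the
  -- approximation `q t`.
  rowOp .mul 5 0 ⟨15, 9, 5⟩ ⟨25, 9, 9⟩ ⟨5, 4, 5⟩ ;;
    prim (.betweenX ⟨26, 9, 4⟩ 15 9 5 4) ;;
    arith .add ⟨27, 9, 9⟩ ⟨27, 9, 9⟩ ⟨26, 9, 4⟩ ;;
    rowOp .add 5 0 ⟨28, 9, 5⟩ ⟨28, 9, 5⟩ ⟨5, 4, 5⟩ ;;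
    rowOp .mul 6 1 ⟨16, 9, 6⟩ ⟨26, 9, 4⟩ ⟨4, 4, 6⟩ ;;
    rowOp .add 6 1 ⟨29, 9, 6⟩ ⟨29, 9, 6⟩ ⟨16, 9, 6⟩

/-- Approximate the values of all rows. -/
def approximateCode : Code BasisOp := loop 4 3 approximateRow

/-- Compute the width and the height of one rectangle. -/
def outputRow : Code BasisOp :=
  arith .div ⟨10, 9, 9⟩ ⟨26, 9, 4⟩ ⟨27, 9, 9⟩ ;;
    rowOp .mul 5 0 ⟨15, 9, 5⟩ ⟨10, 9, 9⟩ ⟨28, 9, 5⟩ ;;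
    rowOp .sub 5 0 ⟨15, 9, 5⟩ ⟨5, 4, 5⟩ ⟨15, 9, 5⟩ ;;
    rowOp .div 5 0 ⟨0, 4, 5⟩ ⟨15, 9, 5⟩ ⟨22, 9, 9⟩ ;;
    rowOp .mul 6 1 ⟨16, 9, 6⟩ ⟨22, 9, 9⟩ ⟨4, 4, 6⟩ ;;
    rowOp .add 6 1 ⟨1, 4, 6⟩ ⟨29, 9, 6⟩ ⟨16, 9, 6⟩

/-- Compute the widths and heights of the rectangles. -/
def outputCode : Code BasisOp := arith .add ⟨27, 9, 9⟩ ⟨22, 9, 9⟩ ⟨27, 9, 9⟩ ;; loop 4 3 outputRow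

/-- Compute the rectangles from a factorization of the Dehn matrix. -/
def rectangleCode : Code BasisOp :=
  normalizeCode ;; toleranceCode ;; approximateCode ;; outputCode

variable {m n : ℕ} {xb : Fin m → ℝ} {yb : Fin n → ℝ} {B : Between xb yb}

lemma run_normalizeX {s s' : State} (hs' : s' = normalizeX.run (BasisOp.act xb yb B) s)
    (r0 : s.reg 0 = m) (r1 : s.reg 1 = n) (r9 : s.reg 9 = 0) {t : ℕ} (r4 : s.reg 4 = t)
    (hw : comb xb (s.row m 5 t) ≠ 0) :
    (∀ i j, s'.mat 5 i j = if i = t ∧ j < m then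
      ratSign (comb xb (s.row m 5 t)) * s.mat 5 t j else s.mat 5 i j) ∧
    (∀ i j, s'.mat 4 i j = if i = t ∧ j < n then
      ratSign (comb xb (s.row m 5 t)) * s.mat 4 t j else s.mat 4 i j) ∧
    (∀ j ≠ t, s'.mat 18 0 j = s.mat 18 0 j) ∧
    0 < comb xb (s'.row m 5 t) ∧ comb xb (s'.row m 5 t) < s'.mat 18 0 t ∧
    s'.mat 12 0 0 = s.mat 12 0 0 + s'.mat 18 0 t := by
  simp only [normalizeX, run, BasisOp.act] at hs'
  rw [run_rowOp _ _ (by simp) (by simp) (by simp), run_rowOp _ _ (by simp) (by simp) (by simp),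
    run_rowOp _ _ (by simp) (by simp) (by simp)] at hs'
  rw [r4] at hs'
  set σ := ratSign (comb xb (s.row m 5 t)) with hσ
  generalize hs₁ : State.fillRow (State.fillRow (State.fillRow _ 5 _ _ _ _) 6 _ _ _ _) 5 _ _ _ _
    = s₁ at hs'
  have q4 : s₁.reg 4 = t := by simp [← hs₁, State.fillRow, State.put, r4]
  have q9 : s₁.reg 9 = 0 := by simp [← hs₁, State.fillRow, State.put, r9]
  have m5 : ∀ i j, s₁.mat 5 i j = if i = t ∧ j < m then σ * s.mat 5 t j else s.mat 5 i j := by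
    intro i j
    simp [← hs₁, State.fillRow, State.put, State.getAt, State.setReg, State.get, ArithOp.eval, r0,
      r4, r9]
  have m4 : ∀ i j, s₁.mat 4 i j = if i = t ∧ j < n then σ * s.mat 4 t j else s.mat 4 i j := by
    intro i j
    simp [← hs₁, State.fillRow, State.put, State.getAt, State.setReg, State.get, ArithOp.eval, r1,
      r4, r9]
  have m18 : s₁.mat 18 = s.mat 18 := by
    ext i j; simp [← hs₁, State.fillRow, State.put]
  have m12 : s₁.mat 12 = s.mat 12 := by
    ext i j; simp [← hs₁, State.fillRow, State.put]
  have w5 : s₁.row m 5 t = σ • s.row m 5 t := by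
    ext j; simp [State.row, m5]
  have w15 : s₁.row m 15 0 = (2 * σ) • s.row m 5 t := by
    ext j
    simp [← hs₁, State.row, State.fillRow, State.put, State.getAt, State.setReg, State.get,
      ArithOp.eval, r0, r4, r9, two_mul, add_mul]
  have hpos : 0 < comb xb (s₁.row m 5 t) := by
    rw [w5, comb_smul, ratSign_mul_self]
    exact abs_pos.2 hw
  have hB := B.onX_spec (s₁.row m 5 t) (s₁.row m 15 0) (by
    rw [w15, mul_smul, ← w5, comb_smul]; push_cast; linarith)
  rw [q4, q9] at hs'
  generalize B.onX (s₁.row m 5 t) (s₁.row m 15 0) = β at hs' hB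
  have w5' : s'.row m 5 t = s₁.row m 5 t := by
    ext j; simp [hs', State.row, State.put]
  rw [w5']
  refine ⟨fun i j => ?_, fun i j => ?_, fun j hj => ?_, hpos, ?_, ?_⟩
  · rw [← m5]; simp [hs', State.put]
  · rw [← m4]; simp [hs', State.put]
  · simp [hs', State.put, q4, q9, hj, m18]
  · simpa [hs', State.put, q4, q9] using hB.1
  · simp [hs', State.put, State.get, ArithOp.eval, q4, q9, m12]

lemma run_boundY {s s' : State} (hs' : s' = boundY.run (BasisOp.act xb yb B) s)
    (r1 : s.reg 1 = n) (r9 : s.reg 9 = 0) {t : ℕ} (r4 : s.reg 4 = t)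
    (hg : comb yb (s.row n 4 t) ≠ 0) :
    (∀ j ≠ t, s'.mat 19 0 j = s.mat 19 0 j) ∧
    |comb yb (s.row n 4 t)| < s'.mat 19 0 t ∧
    s'.mat 13 0 0 = s.mat 13 0 0 + s'.mat 19 0 t := by
  simp only [boundY, run, BasisOp.act] at hs'
  rw [run_rowOp _ _ (by simp) (by simp) (by simp), run_rowOp _ _ (by simp) (by simp) (by simp)]
    at hs'
  rw [r4] at hs'
  set σ := ratSign (comb yb (s.row n 4 t)) with hσ
  generalize hs₁ : State.fillRow (State.fillRow _ 6 _ _ _ _) 6 _ _ _ _ = s₁ at hs'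
  have q4 : s₁.reg 4 = t := by simp [← hs₁, State.fillRow, State.put, r4]
  have q9 : s₁.reg 9 = 0 := by simp [← hs₁, State.fillRow, State.put, r9]
  have m19 : s₁.mat 19 = s.mat 19 := by
    ext i j; simp [← hs₁, State.fillRow, State.put]
  have m13 : s₁.mat 13 = s.mat 13 := by
    ext i j; simp [← hs₁, State.fillRow, State.put]
  have w16 : s₁.row n 16 0 = σ • s.row n 4 t := by
    ext j
    simp [← hs₁, State.row, State.fillRow, State.put, State.getAt, State.setReg, State.get,
      ArithOp.eval, r1, r4, r9]
  have w17 : s₁.row n 17 0 = (2 * σ) • s.row n 4 t := by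
    ext j
    simp [← hs₁, State.row, State.fillRow, State.put, State.getAt, State.setReg, State.get,
      ArithOp.eval, r1, r4, r9, two_mul, add_mul]
  have hpos : comb yb (s₁.row n 16 0) = |comb yb (s.row n 4 t)| := by
    rw [w16, comb_smul, ratSign_mul_self]
  have hB := B.onY_spec (s₁.row n 16 0) (s₁.row n 17 0) (by
    rw [w17, mul_smul, ← w16, comb_smul, hpos]; push_cast; linarith [abs_pos.2 hg])
  rw [q9] at hs'
  rw [hpos] at hB
  generalize B.onY (s₁.row n 16 0) (s₁.row n 17 0) = β at hs' hB
  refine ⟨fun j hj => ?_, ?_, ?_⟩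
  · simp [hs', State.put, q4, q9, hj, m19]
  · simpa [hs', State.put, q4, q9] using hB.1
  · simp [hs', State.put, State.get, ArithOp.eval, q4, q9, m13]

/-- Row `t` and column `t` are both multiplied by the sign of the row's value. The sign squares to
`1`, so the products and the factorization are preserved. -/
lemma run_normalizeCode {s s' : State} (hs' : s' = normalizeCode.run (BasisOp.act xb yb B) s)
    (r0 : s.reg 0 = m) (r1 : s.reg 1 = n) (r9 : s.reg 9 = 0)
    (h12 : s.mat 12 0 0 = 0) (h13 : s.mat 13 0 0 = 0)
    (hw : ∀ t < s.reg 3, comb xb (s.row m 5 t) ≠ 0)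
    (hg : ∀ t < s.reg 3, comb yb (s.row n 4 t) ≠ 0) :
    (∀ t < s.reg 3, (∀ i < n, ∀ j < m, s'.mat 4 t i * s'.mat 5 t j = s.mat 4 t i * s.mat 5 t j) ∧
      0 < comb xb (s'.row m 5 t) ∧ comb xb (s'.row m 5 t) < s'.mat 18 0 t ∧
      |comb yb (s'.row n 4 t)| < s'.mat 19 0 t) ∧
    s'.mat 12 0 0 = ∑ t ∈ Finset.range (s.reg 3), s'.mat 18 0 t ∧
    s'.mat 13 0 0 = ∑ t ∈ Finset.range (s.reg 3), s'.mat 19 0 t := by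
  have key := run_loop (s := s) (i := 4) (n := 3) (p := normalizeX ;; boundY) (targets_act xb yb B)
    rfl (fun k s' =>
      (∀ t < k, (∀ i < n, ∀ j < m, s'.mat 4 t i * s'.mat 5 t j = s.mat 4 t i * s.mat 5 t j) ∧
        0 < comb xb (s'.row m 5 t) ∧ comb xb (s'.row m 5 t) < s'.mat 18 0 t ∧
        |comb yb (s'.row n 4 t)| < s'.mat 19 0 t) ∧
      (∀ t ≥ k, s'.mat 4 t = s.mat 4 t ∧ s'.mat 5 t = s.mat 5 t) ∧
      s'.mat 12 0 0 = ∑ t ∈ Finset.range k, s'.mat 18 0 t ∧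
      s'.mat 13 0 0 = ∑ t ∈ Finset.range k, s'.mat 19 0 t) ?_ ?_
  · rw [hs']
    exact ⟨key.1, key.2.2.1, key.2.2.2⟩
  · exact ⟨by simp, fun t _ => ⟨rfl, rfl⟩, by simpa [State.setReg] using h12,
      by simpa [State.setReg] using h13⟩
  · rintro k hk s₀ hF h4 ⟨i1, i2, i3, i4⟩
    have q0 : s₀.reg 0 = m := (hF.reg 0 rfl).trans r0
    have q1 : s₀.reg 1 = n := (hF.reg 1 rfl).trans r1
    have q9 : s₀.reg 9 = 0 := (hF.reg 9 rfl).trans r9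
    have w5 : s₀.row m 5 k = s.row m 5 k := by ext j; simp [State.row, (i2 k le_rfl).2]
    have w4 : s₀.row n 4 k = s.row n 4 k := by ext j; simp [State.row, (i2 k le_rfl).1]
    have hw' : comb xb (s₀.row m 5 k) ≠ 0 := by rw [w5]; exact hw k hk
    rw [run]
    generalize hs₁ : normalizeX.run (BasisOp.act xb yb B) s₀ = s₁
    obtain ⟨a1, a2, a3, a4, a5, a6⟩ := run_normalizeX hs₁.symm q0 q1 q9 h4 hw'
    have hF₁ := frame (targets_act xb yb B) normalizeX s₀
    rw [hs₁] at hF₁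
    generalize hs₂ : boundY.run (BasisOp.act xb yb B) s₁ = s₂
    have hF₂ := frame (targets_act xb yb B) boundY s₁
    rw [hs₂] at hF₂
    set σ := ratSign (comb xb (s₀.row m 5 k)) with hσ
    have hσ2 : σ * σ = 1 := ratSign_sq hw'
    have v4 : s₁.row n 4 k = σ • s.row n 4 k := by
      rw [← w4]; ext j; simp [State.row, a2]
    have hg' : comb yb (s₁.row n 4 k) ≠ 0 := by
      rw [v4, comb_smul]
      refine mul_ne_zero (fun h => ?_) (hg k hk)
      rw [Rat.cast_eq_zero.1 h] at hσ2
      norm_num at hσ2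
    obtain ⟨b1, b2, b3⟩ := run_boundY hs₂.symm ((hF₁.reg 1 rfl).trans q1)
      ((hF₁.reg 9 rfl).trans q9) ((hF₁.reg 4 rfl).trans h4) hg'
    have m4 : s₂.mat 4 = s₁.mat 4 := hF₂.mat 4 rfl
    have m5 : s₂.mat 5 = s₁.mat 5 := hF₂.mat 5 rfl
    have m12 : s₂.mat 12 = s₁.mat 12 := hF₂.mat 12 rfl
    have m18 : s₂.mat 18 = s₁.mat 18 := hF₂.mat 18 rfl
    have m13 : s₁.mat 13 = s₀.mat 13 := hF₁.mat 13 rfl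
    have m19 : s₁.mat 19 = s₀.mat 19 := hF₁.mat 19 rfl
    have v5 : ∀ t, (s₂.setReg 4 (k + 1)).row m 5 t = s₁.row m 5 t := fun t => by
      ext j; simp [State.row, State.setReg, m5]
    have v4' : ∀ t, (s₂.setReg 4 (k + 1)).row n 4 t = s₁.row n 4 t := fun t => by
      ext j; simp [State.row, State.setReg, m4]
    refine ⟨fun t ht => ?_, fun t ht => ?_, ?_, ?_⟩
    · rw [v5, v4']
      simp only [State.setReg, m4, m5, m18]
      rcases Nat.lt_succ_iff_lt_or_eq.1 ht with ht | rfl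
      · have u5 : s₁.row m 5 t = s₀.row m 5 t := by ext j; simp [State.row, a1, ht.ne]
        have u4 : s₁.row n 4 t = s₀.row n 4 t := by ext j; simp [State.row, a2, ht.ne]
        obtain ⟨c1, c2, c3, c4⟩ := i1 t ht
        rw [u5, u4, a3 t ht.ne, b1 t ht.ne, m19]
        refine ⟨fun i hi j hj => ?_, c2, c3, c4⟩
        rw [← c1 i hi j hj, a1, a2, if_neg (by omega), if_neg (by omega)]
      · refine ⟨fun i hi j hj => ?_, a4, a5, b2⟩
        rw [a1, a2, if_pos ⟨rfl, hi⟩, if_pos ⟨rfl, hj⟩, (i2 t le_rfl).1, (i2 t le_rfl).2]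
        linear_combination (s.mat 4 t i * s.mat 5 t j) * hσ2
    · simp only [State.setReg, m4, m5]
      obtain ⟨c1, c2⟩ := i2 t (by omega)
      rw [← c1, ← c2]
      constructor
      · ext i; rw [a2, if_neg (by omega)]
      · ext i; rw [a1, if_neg (by omega)]
    · simp only [State.setReg, m12, m18]
      rw [a6, i3, Finset.sum_range_succ]
      congr 1
      exact Finset.sum_congr rfl fun t ht => (a3 t (Finset.mem_range.1 ht).ne).symm
    · simp only [State.setReg]
      rw [b3, m13, i4, Finset.sum_range_succ]
      congr 1
      exact Finset.sum_congr rfl fun t ht => by rw [b1 t (Finset.mem_range.1 ht).ne, m19]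

lemma run_toleranceCode {s s' : State} (hs' : s' = toleranceCode.run (BasisOp.act xb yb B) s)
    (r9 : s.reg 9 = 0) (h21 : s.mat 21 = 0)
    (hA : 0 < comb (prodBasis xb yb) (s.block n m 3)) :
    ∃ l : ℚ, 0 < l ∧ (l : ℝ) < comb (prodBasis xb yb) (s.block n m 3) ∧
      s'.mat 22 0 0 = l / (2 * s.mat 13 0 0) ∧
      s'.mat 25 0 0 = 1 - s'.mat 22 0 0 / s.mat 12 0 0 := by
  have h0 : comb (prodBasis xb yb) (s.block n m 21) = 0 := by
    simp [comb, State.block, h21]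
  have hB := B.onXY_spec (s.block n m 21) (s.block n m 3) (by rwa [h0])
  rw [h0] at hB
  refine ⟨_, by exact_mod_cast hB.1, hB.2, ?_, ?_⟩ <;>
    simp [hs', toleranceCode, run, BasisOp.act, State.put, State.get, ArithOp.eval, r9, two_mul]

lemma run_approximateRow {s s' : State} (hs' : s' = approximateRow.run (BasisOp.act xb yb B) s)
    (r0 : s.reg 0 = m) (r1 : s.reg 1 = n) (r9 : s.reg 9 = 0) {t : ℕ} (r4 : s.reg 4 = t)
    (h25 : s.mat 25 0 0 < 1) (hw : 0 < comb xb (s.row m 5 t)) :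
    (∀ j ≠ t, s'.mat 26 0 j = s.mat 26 0 j) ∧
    (s.mat 25 0 0 * comb xb (s.row m 5 t) < s'.mat 26 0 t ∧
      s'.mat 26 0 t < comb xb (s.row m 5 t)) ∧
    s'.mat 27 0 0 = s.mat 27 0 0 + s'.mat 26 0 t ∧
    (∀ j < m, s'.mat 28 0 j = s.mat 28 0 j + s.mat 5 t j) ∧
    ∀ i < n, s'.mat 29 0 i = s.mat 29 0 i + s'.mat 26 0 t * s.mat 4 t i := by
  simp only [approximateRow, run, BasisOp.act] at hs'
  rw [run_rowOp _ _ (by simp) (by simp) (by simp), run_rowOp _ _ (by simp) (by simp) (by simp),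
    run_rowOp _ _ (by simp) (by simp) (by simp), run_rowOp _ _ (by simp) (by simp) (by simp)] at hs'
  generalize hs₁ : State.fillRow s 5 _ _ _ _ = s₁ at hs'
  have q0 : s₁.reg 0 = m := by simp [← hs₁, State.fillRow, r0]
  have q1 : s₁.reg 1 = n := by simp [← hs₁, State.fillRow, r1]
  have q4 : s₁.reg 4 = t := by simp [← hs₁, State.fillRow, r4]
  have q9 : s₁.reg 9 = 0 := by simp [← hs₁, State.fillRow, r9]
  have hm : ∀ a, a ≠ 15 → s₁.mat a = s.mat a := by
    intro a ha; ext i j; simp [← hs₁, State.fillRow, ha]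
  have w5 : s₁.row m 5 t = s.row m 5 t := by
    ext j; simp [State.row, hm]
  have w15 : s₁.row m 15 0 = s.mat 25 0 0 • s.row m 5 t := by
    ext j
    simp [← hs₁, State.row, State.fillRow, State.getAt, State.setReg, State.get, ArithOp.eval, r0,
      r4, r9]
  have hB := B.onX_spec (s₁.row m 15 0) (s₁.row m 5 t) (by
    rw [w15, w5, comb_smul]
    have : ((s.mat 25 0 0 : ℚ) : ℝ) < 1 := by exact_mod_cast h25
    nlinarith)
  rw [q4, q9] at hs'
  generalize B.onX (s₁.row m 15 0) (s₁.row m 5 t) = β at hs' hB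
  rw [w15, w5, comb_smul] at hB
  have e26 : s'.mat 26 0 t = β := by simp [hs', State.fillRow, State.put, q4, q9]
  rw [e26]
  refine ⟨fun j hj => ?_, hB, ?_, fun j hj => ?_, fun i hi => ?_⟩
  · simp [hs', State.fillRow, State.put, q4, q9, hj, hm]
  · simp [hs', State.fillRow, State.put, State.get, ArithOp.eval, q4, q9, hm]
  · simp [hs', State.fillRow, State.put, State.getAt, State.setReg, State.get, ArithOp.eval, q0, q4,
      q9, hm, hj]
  · simp [hs', State.fillRow, State.put, State.getAt, State.setReg, State.get, ArithOp.eval, q1, q4,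
      q9, hm, hi]

lemma run_approximateCode {s s' : State} (hs' : s' = approximateCode.run (BasisOp.act xb yb B) s)
    (r0 : s.reg 0 = m) (r1 : s.reg 1 = n) (r9 : s.reg 9 = 0) (h25 : s.mat 25 0 0 < 1)
    (h27 : s.mat 27 = 0) (h28 : s.mat 28 = 0) (h29 : s.mat 29 = 0)
    (hw : ∀ t < s.reg 3, 0 < comb xb (s.row m 5 t)) :
    (∀ t < s.reg 3, s.mat 25 0 0 * comb xb (s.row m 5 t) < s'.mat 26 0 t ∧
      s'.mat 26 0 t < comb xb (s.row m 5 t)) ∧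
    s'.mat 27 0 0 = ∑ t ∈ Finset.range (s.reg 3), s'.mat 26 0 t ∧
    (∀ j < m, s'.mat 28 0 j = ∑ t ∈ Finset.range (s.reg 3), s.mat 5 t j) ∧
    ∀ i < n, s'.mat 29 0 i = ∑ t ∈ Finset.range (s.reg 3), s'.mat 26 0 t * s.mat 4 t i := by
  rw [hs']
  refine run_loop (s := s) (i := 4) (n := 3) (p := approximateRow) (targets_act xb yb B)
    rfl (fun k s' => (∀ t < k, s.mat 25 0 0 * comb xb (s.row m 5 t) < s'.mat 26 0 t ∧
        s'.mat 26 0 t < comb xb (s.row m 5 t)) ∧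
      s'.mat 27 0 0 = ∑ t ∈ Finset.range k, s'.mat 26 0 t ∧
      (∀ j < m, s'.mat 28 0 j = ∑ t ∈ Finset.range k, s.mat 5 t j) ∧
      ∀ i < n, s'.mat 29 0 i = ∑ t ∈ Finset.range k, s'.mat 26 0 t * s.mat 4 t i) ?_ ?_
  · simp [State.setReg, h27, h28, h29]
  · rintro k hk s₀ hF h4 ⟨i1, i2, i3, i4⟩
    have m4 : s₀.mat 4 = s.mat 4 := hF.mat 4 rfl
    have m5 : s₀.mat 5 = s.mat 5 := hF.mat 5 rfl
    have m25 : s₀.mat 25 = s.mat 25 := hF.mat 25 rfl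
    have w5 : s₀.row m 5 k = s.row m 5 k := by ext j; simp [State.row, m5]
    generalize hs₁ : approximateRow.run (BasisOp.act xb yb B) s₀ = s₁
    obtain ⟨a1, a2, a3, a4, a5⟩ := run_approximateRow hs₁.symm ((hF.reg 0 rfl).trans r0)
      ((hF.reg 1 rfl).trans r1) ((hF.reg 9 rfl).trans r9) h4 (by rwa [m25])
      (by rw [w5]; exact hw k hk)
    rw [w5, m25] at a2
    refine ⟨fun t ht => ?_, ?_, fun j hj => ?_, fun i hi => ?_⟩
    · simp only [State.setReg]
      rcases Nat.lt_succ_iff_lt_or_eq.1 ht with ht | rfl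
      · rw [a1 t ht.ne]; exact i1 t ht
      · exact a2
    · simp only [State.setReg]
      rw [a3, i2, Finset.sum_range_succ]
      congr 1
      exact Finset.sum_congr rfl fun t ht => (a1 t (Finset.mem_range.1 ht).ne).symm
    · simp only [State.setReg]
      rw [a4 j hj, i3 j hj, Finset.sum_range_succ, m5]
    · simp only [State.setReg]
      rw [a5 i hi, i4 i hi, Finset.sum_range_succ, m4]
      congr 1
      exact Finset.sum_congr rfl fun t ht => by rw [a1 t (Finset.mem_range.1 ht).ne]

lemma run_outputCode {f : BasisOp → State → State} {tgt : BasisOp → ℕ} (hf : Targets f tgt)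
    {s s' : State} (hs' : s' = outputCode.run f s) (r9 : s.reg 9 = 0) {t : ℕ} (ht : t < s.reg 3) :
    (∀ j < s.reg 0, s'.mat 0 t j = (s.mat 5 t j -
      s.mat 26 0 t / (s.mat 22 0 0 + s.mat 27 0 0) * s.mat 28 0 j) / s.mat 22 0 0) ∧
    ∀ i < s.reg 1, s'.mat 1 t i = s.mat 29 0 i + s.mat 22 0 0 * s.mat 4 t i := by
  rw [outputCode, run] at hs'
  generalize hs₁ : run f (arith _ _ _ _) s = s₁ at hs'
  have hF₁ := frame hf (arith .add ⟨27, 9, 9⟩ ⟨22, 9, 9⟩ ⟨27, 9, 9⟩) s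
  rw [hs₁] at hF₁
  have q3 : s₁.reg 3 = s.reg 3 := hF₁.reg 3 rfl
  -- The accumulated `∑ q i` becomes the denominator `a + ∑ q i` of the new rows.
  have m27 : s₁.mat 27 0 0 = s.mat 22 0 0 + s.mat 27 0 0 := by
    simp [← hs₁, run, State.put, State.get, ArithOp.eval, r9]
  have key := run_loop (s := s₁) (i := 4) (n := 3) (p := outputRow) hf
    rfl (fun k s' => t < k → (∀ j < s.reg 0, s'.mat 0 t j = (s.mat 5 t j -
      s.mat 26 0 t / (s.mat 22 0 0 + s.mat 27 0 0) * s.mat 28 0 j) / s.mat 22 0 0) ∧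
    ∀ i < s.reg 1, s'.mat 1 t i = s.mat 29 0 i + s.mat 22 0 0 * s.mat 4 t i) ?_ ?_
  · rw [q3] at key
    rw [hs']
    exact key ht
  · simp
  · intro k hk s₀ hF h4 ih hkt
    have q0 : s₀.reg 0 = s.reg 0 := (hF.reg 0 rfl).trans (hF₁.reg 0 rfl)
    have q1 : s₀.reg 1 = s.reg 1 := (hF.reg 1 rfl).trans (hF₁.reg 1 rfl)
    have q9 : s₀.reg 9 = 0 := ((hF.reg 9 rfl).trans (hF₁.reg 9 rfl)).trans r9
    have m4 : s₀.mat 4 = s.mat 4 := (hF.mat 4 rfl).trans (hF₁.mat 4 rfl)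
    have m5 : s₀.mat 5 = s.mat 5 := (hF.mat 5 rfl).trans (hF₁.mat 5 rfl)
    have m22 : s₀.mat 22 = s.mat 22 := (hF.mat 22 rfl).trans (hF₁.mat 22 rfl)
    have m26 : s₀.mat 26 = s.mat 26 := (hF.mat 26 rfl).trans (hF₁.mat 26 rfl)
    have m28 : s₀.mat 28 = s.mat 28 := (hF.mat 28 rfl).trans (hF₁.mat 28 rfl)
    have m29 : s₀.mat 29 = s.mat 29 := (hF.mat 29 rfl).trans (hF₁.mat 29 rfl)
    have m27' : s₀.mat 27 0 0 = s.mat 22 0 0 + s.mat 27 0 0 := by rw [hF.mat 27 rfl, m27]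
    simp only [outputRow, run]
    rw [run_rowOp _ _ (by simp) (by simp) (by simp), run_rowOp _ _ (by simp) (by simp) (by simp),
      run_rowOp _ _ (by simp) (by simp) (by simp), run_rowOp _ _ (by simp) (by simp) (by simp),
      run_rowOp _ _ (by simp) (by simp) (by simp)]
    rcases Nat.lt_succ_iff_lt_or_eq.1 hkt with hkt | rfl
    · obtain ⟨i1, i2⟩ := ih hkt
      refine ⟨fun j hj => ?_, fun i hi => ?_⟩
      · rw [← i1 j hj]
        simp [State.fillRow, State.put, State.setReg, h4, hkt.ne]
      · rw [← i2 i hi]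
        simp [State.fillRow, State.put, State.setReg, h4, hkt.ne]
    · refine ⟨fun j hj => ?_, fun i hi => ?_⟩
      · simp [State.fillRow, State.put, State.getAt, State.setReg, State.get, ArithOp.eval, q0,
          q9, h4, m5, m22, m26, m28, m27', hj]
      · simp [State.fillRow, State.put, State.getAt, State.setReg, State.get, ArithOp.eval, q1,
          q9, h4, m4, m22, m29, hi]

/-- The rectangles that are computed factorize the Dehn matrix and have positive sizes. -/
lemma run_rectangleCode {s s' : State} (hs' : s' = rectangleCode.run (BasisOp.act xb yb B) s)
    (r0 : s.reg 0 = m) (r1 : s.reg 1 = n) (r9 : s.reg 9 = 0) {D : Fin n → Fin m → ℚ}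
    (h3 : ∀ (k : Fin n) (l : Fin m), s.mat 3 k l = D k l)
    (hD : ∀ k l, D k l = ∑ t ∈ Finset.range (s.reg 3), s.mat 4 t k * s.mat 5 t l)
    (hA : 0 < comb (prodBasis xb yb) fun kl => D kl.1 kl.2)
    (hw : ∀ t < s.reg 3, comb xb (s.row m 5 t) ≠ 0)
    (hg : ∀ t < s.reg 3, comb yb (s.row n 4 t) ≠ 0)
    (h0 : ∀ a ≥ 11, a ≠ 15 → s.mat a = 0) :
    (∀ t : Fin (s.reg 3), 0 < comb xb (s'.row m 0 t) ∧ 0 < comb yb (s'.row n 1 t)) ∧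
      ∀ k l, D k l = ∑ t : Fin (s.reg 3), s'.row n 1 t k * s'.row m 0 t l := by
  have hf := targets_act xb yb B
  simp only [rectangleCode, run] at hs'
  generalize hs₁ : normalizeCode.run (BasisOp.act xb yb B) s = s₁ at hs'
  obtain ⟨a1, a2, a3⟩ := run_normalizeCode hs₁.symm r0 r1 r9 (by rw [h0 12 (by norm_num) (by norm_num)]; rfl)
    (by rw [h0 13 (by norm_num) (by norm_num)]; rfl) hw hg
  have hF₁ := frame hf normalizeCode s
  rw [hs₁] at hF₁
  have hblock : s₁.block n m 3 = fun kl => D kl.1 kl.2 := by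
    ext kl
    rw [State.block, hF₁.mat 3 rfl, h3]
  generalize hs₂ : toleranceCode.run (BasisOp.act xb yb B) s₁ = s₂ at hs'
  obtain ⟨l, b1, b2, b3, b4⟩ := run_toleranceCode hs₂.symm ((hF₁.reg 9 rfl).trans r9)
    ((hF₁.mat 21 rfl).trans (h0 21 (by norm_num) (by norm_num))) (by rwa [hblock])
  have hF₂ := frame hf toleranceCode s₁
  rw [hs₂] at hF₂
  have r3₂ : s₂.reg 3 = s.reg 3 := (hF₂.reg 3 rfl).trans (hF₁.reg 3 rfl)
  have m4₂ : s₂.mat 4 = s₁.mat 4 := hF₂.mat 4 rfl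
  have m5₂ : s₂.mat 5 = s₁.mat 5 := hF₂.mat 5 rfl
  have w5 : ∀ t, s₂.row m 5 t = s₁.row m 5 t := fun t => by ext j; simp [State.row, m5₂]
  set r := s.reg 3 with hr
  let g : Fin r → Fin n → ℚ := fun t => s₁.row n 4 t
  let w : Fin r → Fin m → ℚ := fun t => s₁.row m 5 t
  have hsum : ∀ (k : Fin n) (l : Fin m), D k l = ∑ t, g t k * w t l := by
    intro k l
    rw [hD, Finset.sum_range]
    exact Finset.sum_congr rfl fun t _ => ((a1 t t.2).1 k k.2 l l.2).symm
  have hA' : comb (prodBasis xb yb) (fun kl => D kl.1 kl.2) =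
      ∑ t, comb yb (g t) * comb xb (w t) := by
    rw [← comb_prodBasis]
    simp only [hsum]
  have hr0 : (Finset.univ : Finset (Fin r)).Nonempty := by
    by_contra hn
    rw [Finset.not_nonempty_iff_eq_empty] at hn
    rw [hA', hn, Finset.sum_empty] at hA
    exact lt_irrefl _ hA
  rw [hblock, hA'] at b2
  rw [a3, Finset.sum_range] at b3
  rw [a2, Finset.sum_range] at b4
  have hω : ∀ t : Fin r, comb xb (w t) < s₁.mat 18 0 t := fun t => (a1 t t.2).2.2.1
  have hu : ∀ t : Fin r, |comb yb (g t)| < s₁.mat 19 0 t := fun t => (a1 t t.2).2.2.2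
  have hw0 : ∀ t : Fin r, 0 < comb xb (w t) := fun t => (a1 t t.2).2.1
  have hΩ : 0 < ∑ t : Fin r, s₁.mat 18 0 t := Finset.sum_pos (fun t _ => by
    exact_mod_cast (hw0 t).trans (hω t)) hr0
  have hU : 0 < ∑ t : Fin r, s₁.mat 19 0 t := Finset.sum_pos (fun t _ => by
    exact_mod_cast (abs_nonneg _).trans_lt (hu t)) hr0
  have ha0 : 0 < s₂.mat 22 0 0 := by rw [b3]; positivity
  generalize hs₃ : approximateCode.run (BasisOp.act xb yb B) s₂ = s₃ at hs'
  obtain ⟨c1, c2, c3, c4⟩ := run_approximateCode hs₃.symm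
    (((hF₂.reg 0 rfl).trans (hF₁.reg 0 rfl)).trans r0)
    (((hF₂.reg 1 rfl).trans (hF₁.reg 1 rfl)).trans r1)
    (((hF₂.reg 9 rfl).trans (hF₁.reg 9 rfl)).trans r9)
    (by rw [b4]; linarith [div_pos ha0 hΩ])
    (((hF₂.mat 27 rfl).trans (hF₁.mat 27 rfl)).trans (h0 27 (by norm_num) (by norm_num)))
    (((hF₂.mat 28 rfl).trans (hF₁.mat 28 rfl)).trans (h0 28 (by norm_num) (by norm_num)))
    (((hF₂.mat 29 rfl).trans (hF₁.mat 29 rfl)).trans (h0 29 (by norm_num) (by norm_num)))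
    (fun t ht => by rw [w5]; exact (a1 t (r3₂ ▸ ht)).2.1)
  have hF₃ := frame hf approximateCode s₂
  rw [hs₃] at hF₃
  rw [r3₂] at c1 c2 c3 c4
  have r3₃ : s₃.reg 3 = r := (hF₃.reg 3 rfl).trans r3₂
  have r0₃ : s₃.reg 0 = m :=
    (hF₃.reg 0 rfl).trans (((hF₂.reg 0 rfl).trans (hF₁.reg 0 rfl)).trans r0)
  have r1₃ : s₃.reg 1 = n :=
    (hF₃.reg 1 rfl).trans (((hF₂.reg 1 rfl).trans (hF₁.reg 1 rfl)).trans r1)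
  have r9₃ : s₃.reg 9 = 0 :=
    (hF₃.reg 9 rfl).trans (((hF₂.reg 9 rfl).trans (hF₁.reg 9 rfl)).trans r9)
  have m22 : s₃.mat 22 = s₂.mat 22 := hF₃.mat 22 rfl
  have m4₃ : s₃.mat 4 = s₁.mat 4 := (hF₃.mat 4 rfl).trans m4₂
  have m5₃ : s₃.mat 5 = s₁.mat 5 := (hF₃.mat 5 rfl).trans m5₂
  obtain ⟨p1, p2, p3⟩ := positive_factorization (g := g) (w := w) (a := s₂.mat 22 0 0)
    (b := s₂.mat 22 0 0 / ∑ t : Fin r, s₁.mat 18 0 t) (q := fun t => s₃.mat 26 0 t)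
    hw0 hu hω b1 b2 b3 rfl (fun t => by
      have := c1 t t.2
      rw [b4, w5] at this
      exact_mod_cast this)
  have e1 : ∀ t : Fin r, s'.row n 1 t =
      ∑ i : Fin r, s₃.mat 26 0 i • g i + s₂.mat 22 0 0 • g t := by
    intro t
    ext i
    rw [State.row, (run_outputCode hf hs' r9₃ (t := t) (by rw [r3₃]; exact t.2)).2 i (by rw [r1₃]; exact i.2), c4 i i.2,
      Finset.sum_range, m22, m4₂, m4₃]
    simp [g, State.row]
  have e0 : ∀ t : Fin r, s'.row m 0 t = (1 / s₂.mat 22 0 0) •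
      (w t - (s₃.mat 26 0 t / (s₂.mat 22 0 0 + ∑ i : Fin r, s₃.mat 26 0 i)) • ∑ i, w i) := by
    intro t
    ext j
    rw [State.row, (run_outputCode hf hs' r9₃ (t := t) (by rw [r3₃]; exact t.2)).1 j (by rw [r0₃]; exact j.2), c2, c3 j j.2,
      Finset.sum_range, Finset.sum_range, m22, m5₂, m5₃, div_eq_mul_one_div, mul_comm]
    simp [w, State.row]
  refine ⟨fun t => ?_, fun k l => ?_⟩
  · rw [e0, e1]
    exact ⟨p2 t, p1 t⟩
  · rw [hsum, ← p3]
    exact Finset.sum_congr rfl fun t _ => by rw [e0, e1]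

end Code
/-! ### The algorithms -/

lemma exists_findsBetween {ι : Type} [Fintype ι] (b : ι → ℝ) : ∃ f, FindsBetween b f := by
  have h : ∀ u v : ι → ℚ, ∃ q : ℚ, comb b u < comb b v → comb b u < q ∧ (q : ℝ) < comb b v := by
    intro u v
    by_cases h : comb b u < comb b v
    · obtain ⟨q, hq⟩ := exists_rat_btwn h
      exact ⟨q, fun _ => hq⟩
    · exact ⟨0, fun h' => absurd h' h⟩
  choose f hf using h
  exact ⟨f, hf⟩

lemma nonempty_between {m n : ℕ} (xb : Fin m → ℝ) (yb : Fin n → ℝ) : Nonempty (Between xb yb) := by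
  obtain ⟨f, hf⟩ := exists_findsBetween xb
  obtain ⟨g, hg⟩ := exists_findsBetween yb
  obtain ⟨h, hh⟩ := exists_findsBetween (prodBasis xb yb)
  exact ⟨⟨f, g, h, hf, hg, hh⟩⟩

namespace PolygonInput

variable {m n : ℕ} {I : PolygonInput m n} {xb : Fin m → ℝ} {yb : Fin n → ℝ} {P : Set Plane}

lemma Describes.V_pos (hI : I.Describes xb yb P) : 0 < I.V := by
  by_contra hV
  have hV : IsEmpty (Fin I.V) := by
    rw [Nat.eq_zero_of_not_pos hV]; infer_instance
  have hfr := hI.boundary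
  rw [Set.iUnion_of_empty] at hfr
  obtain ⟨hne, hbd, -⟩ := hI.polygon
  rcases isClopen_iff.1 (isClopen_iff_frontier_eq_empty.2 hfr) with h | h
  · exact hne.ne_empty h
  · rw [h] at hbd
    exact NormedSpace.unbounded_univ ℝ Plane hbd

/-- Both factors of the size are positive: a polygon has a vertex, and over two empty bases all
vertices would coincide. Hence the size bounds all initial loop bounds. -/
lemma Describes.reg_encode_le_size (hI : I.Describes xb yb P) :
    ∀ r < 3, I.encode.reg r ≤ I.size := by
  have hV := hI.V_pos
  have hmn : 0 < m + n := by
    by_contra h0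
    obtain ⟨rfl, rfl⟩ : m = 0 ∧ n = 0 := by omega
    exact hI.nondegenerate ⟨0, hV⟩ (by simp [pt, comb])
  intro r hr
  have h1 : m + n ≤ I.size := Nat.le_mul_of_pos_left _ hV
  have h2 : I.V ≤ I.size := Nat.le_mul_of_pos_right _ hmn
  simp only [encode]
  split_ifs <;> omega

/-- The state in which the computation of the rectangles ends. -/
def rectangleState (I : PolygonInput m n) (xb : Fin m → ℝ) (yb : Fin n → ℝ) (B : Between xb yb) :
    State :=
  Code.rectangleCode.run (BasisOp.act xb yb B) (Code.rankCode.run (BasisOp.act xb yb B) I.encode)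

/-- Linear independence of the bases makes the nonzero rows and columns found by elimination have
nonzero values, as the normalization requires. The rank enters through an equation so that register
3 can be substituted for it in `Fin r`. -/
lemma Describes.rectangleState_spec (hI : I.Describes xb yb P) (hx : LinearIndependent ℚ xb)
    (hy : LinearIndependent ℚ yb) (B : Between xb yb) (b : Fin I.V) {r : ℕ}
    (hr : r = (I.dehnMatrix b).rank) :
    (I.rectangleState xb yb B).reg 3 = r ∧
    (∀ i : Fin r, 0 < (I.rectangleState xb yb B).outWidth xb i ∧
      0 < (I.rectangleState xb yb B).outHeight yb i) ∧
    DissectsInto P fun i : Fin r => rectangle ((I.rectangleState xb yb B).outWidth xb i)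
      ((I.rectangleState xb yb B).outHeight yb i) := by
  have hf := Code.targets_act xb yb B
  generalize hs' : I.rectangleState xb yb B = s'
  rw [rectangleState] at hs'
  generalize hs : Code.rankCode.run (BasisOp.act xb yb B) I.encode = s at hs'
  obtain ⟨a1, a2, a3, a4⟩ := Code.run_rankCode hf I b hs.symm
  have hF := Code.frame hf Code.rankCode I.encode
  rw [hs] at hF
  have hF' := Code.frame hf Code.rectangleCode s
  rw [hs'] at hF'
  rw [← a1] at hr
  obtain ⟨c1, c2⟩ := Code.run_rectangleCode (D := fun k l => I.dehnMatrix b k l) hs'.symm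
    (hF.reg 0 rfl) (hF.reg 1 rfl) (hF.reg 9 rfl) a2 a3 (hI.area_pos b)
    (fun t ht => mt (comb_eq_zero_iff hx _).1 (a4 t ht).2)
    (fun t ht => mt (comb_eq_zero_iff hy _).1 (a4 t ht).1)
    (fun a ha ha' => by
      rw [hF.mat a (by
        simp [Code.rankCode, Code.dehnCode, Code.dehnVertex, Code.dehnRow, Code.eliminateCode,
          Code.eliminateEntry, Code.pivotCode, Code.subtractRow, Code.rowOp, Code.writesMat]
        omega)]
      ext i j
      simp only [encode]
      rw [dif_neg (by omega), dif_neg (by omega)]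
      rfl)
  subst hr
  exact ⟨hF'.reg 3 rfl, c1, hI.dissectsInto b c2 c1⟩

/-- The rank of the Dehn matrix is the minimum number of rectangles. -/
lemma Describes.isLeast_rank (hI : I.Describes xb yb P) (hx : LinearIndependent ℚ xb)
    (hy : LinearIndependent ℚ yb) (b : Fin I.V) :
    IsLeast {r : ℕ | DissectsIntoRectangles P r} (I.dehnMatrix b).rank := by
  -- The rectangles computed with any choice of intermediate rationals show that the rank is
  -- attained, also for the program that never uses the bases.
  obtain ⟨B⟩ := nonempty_between xb yb
  obtain ⟨-, h1, h2⟩ := hI.rectangleState_spec hx hy B b rfl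
  exact ⟨⟨_, _, h1, h2⟩, fun r hr => hI.rank_dehnMatrix_le hx hy b hr⟩

end PolygonInput

end OrthoDissection

end

theorem mainTheorem4 :
    (∃ (prog : OrthoDissection.RationalProgram) (bound : Polynomial ℕ),
      ∀ (m n : ℕ) (xb : Fin m → ℝ) (yb : Fin n → ℝ),
        LinearIndependent ℚ xb → LinearIndependent ℚ yb →
        ∀ (I : OrthoDissection.PolygonInput m n) (P : Set OrthoDissection.Plane),
          I.Describes xb yb P →
          ∃ (t : ℕ) (s : OrthoDissection.State),
            OrthoDissection.RationalExec prog I.encode t s ∧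
            t ≤ bound.eval I.size ∧
            IsLeast {r : ℕ | OrthoDissection.DissectsIntoRectangles P r} s.outNumber ∧
            ∀ b : Fin I.V, s.outNumber = (I.dehnMatrix b).rank) ∧
    (∃ (prog : OrthoDissection.BasisProgram) (bound : Polynomial ℕ),
      ∀ (m n : ℕ) (xb : Fin m → ℝ) (yb : Fin n → ℝ),
        LinearIndependent ℚ xb → LinearIndependent ℚ yb →
        ∀ (B : OrthoDissection.Between xb yb)
          (I : OrthoDissection.PolygonInput m n) (P : Set OrthoDissection.Plane),
          I.Describes xb yb P →
          ∃ (t : ℕ) (s : OrthoDissection.State),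
            OrthoDissection.BasisExec xb yb B prog I.encode t s ∧
            t ≤ bound.eval I.size ∧
            IsLeast {r : ℕ | OrthoDissection.DissectsIntoRectangles P r} s.outNumber ∧
            (∀ i : Fin s.outNumber, 0 < s.outWidth xb i ∧ 0 < s.outHeight yb i) ∧
            OrthoDissection.DissectsInto P (fun i : Fin s.outNumber =>
              OrthoDissection.rectangle (s.outWidth xb i) (s.outHeight yb i))) := by
  refine ⟨⟨.seq OrthoDissection.Code.rankCode.compile (.copyReg 0 3),
    (OrthoDissection.Code.rankCode (Q := Empty)).cost + 1,
    fun m n xb yb hx hy I P hI => ?_⟩,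
    ⟨.seq OrthoDissection.Code.rankCode.compile
      (.seq OrthoDissection.Code.rectangleCode.compile (.copyReg 0 3)),
    (OrthoDissection.Code.rankCode (Q := OrthoDissection.BasisOp)).cost +
      OrthoDissection.Code.rectangleCode.cost + 1,
    fun m n xb yb hx hy B I P hI => ?_⟩⟩
  · have hf : OrthoDissection.Code.Targets
        (fun q : Empty => (q.elim : OrthoDissection.State → OrthoDissection.State))
        fun q => q.elim := fun q => q.elim
    obtain ⟨t, ht, he⟩ := OrthoDissection.Code.exists_exec hf OrthoDissection.Code.rankCode
      (b := 3) rfl I.encode hI.reg_encode_le_size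
    have hr := fun b => (OrthoDissection.Code.run_rankCode hf I b rfl).1
    refine ⟨t + 1, _, .seq he (.copyReg _ 0 3), ?_, ?_, hr⟩
    · simpa using ht
    · have := hI.isLeast_rank hx hy ⟨0, hI.V_pos⟩
      rwa [← hr] at this
  · have hf := OrthoDissection.Code.targets_act xb yb B
    obtain ⟨t₁, ht₁, he₁⟩ := OrthoDissection.Code.exists_exec hf OrthoDissection.Code.rankCode
      (b := 3) rfl I.encode hI.reg_encode_le_size
    let b : Fin I.V := ⟨0, hI.V_pos⟩
    have hr := (OrthoDissection.Code.run_rankCode hf I b rfl).1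
    have hF := OrthoDissection.Code.frame hf OrthoDissection.Code.rankCode I.encode
    obtain ⟨t₂, ht₂, he₂⟩ := OrthoDissection.Code.exists_exec hf OrthoDissection.Code.rectangleCode
      -- Loops now also run up to register 3, which holds the rank; it is at most `m` and hence at
      -- most the size.
      (b := 4) (M := I.size) rfl
      (OrthoDissection.Code.rankCode.run (OrthoDissection.BasisOp.act xb yb B) I.encode) (by
        intro r h
        rcases Nat.lt_succ_iff_lt_or_eq.1 h with h | rfl
        · rw [hF.reg r (OrthoDissection.Code.WellFormed.writesReg_eq_false h rfl)]
          exact hI.reg_encode_le_size r h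
        · rw [hr]
          exact (Matrix.rank_le_width _).trans (hI.reg_encode_le_size 0 (by norm_num)))
    obtain ⟨h3, hpos, hdis⟩ := hI.rectangleState_spec hx hy B b rfl
    refine ⟨t₁ + (t₂ + 1), _, .seq he₁ (.seq he₂ (.copyReg _ 0 3)), ?_, ?_⟩
    · simp only [Polynomial.eval_add, Polynomial.eval_one]
      omega
    · have hleast := hI.isLeast_rank hx hy b
      generalize (I.dehnMatrix b).rank = r at h3 hpos hdis hleast
      subst h3
      exact ⟨hleast, hpos, hdis⟩
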